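/- Let $\sigma\in\{1,-1\}$ and let $\rho_1,\rho_2$ be real with $-1<\rho_1\rho_2<0$ if $\sigma=1$ and $0<\rho_1\rho_2<1$ if $\sigma=-1$. Let $N\ge 1$, let $\hat a_1,\hat a_2,\dots$ be arbitrary complex numbers, and let $R$ be an integer with $R\ge 2N-1$, or $R=\infty$ in case the power series $\sum_{r\ge1}\hat a_r z^r$ has a positive radius of convergence. Put $\hat b=\mathrm i(1+\sigma\rho_1\rho_2)$ and $\hat p_0=\sqrt{\hat b(\hat b-\mathrm i)}+\hat b$ (where $\hat b(\hat b-\mathrm i)>0$), let $^*$ denote complex conjugation, and for $n,k,l\in\mathbb Z$ and $x,t\in\mathbb R$ define $$m^{(n,k,l)}=\frac{\mathrm i\hat p}{\hat p+\hat q}\Big(-\frac{\hat p}{\hat q}\Big)^{n}\Big(-\frac{\hat p-\mathrm i}{\hat q+\mathrm i}\Big)^{k}\Big(-\frac{\hat p-\hat b}{\hat q+\hat b}\Big)^{l}e^{\Theta},$$ $$\Theta=\frac{\rho_2}{\rho_1}(\hat p+\hat q)x+\frac{\mathrm i\rho_1\hat b}{\rho_2}\Big(\frac1{\hat p}+\frac1{\hat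 q}\Big)t+\sum_{r=1}^{R}\hat a_r\ln^r\Big(\frac{\hat p-\hat b}{\sqrt{\hat b(\hat b-\mathrm i)}}\Big)+\sum_{r=1}^{R}\hat a_r^*\ln^r\Big(\frac{\hat q+\hat b}{\sqrt{\hat b(\hat b-\mathrm i)}}\Big),$$ $$\tilde m^{(n,k,l)}_{i,j}=\frac{[(\hat p-\hat b)\partial_{\hat p}]^i}{i!}\frac{[(\hat q+\hat b)\partial_{\hat q}]^j}{j!}\,m^{(n,k,l)}\Big|_{\hat p=\hat p_0,\ \hat q=\hat p_0^*},\qquad \tau_{n,k,l}=\det_{1\le i,j\le N}\big(\tilde m^{(n,k,l)}_{2i-1,2j-1}\big),\qquad \Omega_0=-\frac{\hat p_0(\hat p_0-\mathrm i)}{\hat p_0^*(\hat p_0^*+\mathrm i)}.$$ Then, with $f=\tau_{0,0,0}$, $g=\Omega_0^{-N}\tau_{-1,1,0}$ and $h=\tau_{-1,0,1}$: (1) $f(x,t)\ne0$ and $f^*(x,t)=\tau_{-1,0,0}(x,t)$ for all real $x,t$, and the functions $$u=\rho_1\frac{g}{f^*}\,e^{\mathrm i(1+\sigma\rho_1\rho_2)\left(\frac{\rho_2}{\rho_1}x+\frac{\rho_1}{\rho_2}t\right)},\qquad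 v=\rho_2\frac{h}{f}\,e^{\mathrm i(1+\sigma\rho_1\rho_2)\left(\frac{\rho_2}{\rho_1}x+\frac{\rho_1}{\rho_2}t\right)}$$ (the rogue-wave solutions of order $N$) are a classical ($C^1$) solution on $\mathbb R^2$ of the massive Thirring model $\mathrm iu_x+v+\sigma u|v|^2=0$, $\mathrm iv_t+u+\sigma v|u|^2=0$. (2) The functions $\tau_{n,k,l}$ do not depend on the choice of $R$, so only $\hat a_1,\dots,\hat a_{2N-1}$ enter. (3) (The parameter $\alpha$ is reducible.) For every real $\alpha>0$ put $a=\mathrm i\alpha$, $b=a(1+\sigma\rho_1\rho_2)$, $p_0=\sqrt{b(b-a)}+b$, $\Omega_0^{(\alpha)}=-\frac{p_0(p_0-\mathrm i\alpha)}{p_0^*(p_0^*+\mathrm i\alpha)}$, and let $\tau^{(\alpha)}_{n,k,l}$ be the determinant with the elements $$\frac{[(p-b)\partial_p]^i}{i!}\frac{[(q+b)\partial_q]^j}{j!}\left[\frac{\mathrm ip}{p+q}\Big(-\frac pq\Big)^n\Big(-\frac{p-a}{q+a}\Big)^k\Big(-\frac{p-b}{q+b}\Big)^l e^{\Theta^{(\alpha)}}\right]_{p=p_0,\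 q=p_0^*},$$ $$\Theta^{(\alpha)}=\frac{\mathrm i\rho_2}{a\rho_1}(p+q)x+\frac{\mathrm i\rho_1b}{\rho_2}\Big(\frac1p+\frac1q\Big)t+\sum_{r=1}^{R}\hat a_r\ln^r\Big(\frac{p-b}{\sqrt{b(b-a)}}\Big)+\sum_{r=1}^{R}\hat a_r^*\ln^r\Big(\frac{q+b}{\sqrt{b(b-a)}}\Big)$$ in the places $(2i-1,2j-1)$, $1\le i,j\le N$. Then $\Omega_0^{(\alpha)}=\Omega_0$ and $\tau^{(\alpha)}_{n,k,l}=\tau_{n,k,l}$ for all $n,k,l$, so the solutions $u,v$ formed from $\tau^{(\alpha)}$ and $\Omega_0^{(\alpha)}$ are the same functions as above. -/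

import Mathlib

open scoped ComplexConjugate Nat

namespace MTRogue

/-- `(u, v)` is a classical solution on the whole plane of the massive Thirring model
`i u_x + v + σ u |v|² = 0`, `i v_t + u + σ v |u|² = 0`. -/
structure IsMTSolution (σ : ℝ) (u v : ℝ → ℝ → ℂ) : Prop where
  contDiff_u : ContDiff ℝ 1 (fun z : ℝ × ℝ => u z.1 z.2)
  contDiff_v : ContDiff ℝ 1 (fun z : ℝ × ℝ => v z.1 z.2)
  eq_x : ∀ x t : ℝ, Complex.I * deriv (fun x' : ℝ => u x' t) x + v x t
    + (σ : ℂ) * u x t * ((‖v x t‖ ^ 2 : ℝ) : ℂ) = 0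
  eq_t : ∀ x t : ℝ, Complex.I * deriv (fun t' : ℝ => v x t') t + u x t
    + (σ : ℂ) * v x t * ((‖u x t‖ ^ 2 : ℝ) : ℂ) = 0

/-- The power series `∑_{r ≥ 1} c_r z^r` has a positive radius of convergence. -/
def HasPosRadius (c : ℕ → ℂ) : Prop :=
  ∃ ε : ℝ, 0 < ε ∧ Summable (fun r : ℕ => ‖c (r + 1)‖ * ε ^ (r + 1))

/-- `∑_{r = 1}^{R} c_r z^r`, where `R = ∞` is allowed. -/
noncomputable def powerSum (R : ℕ∞) (c : ℕ → ℂ) (z : ℂ) : ℂ :=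
  ∑' r : ℕ, if ((r + 1 : ℕ) : ℕ∞) ≤ R then c (r + 1) * z ^ (r + 1) else 0

/-- The differential operator `(p - b) ∂_p` on functions of `(p, q)`. -/
noncomputable def opP (b : ℂ) (F : ℂ → ℂ → ℂ) : ℂ → ℂ → ℂ :=
  fun p q => (p - b) * deriv (fun p' : ℂ => F p' q) p

/-- The differential operator `(q + b) ∂_q` on functions of `(p, q)`. -/
noncomputable def opQ (b : ℂ) (F : ℂ → ℂ → ℂ) : ℂ → ℂ → ℂ :=
  fun p q => (q + b) * deriv (fun q' : ℂ => F p q') q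

/-- `[(p - b) ∂_p]^i / i! [(q + b) ∂_q]^j / j! F` evaluated at `p = p₀`, `q = p₀*`. -/
noncomputable def matElem (b p₀ : ℂ) (F : ℂ → ℂ → ℂ) (i j : ℕ) : ℂ :=
  ((opP b)^[i] ((opQ b)^[j] F)) p₀ (conj p₀) / ((i ! : ℂ) * (j ! : ℂ))

/-- The determinant of the elements with indices `(2i - 1, 2j - 1)`, `1 ≤ i, j ≤ N`
(the index type `Fin N` starts at `0`). -/
noncomputable def oddDet (N : ℕ) (b p₀ : ℂ) (F : ℂ → ℂ → ℂ) : ℂ :=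
  Matrix.det (Matrix.of fun i j : Fin N => matElem b p₀ F (2 * (i : ℕ) + 1) (2 * (j : ℕ) + 1))

section Reduced

/-- `b̂ = i (1 + σ ρ₁ ρ₂)`. -/
noncomputable def bHat (σ ρ₁ ρ₂ : ℝ) : ℂ := Complex.I * (1 + σ * ρ₁ * ρ₂)

/-- `√(b̂ (b̂ - i))`. -/
noncomputable def rootHat (σ ρ₁ ρ₂ : ℝ) : ℂ :=
  Complex.sqrt (bHat σ ρ₁ ρ₂ * (bHat σ ρ₁ ρ₂ - Complex.I))

/-- `p̂₀ = √(b̂ (b̂ - i)) + b̂`. -/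
noncomputable def pHat (σ ρ₁ ρ₂ : ℝ) : ℂ := rootHat σ ρ₁ ρ₂ + bHat σ ρ₁ ρ₂

/-- `Ω₀` in the variables without `α`. -/
noncomputable def OmegaHat (σ ρ₁ ρ₂ : ℝ) : ℂ :=
  -(pHat σ ρ₁ ρ₂ * (pHat σ ρ₁ ρ₂ - Complex.I))
    / (conj (pHat σ ρ₁ ρ₂) * (conj (pHat σ ρ₁ ρ₂) + Complex.I))

/-- The exponent `Θ` in the variables without `α`. -/
noncomputable def ThetaHat (σ ρ₁ ρ₂ : ℝ) (R : ℕ∞) (c : ℕ → ℂ) (x t : ℝ) (p q : ℂ) : ℂ :=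
  (ρ₂ : ℂ) / ρ₁ * (p + q) * x
    + Complex.I * ρ₁ * bHat σ ρ₁ ρ₂ / ρ₂ * (1 / p + 1 / q) * t
    + powerSum R c (Complex.log ((p - bHat σ ρ₁ ρ₂) / rootHat σ ρ₁ ρ₂))
    + powerSum R (fun r => conj (c r)) (Complex.log ((q + bHat σ ρ₁ ρ₂) / rootHat σ ρ₁ ρ₂))

/-- The function `m^{(n,k,l)}` in the variables without `α`. -/
noncomputable def mHat (σ ρ₁ ρ₂ : ℝ) (R : ℕ∞) (c : ℕ → ℂ) (n k l : ℤ) (x t : ℝ) (p q : ℂ) : ℂ :=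
  Complex.I * p / (p + q) * (-(p / q)) ^ n
    * (-((p - Complex.I) / (q + Complex.I))) ^ k
    * (-((p - bHat σ ρ₁ ρ₂) / (q + bHat σ ρ₁ ρ₂))) ^ l
    * Complex.exp (ThetaHat σ ρ₁ ρ₂ R c x t p q)

/-- The tau functions `τ_{n,k,l}` in the variables without `α`. -/
noncomputable def tauHat (σ ρ₁ ρ₂ : ℝ) (N : ℕ) (R : ℕ∞) (c : ℕ → ℂ) (n k l : ℤ) (x t : ℝ) : ℂ :=
  oddDet N (bHat σ ρ₁ ρ₂) (pHat σ ρ₁ ρ₂) (mHat σ ρ₁ ρ₂ R c n k l x t)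

end Reduced

section WithAlpha

/-- `a = i α`. -/
noncomputable def aPar (α : ℝ) : ℂ := Complex.I * α

/-- `b = a (1 + σ ρ₁ ρ₂)`. -/
noncomputable def bPar (α σ ρ₁ ρ₂ : ℝ) : ℂ := aPar α * (1 + σ * ρ₁ * ρ₂)

/-- `√(b (b - a))`. -/
noncomputable def rootPar (α σ ρ₁ ρ₂ : ℝ) : ℂ :=
  Complex.sqrt (bPar α σ ρ₁ ρ₂ * (bPar α σ ρ₁ ρ₂ - aPar α))

/-- `p₀ = √(b (b - a)) + b`. -/
noncomputable def pPar (α σ ρ₁ ρ₂ : ℝ) : ℂ := rootPar α σ ρ₁ ρ₂ + bPar α σ ρ₁ ρ₂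

/-- `Ω₀` in the variables with `α`. -/
noncomputable def OmegaPar (α σ ρ₁ ρ₂ : ℝ) : ℂ :=
  -(pPar α σ ρ₁ ρ₂ * (pPar α σ ρ₁ ρ₂ - Complex.I * α))
    / (conj (pPar α σ ρ₁ ρ₂) * (conj (pPar α σ ρ₁ ρ₂) + Complex.I * α))

/-- The exponent `Θ` in the variables with `α`. -/
noncomputable def ThetaPar (α σ ρ₁ ρ₂ : ℝ) (R : ℕ∞) (c : ℕ → ℂ) (x t : ℝ) (p q : ℂ) : ℂ :=
  Complex.I * ρ₂ / (aPar α * ρ₁) * (p + q) * x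
    + Complex.I * ρ₁ * bPar α σ ρ₁ ρ₂ / ρ₂ * (1 / p + 1 / q) * t
    + powerSum R c (Complex.log ((p - bPar α σ ρ₁ ρ₂) / rootPar α σ ρ₁ ρ₂))
    + powerSum R (fun r => conj (c r))
        (Complex.log ((q + bPar α σ ρ₁ ρ₂) / rootPar α σ ρ₁ ρ₂))

/-- The function `m^{(n,k,l)}` in the variables with `α`. -/
noncomputable def mPar (α σ ρ₁ ρ₂ : ℝ) (R : ℕ∞) (c : ℕ → ℂ) (n k l : ℤ) (x t : ℝ)
    (p q : ℂ) : ℂ :=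
  Complex.I * p / (p + q) * (-(p / q)) ^ n
    * (-((p - aPar α) / (q + aPar α))) ^ k
    * (-((p - bPar α σ ρ₁ ρ₂) / (q + bPar α σ ρ₁ ρ₂))) ^ l
    * Complex.exp (ThetaPar α σ ρ₁ ρ₂ R c x t p q)

/-- The tau functions `τ_{n,k,l}` in the variables with `α`. -/
noncomputable def tauPar (α σ ρ₁ ρ₂ : ℝ) (N : ℕ) (R : ℕ∞) (c : ℕ → ℂ) (n k l : ℤ)
    (x t : ℝ) : ℂ :=
  oddDet N (bPar α σ ρ₁ ρ₂) (pPar α σ ρ₁ ρ₂) (mPar α σ ρ₁ ρ₂ R c n k l x t)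

end WithAlpha

/-- The background plane wave `exp (i (1 + σ ρ₁ ρ₂) (ρ₂/ρ₁ x + ρ₁/ρ₂ t))`. -/
noncomputable def planeWave (σ ρ₁ ρ₂ x t : ℝ) : ℂ :=
  Complex.exp (Complex.I * (1 + σ * ρ₁ * ρ₂) * ((ρ₂ : ℂ) / ρ₁ * x + (ρ₁ : ℂ) / ρ₂ * t))

/-- `u = ρ₁ (g / f*) exp (…)` with `f = τ_{0,0,0}` and `g = Ω₀^{-N} τ_{-1,1,0}`. -/
noncomputable def waveU (σ ρ₁ ρ₂ : ℝ) (N : ℕ) (Ω : ℂ) (τ : ℤ → ℤ → ℤ → ℝ → ℝ → ℂ)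
    (x t : ℝ) : ℂ :=
  ρ₁ * (Ω ^ (-(N : ℤ)) * τ (-1) 1 0 x t / conj (τ 0 0 0 x t)) * planeWave σ ρ₁ ρ₂ x t

/-- `v = ρ₂ (h / f) exp (…)` with `f = τ_{0,0,0}` and `h = τ_{-1,0,1}`. -/
noncomputable def waveV (σ ρ₁ ρ₂ : ℝ) (τ : ℤ → ℤ → ℤ → ℝ → ℝ → ℂ) (x t : ℝ) : ℂ :=
  ρ₂ * (τ (-1) 0 1 x t / τ 0 0 0 x t) * planeWave σ ρ₁ ρ₂ x t

end MTRogue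

/-! Put b = iβ with β = 1 + σρ₁ρ₂ ∈ (0,1), r² = β(1-β), p = b + r e^X and q = -b + r e^Y. Then
(p-b)∂_p = ∂_X and (q+b)∂_q = ∂_Y, and the base point is X = Y = 0. The matrix elements are
therefore coefficients of the double power series of E(p)E*(q)/(p+q) times a rational weight, where
E is the exponential factor, and the analysis becomes algebra of formal series (`logTaylor₂_cauchy`,
`oddDet_eq`).

Parity drives the reduction. An even series acts on the vector of odd coefficients by a triangular
Toeplitz matrix (`oddVec_even_mul`). By the choice of r, p(p-i)/(p-b) equals 2r cosh X plus a
constant, hence is even. Multiplying the weight by -[p(p-i)/(p-b)]·[(q+b)/(q(q+i))] thus only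
multiplies the determinant by Ω₀^N, that is, τ_{n+1,k+1,l-1} = Ω₀^N τ_{n,k,l} (`det_raisedMat`,
`det_shiftMat_one`).

Let M be the matrix with weight p/(p+q). The weights of f*, g, h and of their conjugates differ from
it by a function of p times a function of q, so the matrices differ from M by rank one and their
determinants divided by det M have the form 1 - y·M⁻¹z. The derivative of M in x and in t also has
rank one. The two even series 2r cosh X and β/p + (1-β)/(p-i) satisfy Lyapunov identities T M + M
T'ᵀ = (rank two) (`lyapunov_evenFlow`, `lyapunov_evenPole`), from which `invForm_flow` extracts the
derivatives of f*/f in terms of hh* and gg*. Together with the derivatives of g/f and h/f*, the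
reduction and σρ₁ρ₂ = β-1, this gives the Thirring equations.

For f ≠ 0: Mᴴ = -(M - e eᴴ) for a vector e, so a kernel vector of M is orthogonal to e, and by the
Lyapunov identity also to a second vector. Hence the kernel is invariant under a Toeplitz matrix
that is nilpotent up to a scalar. If it were nonzero it would contain the first basis vector, which
contradicts the orthogonality (`IsWeightedKernel.det_gramMat_ne_zero`).

Independence of R holds because only orders below 2N enter the determinant. The parameter α
disappears under p ↦ αp, q ↦ αq. -/

namespace MTRogue

/-! ### Taylor series in the logarithmic variable -/

open PowerSeries Filter Topology

/-- The derivation `(z - b) d/dz`. -/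
noncomputable def logDer (b : ℂ) (A : ℂ → ℂ) : ℂ → ℂ := fun z => (z - b) * deriv A z

/-- The Taylor series of `A` at `z₀` in the variable `log (z - b)`. -/
noncomputable def logTaylor (b z₀ : ℂ) (A : ℂ → ℂ) : ℂ⟦X⟧ :=
  PowerSeries.mk fun n => (logDer b)^[n] A z₀ / n !

lemma coeff_logTaylor (b z₀ : ℂ) (A : ℂ → ℂ) (n : ℕ) :
    coeff n (logTaylor b z₀ A) = (logDer b)^[n] A z₀ / n ! := coeff_mk _ _

lemma constantCoeff_logTaylor (b z₀ : ℂ) (A : ℂ → ℂ) :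
    constantCoeff (logTaylor b z₀ A) = A z₀ := by
  rw [← coeff_zero_eq_constantCoeff_apply, coeff_logTaylor]; simp

lemma logDer_congr {b z₀ : ℂ} {A B : ℂ → ℂ} (h : A =ᶠ[𝓝 z₀] B) :
    logDer b A =ᶠ[𝓝 z₀] logDer b B := by
  filter_upwards [h.eventuallyEq_nhds] with z hz
  simp [logDer, hz.deriv_eq]

lemma logDer_iterate_congr {b z₀ : ℂ} {A B : ℂ → ℂ} (h : A =ᶠ[𝓝 z₀] B) (n : ℕ) :
    (logDer b)^[n] A =ᶠ[𝓝 z₀] (logDer b)^[n] B := by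
  induction n generalizing A B with
  | zero => exact h
  | succ n ih => exact ih (logDer_congr h)

lemma logTaylor_congr {b z₀ : ℂ} {A B : ℂ → ℂ} (h : A =ᶠ[𝓝 z₀] B) :
    logTaylor b z₀ A = logTaylor b z₀ B := by
  ext n
  simp only [coeff_logTaylor, (logDer_iterate_congr h n).eq_of_nhds]

lemma analyticAt_logDer {b z₀ : ℂ} {A : ℂ → ℂ} (h : AnalyticAt ℂ A z₀) :
    AnalyticAt ℂ (logDer b A) z₀ :=
  (analyticAt_id.sub analyticAt_const).mul h.deriv

lemma logDer_add {b z₀ : ℂ} {A B : ℂ → ℂ} (hA : AnalyticAt ℂ A z₀) (hB : AnalyticAt ℂ B z₀) :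
    logDer b (fun z => A z + B z) =ᶠ[𝓝 z₀] fun z => logDer b A z + logDer b B z := by
  filter_upwards [hA.eventually_analyticAt, hB.eventually_analyticAt] with z h1 h2
  simp only [logDer]
  rw [deriv_fun_add h1.differentiableAt h2.differentiableAt]; ring

lemma logDer_mul {b z₀ : ℂ} {A B : ℂ → ℂ} (hA : AnalyticAt ℂ A z₀) (hB : AnalyticAt ℂ B z₀) :
    logDer b (fun z => A z * B z) =ᶠ[𝓝 z₀]
      fun z => logDer b A z * B z + A z * logDer b B z := by
  filter_upwards [hA.eventually_analyticAt, hB.eventually_analyticAt] with z h1 h2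
  simp only [logDer]
  rw [deriv_fun_mul h1.differentiableAt h2.differentiableAt]; ring

lemma derivative_logTaylor (b z₀ : ℂ) (A : ℂ → ℂ) :
    d⁄dX ℂ (logTaylor b z₀ A) = logTaylor b z₀ (logDer b A) := by
  ext n
  rw [coeff_derivative, coeff_logTaylor, coeff_logTaylor, Function.iterate_succ_apply,
    Nat.factorial_succ]
  have h1 : (n ! : ℂ) ≠ 0 := by exact_mod_cast n.factorial_ne_zero
  have h2 : (n + 1 : ℂ) ≠ 0 := by exact_mod_cast n.succ_ne_zero
  push_cast
  field_simp

lemma logTaylor_add {b z₀ : ℂ} {A B : ℂ → ℂ} (hA : AnalyticAt ℂ A z₀) (hB : AnalyticAt ℂ B z₀) :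
    logTaylor b z₀ (fun z => A z + B z) = logTaylor b z₀ A + logTaylor b z₀ B := by
  ext n
  induction n generalizing A B with
  | zero => simp [constantCoeff_logTaylor]
  | succ n ih =>
    have h := ih (analyticAt_logDer (b := b) hA) (analyticAt_logDer (b := b) hB)
    rw [← logTaylor_congr (logDer_add hA hB)] at h
    simp only [map_add, ← derivative_logTaylor, coeff_derivative, ← add_mul] at h ⊢
    exact mul_right_cancel₀ (by exact_mod_cast n.succ_ne_zero) h

/-- By the Leibniz rule both sides have derivatives of the same shape, so the coefficients agree by
induction, with the two functions varying. -/
lemma logTaylor_mul {b z₀ : ℂ} {A B : ℂ → ℂ} (hA : AnalyticAt ℂ A z₀) (hB : AnalyticAt ℂ B z₀) :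
    logTaylor b z₀ (fun z => A z * B z) = logTaylor b z₀ A * logTaylor b z₀ B := by
  ext n
  induction n generalizing A B with
  | zero => simp [constantCoeff_logTaylor]
  | succ n ih =>
    have h1 := ih (analyticAt_logDer (b := b) hA) hB
    have h2 := ih hA (analyticAt_logDer (b := b) hB)
    have h3 := logTaylor_add (b := b) ((analyticAt_logDer (b := b) hA).mul hB)
      (hA.mul (analyticAt_logDer (b := b) hB))
    simp only [Pi.mul_apply] at h3
    have h4 := (congrArg (coeff n) (logTaylor_congr (b := b) (logDer_mul (b := b) hA hB))).trans
      (congrArg (coeff n) h3)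
    rw [map_add] at h4
    erw [h1, h2] at h4
    rw [← map_add] at h4
    have h5 : d⁄dX ℂ (logTaylor b z₀ A * logTaylor b z₀ B) =
        logTaylor b z₀ (logDer b A) * logTaylor b z₀ B
          + logTaylor b z₀ A * logTaylor b z₀ (logDer b B) := by
      rw [Derivation.leibniz, derivative_logTaylor, derivative_logTaylor]
      simp only [smul_eq_mul]; ring
    rw [← h5, ← derivative_logTaylor, coeff_derivative, coeff_derivative] at h4
    exact mul_right_cancel₀ (by exact_mod_cast n.succ_ne_zero) h4

lemma logDer_const (b c : ℂ) : logDer b (fun _ => c) = fun _ => 0 := by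
  funext z; simp [logDer]

lemma logTaylor_const (b z₀ c : ℂ) : logTaylor b z₀ (fun _ => c) = C c := by
  refine derivative.ext ?_ ?_
  · rw [derivative_logTaylor, logDer_const, derivative_C]
    ext n
    rw [coeff_logTaylor]
    have : (logDer b)^[n] (fun _ => (0 : ℂ)) = fun _ => 0 :=
      Function.iterate_fixed (logDer_const b 0) n
    simp [this]
  · simp [constantCoeff_logTaylor]

/-- The function z - b is fixed by the derivation, so z = b + (z₀ - b) e^X. -/
lemma logTaylor_sub_self (b z₀ : ℂ) :
    logTaylor b z₀ (fun z => z - b) = C (z₀ - b) * PowerSeries.exp ℂ := by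
  have h : logDer b (fun z => z - b) = fun z => z - b := by
    funext z; simp [logDer]
  ext n
  rw [coeff_logTaylor, Function.iterate_fixed h n, coeff_C_mul, coeff_exp]
  simp [div_eq_mul_inv]

lemma logTaylor_id (b z₀ : ℂ) :
    logTaylor b z₀ (fun z => z) = C b + C (z₀ - b) * PowerSeries.exp ℂ := by
  rw [← logTaylor_sub_self, ← logTaylor_const b z₀ b, ← logTaylor_add]
  · simp
  · exact analyticAt_const
  · exact analyticAt_id.sub analyticAt_const

lemma logTaylor_inv {b z₀ : ℂ} {A : ℂ → ℂ} (hA : AnalyticAt ℂ A z₀) (h0 : A z₀ ≠ 0) :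
    logTaylor b z₀ (fun z => (A z)⁻¹) = (logTaylor b z₀ A)⁻¹ := by
  rw [PowerSeries.eq_inv_iff_mul_eq_one (by rwa [constantCoeff_logTaylor])]
  rw [← logTaylor_mul (show AnalyticAt ℂ (fun z => (A z)⁻¹) z₀ from hA.inv h0) hA, ← map_one (C (R := ℂ)), ← logTaylor_const b z₀ 1]
  apply logTaylor_congr
  filter_upwards [hA.continuousAt.eventually_ne h0] with z hz
  exact inv_mul_cancel₀ hz

lemma derivative_logTaylor_exp {b z₀ : ℂ} {S : ℂ → ℂ} (hS : AnalyticAt ℂ S z₀) :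
    d⁄dX ℂ (logTaylor b z₀ fun z => Complex.exp (S z)) =
      d⁄dX ℂ (logTaylor b z₀ S) * logTaylor b z₀ fun z => Complex.exp (S z) := by
  rw [derivative_logTaylor, derivative_logTaylor,
    ← logTaylor_mul (analyticAt_logDer hS)
      (show AnalyticAt ℂ (fun z => Complex.exp (S z)) z₀ from hS.cexp)]
  apply logTaylor_congr
  filter_upwards [hS.eventually_analyticAt] with z hz
  simp only [logDer]
  rw [deriv_cexp hz.differentiableAt]; ring

/-- The derivation sends the logarithm to 1 and its value at z₀ is log 1 = 0. Hence the sums of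
powers of logarithms in Θ become power series in X with coefficients `a r`. -/
lemma logTaylor_log {b z₀ r : ℂ} (hr : r ≠ 0) (hz : z₀ - b = r) :
    logTaylor b z₀ (fun z => Complex.log ((z - b) / r)) = X := by
  have h1 : (z₀ - b) / r = 1 := by rw [hz, div_self hr]
  refine derivative.ext ?_ ?_
  · rw [derivative_logTaylor, derivative_X, ← map_one (C (R := ℂ)), ← logTaylor_const b z₀ 1]
    apply logTaylor_congr
    have hc : ContinuousAt (fun z : ℂ => (z - b) / r) z₀ := by fun_prop
    have : ∀ᶠ z in 𝓝 z₀, (z - b) / r ∈ Complex.slitPlane :=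
      hc.eventually (Complex.isOpen_slitPlane.mem_nhds (by simp only [h1]; exact Complex.one_mem_slitPlane))
    filter_upwards [this] with z hz
    have h0 : (z - b) / r ≠ 0 := Complex.slitPlane_ne_zero hz
    have h2 : z - b ≠ 0 := fun h => h0 (by simp [h])
    have h3 : HasDerivAt (fun z : ℂ => (z - b) / r) (1 / r) z :=
      ((hasDerivAt_id z).sub_const b).div_const r
    simp only [logDer]
    rw [(h3.clog hz).deriv]
    field_simp
  · simp [constantCoeff_logTaylor, h1]

lemma analyticAt_log_div {b z₀ r : ℂ} (hr : r ≠ 0) (hz : z₀ - b = r) :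
    AnalyticAt ℂ (fun z => Complex.log ((z - b) / r)) z₀ := by
  refine AnalyticAt.clog ((analyticAt_id.sub analyticAt_const).div analyticAt_const hr) ?_
  rw [hz, div_self hr]; exact Complex.one_mem_slitPlane

lemma logTaylor_sum {ι : Type*} (s : Finset ι) {b z₀ : ℂ} {A : ι → ℂ → ℂ}
    (hA : ∀ i, AnalyticAt ℂ (A i) z₀) :
    logTaylor b z₀ (fun z => ∑ i ∈ s, A i z) = ∑ i ∈ s, logTaylor b z₀ (A i) := by
  classical
  induction s using Finset.induction_on with
  | empty => simpa using logTaylor_const b z₀ 0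
  | insert i s hi ih =>
    simp only [Finset.sum_insert hi]
    rw [logTaylor_add (hA i) (Finset.analyticAt_fun_sum _ fun i _ => hA i), ih]

lemma logTaylor_pow {b z₀ : ℂ} {A : ℂ → ℂ} (hA : AnalyticAt ℂ A z₀) (n : ℕ) :
    logTaylor b z₀ (fun z => A z ^ n) = logTaylor b z₀ A ^ n := by
  induction n with
  | zero => simpa using logTaylor_const b z₀ 1
  | succ n ih => simp only [pow_succ]; rw [logTaylor_mul (show AnalyticAt ℂ (fun z => A z ^ n) z₀ from hA.pow n) hA, ih]

end MTRogue

/-! ### The sum of powers of logarithms in the exponent -/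

namespace MTRogue

open PowerSeries Filter Topology

/-- The coefficients of the power series cut off after the index `R`. -/
noncomputable def cutCoeff (R : ℕ∞) (c : ℕ → ℂ) (r : ℕ) : ℂ := if (r : ℕ∞) ≤ R then c r else 0

lemma powerSum_eq_tsum (R : ℕ∞) (c : ℕ → ℂ) (z : ℂ) :
    powerSum R c z = ∑' r : ℕ, cutCoeff R c (r + 1) * z ^ (r + 1) := by
  simp only [powerSum, cutCoeff, ite_mul, zero_mul]

lemma hasPosRadius_cutCoeff {R : ℕ∞} {c : ℕ → ℂ} (h : R = ⊤ → HasPosRadius c) :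
    HasPosRadius (cutCoeff R c) := by
  by_cases hR : R = ⊤
  · have : cutCoeff R c = c := by funext r; simp [cutCoeff, hR]
    rw [this]; exact h hR
  · refine ⟨1, one_pos, ?_⟩
    lift R to ℕ using hR
    refine summable_of_ne_finset_zero (s := Finset.range R) fun r hr => ?_
    have hr' : ¬ (r + 1 ≤ R) := by simp at hr; omega
    have : ¬ (((r + 1 : ℕ) : ℕ∞) ≤ (R : ℕ∞)) := by exact_mod_cast hr'
    simp only [cutCoeff, if_neg this]; simp

lemma HasPosRadius.conj {c : ℕ → ℂ} (h : HasPosRadius c) : HasPosRadius fun r => conj (c r) := by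
  obtain ⟨ε, h0, h1⟩ := h
  exact ⟨ε, h0, by simpa using h1⟩

/-- The remainder after K terms is z^(K+1) times an analytic function and is invisible to the
coefficients of order at most K. This avoids differentiating the infinite sum term by term. -/
lemma exists_tsum_eq_sum_add {d : ℕ → ℂ} (h : HasPosRadius d) (K : ℕ) :
    ∃ g : ℂ → ℂ, AnalyticAt ℂ g 0 ∧ ∀ᶠ z in 𝓝 (0 : ℂ),
      ∑' r : ℕ, d (r + 1) * z ^ (r + 1) =
        ∑ r ∈ Finset.range K, d (r + 1) * z ^ (r + 1) + z ^ (K + 1) * g z := by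
  obtain ⟨ε, h0, h1⟩ := h
  have hball : Metric.ball (0 : ℂ) ε ∈ 𝓝 (0 : ℂ) := Metric.ball_mem_nhds _ h0
  refine ⟨fun z => ∑' r : ℕ, d (r + K + 1) * z ^ r, ?_, ?_⟩
  · refine DifferentiableOn.analyticAt (s := Metric.ball (0 : ℂ) ε) ?_ hball
    refine Complex.differentiableOn_tsum_of_summable_norm
      (u := fun r => ‖d (r + K + 1)‖ * ε ^ r) ?_ ?_ Metric.isOpen_ball ?_
    · have h2 := ((summable_nat_add_iff K).2 h1).mul_right ((ε ^ (K + 1))⁻¹)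
      refine h2.congr fun r => ?_
      have : ε ^ (r + K + 1) = ε ^ r * ε ^ (K + 1) := by ring
      rw [this, mul_assoc, mul_assoc, mul_inv_cancel₀ (by positivity), mul_one]
    · intro r; fun_prop
    · intro r z hz
      rw [norm_mul, norm_pow]
      have : ‖z‖ ≤ ε := by simpa using (Metric.mem_ball.1 hz).le
      gcongr
  · filter_upwards [hball] with z hz
    have hz' : ‖z‖ ≤ ε := by simpa using (Metric.mem_ball.1 hz).le
    have hs : Summable fun r : ℕ => d (r + 1) * z ^ (r + 1) := by
      refine Summable.of_norm_bounded h1 fun r => ?_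
      rw [norm_mul, norm_pow]
      gcongr
    rw [← hs.sum_add_tsum_nat_add K, ← tsum_mul_left]
    congr 1
    refine tsum_congr fun r => ?_
    ring

lemma analyticAt_powerSum {R : ℕ∞} {c : ℕ → ℂ} (h : R = ⊤ → HasPosRadius c) :
    AnalyticAt ℂ (powerSum R c) 0 := by
  obtain ⟨g, hg, h1⟩ := exists_tsum_eq_sum_add (hasPosRadius_cutCoeff h) 0
  refine AnalyticAt.congr (f := fun z => z * g z) (analyticAt_id.mul hg) ?_
  filter_upwards [h1] with z hz
  rw [powerSum_eq_tsum, hz]; simp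

lemma analyticAt_powerSum_log {R : ℕ∞} {c : ℕ → ℂ} (h : R = ⊤ → HasPosRadius c) {b z₀ r : ℂ}
    (hr : r ≠ 0) (hz : z₀ - b = r) :
    AnalyticAt ℂ (fun z => powerSum R c (Complex.log ((z - b) / r))) z₀ := by
  have h1 : Complex.log ((z₀ - b) / r) = 0 := by rw [hz, div_self hr, Complex.log_one]
  exact AnalyticAt.fun_comp (f := fun z => Complex.log ((z - b) / r))
    (by rw [h1]; exact analyticAt_powerSum h) (analyticAt_log_div hr hz)

lemma coeff_logTaylor_powerSum {R : ℕ∞} {c : ℕ → ℂ} (h : R = ⊤ → HasPosRadius c) {b z₀ r : ℂ}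
    (hr : r ≠ 0) (hz : z₀ - b = r) (n : ℕ) :
    coeff n (logTaylor b z₀ fun z => powerSum R c (Complex.log ((z - b) / r))) =
      if n = 0 then 0 else cutCoeff R c n := by
  obtain ⟨g, hg, h1⟩ := exists_tsum_eq_sum_add (hasPosRadius_cutCoeff h) n
  have h0 : Complex.log ((z₀ - b) / r) = 0 := by rw [hz, div_self hr, Complex.log_one]
  have hl := analyticAt_log_div hr hz
  have hg' : AnalyticAt ℂ (fun z => g (Complex.log ((z - b) / r))) z₀ :=
    AnalyticAt.fun_comp (f := fun z => Complex.log ((z - b) / r)) (by rwa [h0]) hl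
  have hpow : ∀ k : ℕ, AnalyticAt ℂ (fun z => Complex.log ((z - b) / r) ^ k) z₀ := fun k => hl.pow k
  have hterm : ∀ k : ℕ, AnalyticAt ℂ
      (fun z => cutCoeff R c (k + 1) * Complex.log ((z - b) / r) ^ (k + 1)) z₀ :=
    fun k => analyticAt_const.mul (hpow _)
  have hlim : Tendsto (fun z => Complex.log ((z - b) / r)) (𝓝 z₀) (𝓝 0) := by
    have := hl.continuousAt.tendsto
    rwa [h0] at this
  have e1 : (fun z => powerSum R c (Complex.log ((z - b) / r))) =ᶠ[𝓝 z₀] fun z =>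
      (∑ k ∈ Finset.range n, cutCoeff R c (k + 1) * Complex.log ((z - b) / r) ^ (k + 1)) +
        Complex.log ((z - b) / r) ^ (n + 1) * g (Complex.log ((z - b) / r)) := by
    filter_upwards [hlim.eventually h1] with z hz
    rw [powerSum_eq_tsum, hz]
  rw [logTaylor_congr e1, logTaylor_add (Finset.analyticAt_fun_sum _ fun k _ => hterm k)
    ((hpow _).fun_mul hg'), logTaylor_sum _ hterm, logTaylor_mul (hpow _) hg', logTaylor_pow hl,
    logTaylor_log hr hz]
  have e2 : ∀ k, logTaylor b z₀
      (fun z => cutCoeff R c (k + 1) * Complex.log ((z - b) / r) ^ (k + 1)) =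
        C (cutCoeff R c (k + 1)) * X ^ (k + 1) := fun k => by
    rw [logTaylor_mul analyticAt_const (hpow _), logTaylor_const, logTaylor_pow hl,
      logTaylor_log hr hz]
  simp only [e2, map_add, map_sum, coeff_C_mul, coeff_X_pow]
  -- The remainder carries the factor X^(n+1), so it has no coefficient of order n.
  rw [coeff_X_pow_mul', if_neg (by omega), add_zero]
  rcases n with _ | n
  · simp
  · simp

end MTRogue

/-! ### Double series and the Cauchy kernel 1/(p+q) -/

namespace MTRogue

open PowerSeries Filter Topology

lemma opQ_iterate (b : ℂ) (F : ℂ → ℂ → ℂ) (j : ℕ) (p : ℂ) :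
    (opQ b)^[j] F p = (logDer (-b))^[j] (F p) := by
  induction j generalizing F with
  | zero => rfl
  | succ j ih =>
    rw [Function.iterate_succ_apply, Function.iterate_succ_apply, ih]
    congr 1
    funext q
    simp [opQ, logDer]

lemma opP_iterate (b : ℂ) (F : ℂ → ℂ → ℂ) (i : ℕ) (p q : ℂ) :
    (opP b)^[i] F p q = (logDer b)^[i] (fun p' => F p' q) p := by
  induction i generalizing F with
  | zero => rfl
  | succ i ih =>
    rw [Function.iterate_succ_apply, Function.iterate_succ_apply, ih]
    rfl

lemma logDer_iterate_div_const (b c : ℂ) (A : ℂ → ℂ) (n : ℕ) :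
    (logDer b)^[n] (fun z => A z / c) = fun z => (logDer b)^[n] A z / c := by
  induction n generalizing A with
  | zero => rfl
  | succ n ih =>
    rw [Function.iterate_succ_apply, Function.iterate_succ_apply, ← ih]
    congr 1
    funext z
    simp only [logDer, deriv_div_const]
    ring

lemma analyticAt_self (z : ℂ) : AnalyticAt ℂ (fun w : ℂ => w) z := analyticAt_id

/-- The double Taylor series of `F` at `(p₀, q₀)` in the variables `log (p - b)` (inner) and
`log (q + b)` (outer). -/
noncomputable def logTaylor₂ (b p₀ q₀ : ℂ) (F : ℂ → ℂ → ℂ) : ℂ⟦X⟧⟦X⟧ :=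
  PowerSeries.mk fun j => logTaylor b p₀ fun p => coeff j (logTaylor (-b) q₀ (F p))

lemma matElem_eq_coeff (b p₀ : ℂ) (F : ℂ → ℂ → ℂ) (i j : ℕ) :
    matElem b p₀ F i j = coeff i (coeff j (logTaylor₂ b p₀ (conj p₀) F)) := by
  rw [logTaylor₂, coeff_mk, coeff_logTaylor, matElem, opP_iterate]
  simp only [opQ_iterate, coeff_logTaylor]
  rw [logDer_iterate_div_const, div_div, mul_comm (j ! : ℂ)]

/-- The recursion for the coefficients of an inverse divides only by the constant term p + V(0),
which does not vanish at p₀. -/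
lemma analyticAt_coeff_inv {V : ℂ⟦X⟧} {p₀ : ℂ} (h : p₀ + constantCoeff V ≠ 0) (j : ℕ) :
    AnalyticAt ℂ (fun p => coeff j (C p + V)⁻¹) p₀ := by
  have h0 : AnalyticAt ℂ (fun p : ℂ => (p + constantCoeff V)⁻¹) p₀ :=
    (analyticAt_id.add analyticAt_const).inv h
  have hc : ∀ k, AnalyticAt ℂ (fun p : ℂ => coeff k (C p + V)) p₀ := fun k => by
    simp only [map_add, coeff_C]
    split_ifs
    · exact analyticAt_id.add analyticAt_const
    · exact analyticAt_const.add analyticAt_const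
  induction j using Nat.strong_induction_on with
  | _ j ih =>
    have e : (fun p : ℂ => coeff j (C p + V)⁻¹) = fun p : ℂ => if j = 0 then
        (p + constantCoeff V)⁻¹ else -(p + constantCoeff V)⁻¹ *
          ∑ x ∈ Finset.HasAntidiagonal.antidiagonal j, if x.2 < j then
            coeff x.1 (C p + V) * coeff x.2 (C p + V)⁻¹ else 0 := by
      funext p
      rw [PowerSeries.coeff_inv, map_add, constantCoeff_C]
    rw [e]
    split_ifs with hj
    · exact h0
    · refine h0.neg.mul (Finset.analyticAt_fun_sum _ fun x _ => ?_)
      split_ifs with hx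
      · exact (hc x.1).mul (ih x.2 hx)
      · exact analyticAt_const

/-- The double Taylor series of `1 / (p + q)`. -/
noncomputable def cauchyKernel (b p₀ q₀ : ℂ) : ℂ⟦X⟧⟦X⟧ :=
  PowerSeries.mk fun j => logTaylor b p₀ fun p =>
    coeff j (C p + logTaylor (-b) q₀ fun q => q)⁻¹

/-- Only 1/(p+q) couples the variables. Expanding in q at fixed p makes its coefficients analytic
functions of p, which are then expanded at p₀; the factors A and B multiply from outside. -/
lemma logTaylor₂_cauchy {b p₀ q₀ : ℂ} (h : p₀ + q₀ ≠ 0) {A B : ℂ → ℂ}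
    (hA : AnalyticAt ℂ A p₀) (hB : AnalyticAt ℂ B q₀) :
    logTaylor₂ b p₀ q₀ (fun p q => A p * B q / (p + q)) =
      C (logTaylor b p₀ A) * (PowerSeries.map C (logTaylor (-b) q₀ B) * cauchyKernel b p₀ q₀) := by
  have hk : ∀ j, AnalyticAt ℂ (fun p => coeff j (C p + logTaylor (-b) q₀ fun q => q)⁻¹) p₀ :=
    analyticAt_coeff_inv (by simpa [constantCoeff_logTaylor] using h)
  ext1 j
  have hev : (fun p => coeff j (logTaylor (-b) q₀ fun q => A p * B q / (p + q))) =ᶠ[𝓝 p₀]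
      fun p => A p * ∑ x ∈ Finset.HasAntidiagonal.antidiagonal j, coeff x.1 (logTaylor (-b) q₀ B) *
        coeff x.2 (C p + logTaylor (-b) q₀ fun q => q)⁻¹ := by
    have hne : ∀ᶠ p in 𝓝 p₀, p + q₀ ≠ 0 :=
      (continuousAt_id.add continuousAt_const).eventually_ne h
    filter_upwards [hne] with p hp
    have hinv : AnalyticAt ℂ (fun q : ℂ => (p + q)⁻¹) q₀ :=
      (analyticAt_const.add analyticAt_id).inv hp
    have e1 : (fun q => A p * B q / (p + q)) = fun q => A p * (B q * (p + q)⁻¹) := by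
      funext q; rw [div_eq_mul_inv, mul_assoc]
    rw [e1, logTaylor_mul analyticAt_const (hB.fun_mul hinv), logTaylor_const, coeff_C_mul,
      logTaylor_mul hB hinv,
      logTaylor_inv (A := fun q => p + q) (analyticAt_const.add analyticAt_id) hp,
      logTaylor_add analyticAt_const (analyticAt_self _), logTaylor_const, coeff_mul]
  have hterm : ∀ x : ℕ × ℕ, AnalyticAt ℂ (fun p => coeff x.1 (logTaylor (-b) q₀ B) *
        coeff x.2 (C p + logTaylor (-b) q₀ fun q => q)⁻¹) p₀ := fun x =>
    analyticAt_const.mul (hk x.2)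
  rw [logTaylor₂, coeff_mk, logTaylor_congr hev,
    logTaylor_mul hA (Finset.analyticAt_fun_sum _ fun x _ => hterm x), logTaylor_sum _ hterm,
    coeff_C_mul, coeff_mul]
  congr 1
  refine Finset.sum_congr rfl fun x _ => ?_
  rw [logTaylor_mul analyticAt_const (hk x.2), logTaylor_const, coeff_map, cauchyKernel, coeff_mk]

/-- The kernel is the formal inverse of p + q. The bilinear identities and the conjugation symmetry
need nothing else about it. -/
lemma add_mul_cauchyKernel {b p₀ q₀ : ℂ} (h : p₀ + q₀ ≠ 0) :
    (C (logTaylor b p₀ fun p => p) + PowerSeries.map C (logTaylor (-b) q₀ fun q => q)) *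
      cauchyKernel b p₀ q₀ = 1 := by
  have hk : ∀ j, AnalyticAt ℂ (fun p => coeff j (C p + logTaylor (-b) q₀ fun q => q)⁻¹) p₀ :=
    analyticAt_coeff_inv (by simpa [constantCoeff_logTaylor] using h)
  ext1 j
  have hterm : ∀ x : ℕ × ℕ, AnalyticAt ℂ (fun p => coeff x.1 (logTaylor (-b) q₀ fun q => q) *
        coeff x.2 (C p + logTaylor (-b) q₀ fun q => q)⁻¹) p₀ := fun x =>
    analyticAt_const.mul (hk x.2)
  have hev : (fun p => p * coeff j (C p + logTaylor (-b) q₀ fun q => q)⁻¹ +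
      ∑ x ∈ Finset.HasAntidiagonal.antidiagonal j, coeff x.1 (logTaylor (-b) q₀ fun q => q) *
        coeff x.2 (C p + logTaylor (-b) q₀ fun q => q)⁻¹) =ᶠ[𝓝 p₀]
      fun _ => coeff j (1 : ℂ⟦X⟧) := by
    have hne : ∀ᶠ p in 𝓝 p₀, p + q₀ ≠ 0 :=
      (continuousAt_id.add continuousAt_const).eventually_ne h
    filter_upwards [hne] with p hp
    rw [← PowerSeries.mul_inv_cancel (C p + logTaylor (-b) q₀ fun q => q)
      (by simpa [constantCoeff_logTaylor] using hp), add_mul, map_add, coeff_C_mul, coeff_mul]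
  have h1 := logTaylor_congr (b := b) hev
  rw [logTaylor_add ((analyticAt_self _).fun_mul (hk j))
    (Finset.analyticAt_fun_sum _ fun x _ => hterm x), logTaylor_sum _ hterm,
    logTaylor_mul (analyticAt_self _) (hk j), logTaylor_const] at h1
  have h2 : C (coeff j (1 : ℂ⟦X⟧)) = coeff j (1 : ℂ⟦X⟧⟦X⟧) := by
    simp only [coeff_one]; split_ifs <;> simp
  rw [← h2, ← h1, add_mul, map_add, coeff_C_mul, coeff_mul]
  congr 1
  · rw [cauchyKernel, coeff_mk]
  · refine Finset.sum_congr rfl fun x _ => ?_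
    rw [logTaylor_mul analyticAt_const (hk x.2), logTaylor_const, coeff_map, cauchyKernel, coeff_mk]

end MTRogue

/-! ### Even series acting on odd coefficients, and conjugation -/

namespace MTRogue

open PowerSeries Matrix

section Series

lemma sum_range_two_mul {R : Type*} [AddCommMonoid R] (h : ℕ → R) (n : ℕ) :
    ∑ k ∈ Finset.range (2 * n), h k = ∑ m ∈ Finset.range n, (h (2 * m) + h (2 * m + 1)) := by
  induction n with
  | zero => simp
  | succ n ih =>
    rw [show 2 * (n + 1) = 2 * n + 1 + 1 by ring, Finset.sum_range_succ, Finset.sum_range_succ, ih,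
      Finset.sum_range_succ, add_assoc]

/-- A power series is even if it is invariant under `X ↦ -X`. -/
def IsEven {R : Type*} [CommRing R] (U : R⟦X⟧) : Prop := rescale (-1 : R) U = U

lemma IsEven.coeff_odd {U : ℂ⟦X⟧} (h : IsEven U) (m : ℕ) : coeff (2 * m + 1) U = 0 := by
  have h1 := congrArg (coeff (2 * m + 1)) h
  rw [coeff_rescale, pow_succ, pow_mul] at h1
  simp only [even_two, Even.neg_pow, one_pow, mul_neg, mul_one, neg_mul, one_mul] at h1
  have : (2 : ℂ) * coeff (2 * m + 1) U = 0 := by linear_combination -h1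
  simpa using this

lemma IsEven.inv {U : ℂ⟦X⟧} (h : IsEven U) (h0 : constantCoeff U ≠ 0) : IsEven U⁻¹ := by
  rw [IsEven, PowerSeries.eq_inv_iff_mul_eq_one h0]
  nth_rewrite 2 [← h]
  rw [← map_mul, PowerSeries.inv_mul_cancel _ h0, map_one]

/-- The lower triangular matrix of the multiplication by an even series on odd coefficients. -/
noncomputable def evenToeplitz (N : ℕ) (U : ℂ⟦X⟧) : Matrix (Fin N) (Fin N) ℂ :=
  Matrix.of fun i l => if (l : ℕ) ≤ i then coeff (2 * ((i : ℕ) - l)) U else 0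

/-- In a pair with odd sum 2i+1 exactly one index is odd. Since `f` vanishes at odd indices, only
the pairs with odd second index remain, and `g` is sampled at odd indices alone. -/
lemma sum_antidiagonal_odd {R : Type*} [CommRing R] {N : ℕ} (f g : ℕ → R)
    (hf : ∀ m, f (2 * m + 1) = 0) (i : Fin N) :
    ∑ x ∈ Finset.HasAntidiagonal.antidiagonal (2 * (i : ℕ) + 1), f x.1 * g x.2 =
      ∑ l : Fin N, (if (l : ℕ) ≤ i then f (2 * ((i : ℕ) - l)) else 0) * g (2 * (l : ℕ) + 1) := by
  rw [← Finset.Nat.sum_antidiagonal_swap]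
  simp only [Prod.fst_swap, Prod.snd_swap]
  rw [Finset.Nat.sum_antidiagonal_eq_sum_range_succ_mk]
  simp only
  rw [show (2 * (i : ℕ) + 1).succ = 2 * ((i : ℕ) + 1) by omega, sum_range_two_mul]
  rw [Fin.sum_univ_eq_sum_range
    (fun l => (if l ≤ (i : ℕ) then f (2 * ((i : ℕ) - l)) else 0) * g (2 * l + 1)) N]
  -- The terms with l > i vanish, so the sum over the first i+1 indices extends to all N.
  have hi := i.2
  rw [← Finset.sum_subset (Finset.range_subset_range.2 (by omega : (i : ℕ) + 1 ≤ N))]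
  · refine Finset.sum_congr rfl fun m hm => ?_
    have hm' : m ≤ i := by simpa [Nat.lt_succ_iff] using hm
    rw [if_pos hm', show 2 * (i : ℕ) + 1 - 2 * m = 2 * ((i : ℕ) - m) + 1 by omega, hf,
      show 2 * (i : ℕ) + 1 - (2 * m + 1) = 2 * ((i : ℕ) - m) by omega]
    ring
  · intro m _ hm
    have hm' : ¬ m ≤ i := by simpa [Nat.lt_succ_iff] using hm
    rw [if_neg hm', zero_mul]

/-- The vector of the odd coefficients. -/
noncomputable def oddVec (N : ℕ) (U : ℂ⟦X⟧) : Fin N → ℂ := fun i => coeff (2 * (i : ℕ) + 1) U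

/-- The matrix of the odd coefficients of a double series. -/
noncomputable def oddMat (N : ℕ) (F : ℂ⟦X⟧⟦X⟧) : Matrix (Fin N) (Fin N) ℂ :=
  Matrix.of fun i j => coeff (2 * (i : ℕ) + 1) (coeff (2 * (j : ℕ) + 1) F)

variable {N : ℕ}

lemma oddVec_add (U V : ℂ⟦X⟧) : oddVec N (U + V) = oddVec N U + oddVec N V := by
  ext i; simp [oddVec]

lemma oddVec_sub (U V : ℂ⟦X⟧) : oddVec N (U - V) = oddVec N U - oddVec N V := by
  ext i; simp [oddVec]

lemma oddVec_C_mul (c : ℂ) (U : ℂ⟦X⟧) : oddVec N (C c * U) = c • oddVec N U := by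
  ext i; simp [oddVec]

lemma oddMat_add (U V : ℂ⟦X⟧⟦X⟧) : oddMat N (U + V) = oddMat N U + oddMat N V := by
  ext i; simp [oddMat]

lemma oddMat_sub (U V : ℂ⟦X⟧⟦X⟧) : oddMat N (U - V) = oddMat N U - oddMat N V := by
  ext i; simp [oddMat]

lemma oddMat_neg (U : ℂ⟦X⟧⟦X⟧) : oddMat N (-U) = -oddMat N U := by
  ext i; simp [oddMat]

lemma oddMat_C_mul (c : ℂ) (U : ℂ⟦X⟧⟦X⟧) : oddMat N (C (C c) * U) = c • oddMat N U := by
  ext i; simp [oddMat]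

lemma oddMat_mul_map (U V : ℂ⟦X⟧) :
    oddMat N (C U * PowerSeries.map C V) = vecMulVec (oddVec N U) (oddVec N V) := by
  ext i j
  rw [oddMat, of_apply, coeff_C_mul, coeff_map, coeff_mul_C, vecMulVec_apply]
  rfl

lemma oddVec_even_mul {G : ℂ⟦X⟧} (hG : IsEven G) (U : ℂ⟦X⟧) :
    oddVec N (G * U) = evenToeplitz N G *ᵥ oddVec N U := by
  ext i
  rw [oddVec, coeff_mul, sum_antidiagonal_odd (fun k => coeff k G) (fun k => coeff k U) hG.coeff_odd]
  rfl

lemma oddMat_even_mul {G : ℂ⟦X⟧} (hG : IsEven G) (F : ℂ⟦X⟧⟦X⟧) :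
    oddMat N (C G * F) = evenToeplitz N G * oddMat N F := by
  ext i j
  rw [oddMat, of_apply, coeff_C_mul]
  exact congrFun (oddVec_even_mul hG (coeff (2 * (j : ℕ) + 1) F)) i

/-- The inner variable labels rows and the outer one columns, so an even series in q acts from the
right by the transpose. -/
lemma oddMat_map_even_mul {G : ℂ⟦X⟧} (hG : IsEven G) (F : ℂ⟦X⟧⟦X⟧) :
    oddMat N (PowerSeries.map C G * F) = oddMat N F * (evenToeplitz N G)ᵀ := by
  ext i j
  rw [oddMat, of_apply, coeff_mul, sum_antidiagonal_odd
    (fun k => coeff k (PowerSeries.map (C (R := ℂ)) G)) (fun k => coeff k F)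
    (fun m => by rw [coeff_map, hG.coeff_odd, map_zero]), map_sum, mul_apply]
  refine Finset.sum_congr rfl fun l _ => ?_
  simp only [evenToeplitz, transpose_apply, of_apply, coeff_map, oddMat]
  split_ifs
  · rw [coeff_C_mul, mul_comm]
  · simp

lemma det_evenToeplitz (U : ℂ⟦X⟧) : (evenToeplitz N U).det = constantCoeff U ^ N := by
  rw [det_of_isLowerTriangular]
  · simp [evenToeplitz]
  · intro i j hij
    have : ¬ (j : ℕ) ≤ i := by simpa using hij
    rw [evenToeplitz, of_apply, if_neg this]

/-- Conjugation of the coefficients of a series. -/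
noncomputable def conjSeries : ℂ⟦X⟧ →+* ℂ⟦X⟧ := PowerSeries.map (starRingEnd ℂ)

lemma coeff_conjSeries (U : ℂ⟦X⟧) (n : ℕ) : coeff n (conjSeries U) = conj (coeff n U) :=
  coeff_map _ _ _

lemma oddVec_conjSeries (U : ℂ⟦X⟧) : oddVec N (conjSeries U) = star (oddVec N U) := by
  ext i; simp [oddVec, coeff_conjSeries]

lemma conjSeries_conjSeries (U : ℂ⟦X⟧) : conjSeries (conjSeries U) = U := by
  ext n; simp [coeff_conjSeries]

lemma conjSeries_C (c : ℂ) : conjSeries (C c) = C (conj c) := PowerSeries.map_C _ _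

lemma conjSeries_inv {U : ℂ⟦X⟧} (h : constantCoeff U ≠ 0) : conjSeries U⁻¹ = (conjSeries U)⁻¹ := by
  rw [PowerSeries.eq_inv_iff_mul_eq_one, ← map_mul, PowerSeries.inv_mul_cancel _ h, map_one]
  rw [← coeff_zero_eq_constantCoeff_apply, coeff_conjSeries]
  simpa using h

/-- Conjugation of the coefficients of a double series combined with the exchange of the two
variables. -/
noncomputable def conjSwap (F : ℂ⟦X⟧⟦X⟧) : ℂ⟦X⟧⟦X⟧ :=
  PowerSeries.mk fun j => PowerSeries.mk fun i => conj (coeff j (coeff i F))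

lemma coeff_conjSwap (F : ℂ⟦X⟧⟦X⟧) (i j : ℕ) :
    coeff i (coeff j (conjSwap F)) = conj (coeff j (coeff i F)) := by
  rw [conjSwap, coeff_mk, coeff_mk]

lemma conjSwap_add (F G : ℂ⟦X⟧⟦X⟧) : conjSwap (F + G) = conjSwap F + conjSwap G := by
  ext j i; simp [coeff_conjSwap]

lemma conjSwap_mul (F G : ℂ⟦X⟧⟦X⟧) : conjSwap (F * G) = conjSwap F * conjSwap G := by
  ext j i
  rw [coeff_conjSwap, coeff_mul, coeff_mul, map_sum, map_sum, map_sum]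
  simp only [coeff_mul, coeff_conjSwap, map_sum, map_mul]
  rw [Finset.sum_comm]

lemma conjSwap_C (U : ℂ⟦X⟧) : conjSwap (C U) = PowerSeries.map C (conjSeries U) := by
  ext j i
  rw [coeff_conjSwap, coeff_map, coeff_conjSeries, coeff_C, coeff_C]
  split_ifs <;> simp

lemma conjSwap_map (U : ℂ⟦X⟧) : conjSwap (PowerSeries.map C U) = C (conjSeries U) := by
  ext j i
  rw [coeff_conjSwap, coeff_map, coeff_C, coeff_C]
  split_ifs <;> simp [coeff_conjSeries]

lemma oddMat_conjSwap (F : ℂ⟦X⟧⟦X⟧) : oddMat N (conjSwap F) = (oddMat N F)ᴴ := by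
  ext i j
  simp [oddMat, coeff_conjSwap]

end Series

end MTRogue

/-! ### Rank one updates, the flow identity and a kernel criterion -/

namespace MTRogue

open Matrix

section Resolvent

variable {n : Type*} [Fintype n] [DecidableEq n]

/-- The bilinear form `y · M⁻¹ z`. -/
noncomputable def invForm (M : Matrix n n ℂ) (y z : n → ℂ) : ℂ := y ⬝ᵥ (M⁻¹ *ᵥ z)

lemma invForm_sub_left (M : Matrix n n ℂ) (y y' z : n → ℂ) :
    invForm M (y - y') z = invForm M y z - invForm M y' z := by simp [invForm, sub_dotProduct]

lemma invForm_smul_left (M : Matrix n n ℂ) (c : ℂ) (y z : n → ℂ) :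
    invForm M (c • y) z = c * invForm M y z := by simp [invForm, smul_dotProduct]

lemma invForm_add_right (M : Matrix n n ℂ) (y z z' : n → ℂ) :
    invForm M y (z + z') = invForm M y z + invForm M y z' := by
  simp [invForm, mulVec_add, dotProduct_add]

lemma invForm_sub_right (M : Matrix n n ℂ) (y z z' : n → ℂ) :
    invForm M y (z - z') = invForm M y z - invForm M y z' := by
  simp [invForm, mulVec_sub, dotProduct_sub]

lemma invForm_smul_right (M : Matrix n n ℂ) (c : ℂ) (y z : n → ℂ) :
    invForm M y (c • z) = c * invForm M y z := by
  simp [invForm, mulVec_smul, dotProduct_smul]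

lemma det_add_vecMulVec {M : Matrix n n ℂ} (hM : M.det ≠ 0) (u v : n → ℂ) :
    (M + vecMulVec u v).det = M.det * (1 + invForm M v u) := by
  rw [vecMulVec_eq Unit, det_add_replicateCol_mul_replicateRow hM.isUnit, invForm,
    dotProduct_mulVec]
  simp [det_unique, mul_apply, dotProduct, vecMul]

lemma det_sub_vecMulVec {M : Matrix n n ℂ} (hM : M.det ≠ 0) (u v : n → ℂ) :
    (M - vecMulVec u v).det = M.det * (1 - invForm M v u) := by
  have h : M - vecMulVec u v = M + vecMulVec (-u) v := by
    rw [neg_vecMulVec, sub_eq_add_neg]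
  rw [h, det_add_vecMulVec hM, ← neg_one_smul ℂ u, invForm_smul_right]
  ring

lemma dotProduct_inv_mulVec_vecMulVec (M : Matrix n n ℂ) (y z u v : n → ℂ) :
    y ⬝ᵥ (M⁻¹ *ᵥ (vecMulVec u v *ᵥ (M⁻¹ *ᵥ z))) = invForm M y u * invForm M v z := by
  rw [vecMulVec_mulVec]
  simp [invForm, mulVec_smul, dotProduct_smul, mul_comm]

/-- The effect of a flow which is trivial up to a rank one term on `1 - ψ · M⁻¹ ϕ`. -/
lemma invForm_flow {M T T' R₀ : Matrix n n ℂ} (hM : M.det ≠ 0) {ϕ ψ γ χ ϕd ψd : n → ℂ} {ρ c δ : ℂ}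
    (hT : T * M + M * T'ᵀ = R₀ + ρ • vecMulVec (ϕ + c • γ) χ)
    (hϕ : ϕd = T *ᵥ ϕ - ρ • γ + δ • ϕ) (hψ : ψd = T' *ᵥ ψ - ρ • χ - δ • ψ) :
    c * (invForm M ψd ϕ - ψ ⬝ᵥ (M⁻¹ *ᵥ (R₀ *ᵥ (M⁻¹ *ᵥ ϕ))) + invForm M ψ ϕd) =
      -ρ * ((1 - invForm M ψ ϕ) -
        (1 - c * invForm M χ ϕ) * (1 - invForm M ψ (ϕ + c • γ))) := by
  -- Sandwiched between ψ·M⁻¹ and M⁻¹ϕ, the Lyapunov identity cancels the `R₀` term against the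
  -- contributions of T and T'. The δ terms cancel each other, so only terms with the factor ρ
  -- survive.
  have h1 : invForm M (T' *ᵥ ψ) ϕ + invForm M ψ (T *ᵥ ϕ) =
      ψ ⬝ᵥ (M⁻¹ *ᵥ ((T * M + M * T'ᵀ) *ᵥ (M⁻¹ *ᵥ ϕ))) := by
    have e1 : M⁻¹ *ᵥ ((T * M + M * T'ᵀ) *ᵥ (M⁻¹ *ᵥ ϕ)) =
        M⁻¹ *ᵥ (T *ᵥ ϕ) + T'ᵀ *ᵥ (M⁻¹ *ᵥ ϕ) := by
      have hu : IsUnit M.det := hM.isUnit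
      rw [add_mulVec, mulVec_add]
      congr 1
      · rw [mulVec_mulVec ϕ, mul_assoc, mul_nonsing_inv _ hu, mul_one]
      · rw [← mulVec_mulVec, mulVec_mulVec _ M⁻¹ M, nonsing_inv_mul _ hu, one_mulVec]
    rw [e1, dotProduct_add, add_comm, invForm, invForm, dotProduct_mulVec ψ T'ᵀ, vecMul_transpose]
  rw [hT, add_mulVec, mulVec_add, dotProduct_add, smul_mulVec, mulVec_smul, dotProduct_smul,
    dotProduct_inv_mulVec_vecMulVec] at h1
  subst hϕ hψ
  simp only [invForm_add_right, invForm_sub_right, invForm_smul_right, invForm_sub_left,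
    invForm_smul_left, smul_eq_mul] at h1 ⊢
  linear_combination c * h1

end Resolvent

/-- If the kernel of `M` is invariant under an upper triangular Toeplitz matrix with nonzero first
superdiagonal and does not contain the first basis vector, then it is trivial. -/
lemma det_ne_zero_of_kernel_invariant {N : ℕ} {M : Matrix (Fin N) (Fin N) ℂ}
    {U : PowerSeries ℂ} (hU : PowerSeries.coeff 2 U ≠ 0)
    (hinv : ∀ v, M *ᵥ v = 0 → M *ᵥ ((evenToeplitz N U)ᵀ *ᵥ v) = 0)
    (h0 : ∀ v, M *ᵥ v = 0 → (∀ i : Fin N, 1 ≤ (i : ℕ) → v i = 0) → v = 0) : M.det ≠ 0 := by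
  have key : ∀ (J : ℕ) (v : Fin N → ℂ), M *ᵥ v = 0 → (∀ i : Fin N, J ≤ (i : ℕ) → v i = 0) →
      v = 0 := by
    intro J
    induction J with
    | zero => intro v _ hv; ext i; exact hv i (Nat.zero_le _)
    | succ J ih =>
      intro v hv hz
      rcases Nat.eq_zero_or_pos J with rfl | hJ
      · exact h0 v hv hz
      -- Removing the diagonal leaves a strictly upper triangular matrix, so `w` stays in the kernel
      -- and its support is shorter by one; the induction hypothesis gives `w = 0`.
      set w : Fin N → ℂ := (evenToeplitz N U)ᵀ *ᵥ v - PowerSeries.coeff 0 U • v with hw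
      have hwi : ∀ i : Fin N, w i = ∑ l : Fin N, (if (i : ℕ) < l then
          PowerSeries.coeff (2 * ((l : ℕ) - i)) U else 0) * v l := by
        intro i
        have : PowerSeries.coeff 0 U * v i = ∑ l : Fin N, (if i = l then
          PowerSeries.coeff 0 U else 0) * v l := by simp
        simp only [hw, Pi.sub_apply, Pi.smul_apply, smul_eq_mul, mulVec, dotProduct,
          transpose_apply, evenToeplitz, of_apply]
        rw [this, ← Finset.sum_sub_distrib]
        refine Finset.sum_congr rfl fun l _ => ?_
        rcases lt_trichotomy (i : ℕ) (l : ℕ) with h | h | h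
        · have h1 : i ≠ l := fun h' => by simp [h'] at h
          simp [h, h.le, h1]
        · have h1 : i = l := Fin.ext h
          simp [h1]
        · have h1 : i ≠ l := fun h' => by simp [h'] at h
          simp [h.not_ge, h1, not_lt.2 h.le]
      have hwM : M *ᵥ w = 0 := by
        rw [hw, mulVec_sub, mulVec_smul, hinv v hv, hv, smul_zero, sub_zero]
      have hw0 : w = 0 := by
        refine ih w hwM fun i hi => ?_
        rw [hwi]
        refine Finset.sum_eq_zero fun l _ => ?_
        split_ifs with h
        · rw [hz l (by omega), mul_zero]
        · rw [zero_mul]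
      refine ih v hv fun i hi => ?_
      rcases hi.eq_or_lt with h | h
      · have hi0 : J - 1 < N := by have := i.2; omega
        -- In row J-1 only the entry v_J survives, multiplied by the X² coefficient of `U`; hence
        -- v_J = 0 and the induction hypothesis applies to v itself.
        have h1 := congrFun hw0 ⟨J - 1, hi0⟩
        rw [hwi, Finset.sum_eq_single i] at h1
        · rw [if_pos (by simp only; omega), show 2 * ((i : ℕ) - (J - 1)) = 2 by omega] at h1
          exact (mul_eq_zero.1 h1).resolve_left hU
        · intro l _ hl
          have hl' : (l : ℕ) ≠ i := fun h' => hl (Fin.ext h')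
          split_ifs with h2
          · rw [hz l (by simp only at h2; omega), mul_zero]
          · rw [zero_mul]
        · simp
      · exact hz i h
  intro hdet
  obtain ⟨v, hv, hv0⟩ := exists_mulVec_eq_zero_iff.2 hdet
  exact hv (key N v hv0 fun i hi => absurd i.2 (by omega))

end MTRogue

/-! ### Rational functions of p and their parity -/

namespace MTRogue

open PowerSeries Matrix

/-- The series of `p = i β + r e^X`. -/
noncomputable def momentum (β r : ℝ) : ℂ⟦X⟧ := C (Complex.I * β) + C (r : ℂ) * PowerSeries.exp ℂ

/-- The series of `1 / (p - c)`. -/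
noncomputable def pole (β r : ℝ) (c : ℂ) : ℂ⟦X⟧ := (momentum β r - C c)⁻¹

section Momentum

variable {β r : ℝ}

lemma constantCoeff_momentum_sub (c : ℂ) :
    constantCoeff (momentum β r - C c) = r + Complex.I * β - c := by
  simp [momentum, add_comm]

lemma constantCoeff_momentum_sub_I_mul_ne_zero (hr : 0 < r) (y : ℝ) :
    constantCoeff (momentum β r - C (Complex.I * y)) ≠ 0 := by
  rw [constantCoeff_momentum_sub]
  intro h
  have := congrArg Complex.re h
  simp at this
  exact hr.ne' this

lemma momentum_sub_mul_pole (hr : 0 < r) (y : ℝ) :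
    (momentum β r - C (Complex.I * y)) * pole β r (Complex.I * y) = 1 :=
  PowerSeries.mul_inv_cancel _ (constantCoeff_momentum_sub_I_mul_ne_zero hr y)

lemma conjSeries_momentum : conjSeries (momentum β r) = momentum β r - 2 * C (Complex.I * β) := by
  rw [momentum, map_add conjSeries, map_mul conjSeries, conjSeries_C, conjSeries_C, conjSeries, map_exp]
  simp only [map_mul, Complex.conj_I, Complex.conj_ofReal, map_neg, neg_mul]
  ring

/-- As p - b = r e^X, the function r²/(p-b) is r e^(-X). -/
lemma rescale_pole_self (hr : 0 < r) :
    C ((r : ℂ) ^ 2) * pole β r (Complex.I * β) =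
      rescale (-1 : ℂ) (momentum β r - C (Complex.I * β)) := by
  have h1 : (momentum β r - C (Complex.I * β)) *
      rescale (-1 : ℂ) (momentum β r - C (Complex.I * β)) = C ((r : ℂ) ^ 2) := by
    have h2 := exp_mul_exp_neg_eq_one (A := ℂ)
    rw [evalNegHom] at h2
    have h3 : momentum β r - C (Complex.I * β) = C (r : ℂ) * PowerSeries.exp ℂ := by
      rw [momentum]; ring
    have h4 : rescale (-1 : ℂ) (C (r : ℂ)) = C (r : ℂ) := by
      ext n; rw [coeff_rescale, coeff_C]; split_ifs with h <;> simp [h]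
    rw [h3, map_mul, h4, map_pow]
    linear_combination C (r : ℂ) ^ 2 * h2
  linear_combination -pole β r (Complex.I * β) * h1 +
    rescale (-1 : ℂ) (momentum β r - C (Complex.I * β)) * momentum_sub_mul_pole hr β

lemma IsEven.add {U V : ℂ⟦X⟧} (hU : IsEven U) (hV : IsEven V) : IsEven (U + V) := by
  rw [IsEven, map_add, hU, hV]

lemma IsEven.conjSeries {U : ℂ⟦X⟧} (hU : IsEven U) : IsEven (conjSeries U) := by
  ext n
  have := congrArg (fun V => conj (coeff n V)) hU
  simpa [coeff_rescale, coeff_conjSeries] using this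

lemma isEven_C (c : ℂ) : IsEven (C c) := by
  ext n; rw [coeff_rescale, coeff_C]; split_ifs with h <;> simp [h]

/-- The series of `(p - b) + r² / (p - b)` with `b = i β`. -/
noncomputable def evenFlow (β r : ℝ) : ℂ⟦X⟧ :=
  momentum β r - C (Complex.I * β) + C ((r : ℂ) ^ 2) * pole β r (Complex.I * β)

lemma isEven_evenFlow (hr : 0 < r) : IsEven (evenFlow β r) := by
  rw [evenFlow, rescale_pole_self hr, IsEven, map_add, rescale_rescale]
  simp [add_comm]

/-- The series of `p (p - i) / (p - b)` with `b = i β`. -/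
noncomputable def evenRatio (β r : ℝ) : ℂ⟦X⟧ :=
  momentum β r * (momentum β r - C Complex.I) * pole β r (Complex.I * β)

lemma momentum_sub_I_mul_pole (hr : 0 < r) :
    (momentum β r - C Complex.I) * pole β r Complex.I = 1 := by
  simpa using momentum_sub_mul_pole (β := β) hr 1

lemma momentum_mul_pole_zero (hr : 0 < r) : momentum β r * pole β r 0 = 1 := by
  simpa using momentum_sub_mul_pole (β := β) hr 0

/-- Dividing p(p-i) by p - b leaves the remainder b(b-i), and r² = β(1-β) says that this remainder
is r². This is the reason for the choice of p₀. -/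
lemma evenRatio_eq (hr : 0 < r) (hβ : r ^ 2 = β * (1 - β)) :
    evenRatio β r = evenFlow β r + C (2 * (Complex.I * β) - Complex.I) := by
  have h1 := momentum_sub_mul_pole (β := β) hr β
  have h2 : C ((r : ℂ) ^ 2) = C (Complex.I * β) * (C (Complex.I * β) - C Complex.I) := by
    rw [← map_sub, ← map_mul]
    congr 1
    have : ((r : ℂ)) ^ 2 = β * (1 - β) := by exact_mod_cast hβ
    linear_combination this - (β ^ 2 - β) * Complex.I_sq
  rw [evenRatio, evenFlow, h2, map_sub, map_mul C 2, map_ofNat]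
  linear_combination (momentum β r + C (Complex.I * β) - C Complex.I) * h1

lemma isEven_evenRatio (hr : 0 < r) (hβ : r ^ 2 = β * (1 - β)) : IsEven (evenRatio β r) := by
  rw [evenRatio_eq hr hβ]; exact (isEven_evenFlow hr).add (isEven_C _)

/-- The series of `β / p + (1 - β) / (p - i)`. -/
noncomputable def evenPole (β r : ℝ) : ℂ⟦X⟧ :=
  C (β : ℂ) * pole β r 0 + C (1 - β : ℂ) * pole β r Complex.I

/-- Partial fractions: β(p-i) + (1-β)p = p - iβ. So the weighted sum of poles is the reciprocal of
`evenRatio` and inherits its parity. -/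
lemma evenPole_eq (hr : 0 < r) :
    evenPole β r = (momentum β r - C (Complex.I * β)) * pole β r 0 * pole β r Complex.I := by
  have h1 := momentum_mul_pole_zero (β := β) hr
  have h2 := momentum_sub_I_mul_pole (β := β) hr
  rw [evenPole, map_sub, map_one, map_mul]
  linear_combination -C (β : ℂ) * pole β r 0 * h2 - (1 - C (β : ℂ)) * pole β r Complex.I * h1

lemma evenRatio_mul_evenPole (hr : 0 < r) : evenRatio β r * evenPole β r = 1 := by
  have h1 := momentum_mul_pole_zero (β := β) hr
  have h2 := momentum_sub_I_mul_pole (β := β) hr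
  have h3 := momentum_sub_mul_pole (β := β) hr β
  rw [evenPole_eq hr, evenRatio]
  calc _ = (momentum β r * pole β r 0) * ((momentum β r - C Complex.I) * pole β r Complex.I) *
        ((momentum β r - C (Complex.I * β)) * pole β r (Complex.I * β)) := by ring
    _ = 1 := by rw [h1, h2, h3]; simp

lemma isEven_evenPole (hr : 0 < r) (hβ : r ^ 2 = β * (1 - β)) : IsEven (evenPole β r) := by
  have h1 := evenRatio_mul_evenPole (β := β) hr
  have h0 : constantCoeff (evenRatio β r) ≠ 0 := fun h => by
    have := congrArg constantCoeff h1
    rw [map_mul, h] at this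
    simp at this
  have h2 : evenPole β r = (evenRatio β r)⁻¹ := by
    rw [PowerSeries.eq_inv_iff_mul_eq_one h0, mul_comm, h1]
  rw [h2]; exact (isEven_evenRatio hr hβ).inv h0

lemma conjSeries_pole (hr : 0 < r) (y : ℝ) :
    (conjSeries (momentum β r) + C (Complex.I * y)) *
      conjSeries (pole β r (Complex.I * y)) = 1 := by
  rw [← map_one conjSeries, ← momentum_sub_mul_pole (β := β) hr y, map_mul conjSeries,
    map_sub conjSeries, conjSeries_C]
  simp

/-- The series p - b = r e^X has real coefficients. -/
lemma conjSeries_pole_self (hr : 0 < r) :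
    conjSeries (pole β r (Complex.I * β)) = pole β r (Complex.I * β) := by
  have h1 := conjSeries_pole (β := β) hr β
  have h2 := momentum_sub_mul_pole (β := β) hr β
  rw [conjSeries_momentum] at h1
  linear_combination pole β r (Complex.I * β) * h1 -
    conjSeries (pole β r (Complex.I * β)) * h2

/-- The X² coefficient of 2r cosh X is r. It is the first off-diagonal entry of the Toeplitz matrix
in the kernel criterion. -/
lemma coeff_two_evenFlow_ne_zero (hr : 0 < r) : coeff 2 (evenFlow β r) ≠ 0 := by
  have h3 : momentum β r - C (Complex.I * β) = C (r : ℂ) * PowerSeries.exp ℂ := by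
    rw [momentum]; ring
  rw [evenFlow, rescale_pole_self hr, map_add, coeff_rescale, h3, coeff_C_mul, coeff_exp]
  have : (r : ℂ) ≠ 0 := by exact_mod_cast hr.ne'
  simpa [Nat.factorial] using this

end Momentum

end MTRogue

/-! ### Weighted matrices, rank one relations and Lyapunov identities -/

namespace MTRogue

open PowerSeries Matrix

/-- `W` is the double series of `E(p) E*(q) / (p + q)`, where `e` is the series of `E`. -/
structure IsWeightedKernel (β r : ℝ) (e : ℂ⟦X⟧) (W : ℂ⟦X⟧⟦X⟧) : Prop where
  add_mul : (C (momentum β r) + PowerSeries.map C (conjSeries (momentum β r))) * W =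
    C e * PowerSeries.map C (conjSeries e)
  conjSwap_eq : conjSwap W = W
  ne_zero : constantCoeff e ≠ 0

/-- The matrix with the weight `p / (p + q)`. -/
noncomputable def gramMat (N : ℕ) (β r : ℝ) (W : ℂ⟦X⟧⟦X⟧) : Matrix (Fin N) (Fin N) ℂ :=
  oddMat N (C (momentum β r) * W)

/-- The matrix with the weight `-q / (p + q)`. -/
noncomputable def gramMatConj (N : ℕ) (β r : ℝ) (W : ℂ⟦X⟧⟦X⟧) : Matrix (Fin N) (Fin N) ℂ :=
  oddMat N (-(PowerSeries.map C (conjSeries (momentum β r)) * W))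

/-- The matrix with the weight `q (p - i y) / ((p + q) (q + i y))`. -/
noncomputable def shiftMat (N : ℕ) (β r y : ℝ) (W : ℂ⟦X⟧⟦X⟧) : Matrix (Fin N) (Fin N) ℂ :=
  oddMat N (C (momentum β r - C (Complex.I * y)) *
    PowerSeries.map C (conjSeries (momentum β r) * conjSeries (pole β r (Complex.I * y))) * W)

/-- The matrix with the weight `-p (q + i y) / ((p + q) (p - i y))`. -/
noncomputable def shiftMatConj (N : ℕ) (β r y : ℝ) (W : ℂ⟦X⟧⟦X⟧) : Matrix (Fin N) (Fin N) ℂ :=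
  oddMat N (-(C (momentum β r * pole β r (Complex.I * y)) *
    PowerSeries.map C (conjSeries (momentum β r) + C (Complex.I * y)) * W))

/-- The matrix with the weight `-p (p - i) / ((p + q) (q + i))`. -/
noncomputable def raisedMat (N : ℕ) (β r : ℝ) (W : ℂ⟦X⟧⟦X⟧) : Matrix (Fin N) (Fin N) ℂ :=
  oddMat N (-(C (momentum β r * (momentum β r - C Complex.I)) *
    PowerSeries.map C (conjSeries (pole β r Complex.I)) * W))

/-- The matrix with the weight `-q² (p - b) / ((p + q) p (q + b))`, `b = i β`. -/
noncomputable def loweredMat (N : ℕ) (β r : ℝ) (W : ℂ⟦X⟧⟦X⟧) : Matrix (Fin N) (Fin N) ℂ :=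
  oddMat N (-(C (pole β r 0 * (momentum β r - C (Complex.I * β))) *
    PowerSeries.map C (conjSeries (momentum β r) * conjSeries (momentum β r) *
      conjSeries (pole β r (Complex.I * β))) * W))

section Identities

variable {N : ℕ} {β r : ℝ} {e : ℂ⟦X⟧} {W : ℂ⟦X⟧⟦X⟧}

lemma map_C_C (c : ℂ) : PowerSeries.map (C (R := ℂ)) (C c) = C (C c) := PowerSeries.map_C _ _

lemma map_conjSeries_pole (hr : 0 < r) (y : ℝ) :
    (PowerSeries.map C (conjSeries (momentum β r)) + C (C (Complex.I * y))) *
      PowerSeries.map (C (R := ℂ)) (conjSeries (pole β r (Complex.I * y))) = 1 := by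
  rw [← map_C_C, ← map_add, ← map_mul, conjSeries_pole hr, map_one]

lemma map_conjSeries_pole_I (hr : 0 < r) :
    (PowerSeries.map C (conjSeries (momentum β r)) + C (C Complex.I)) *
      PowerSeries.map (C (R := ℂ)) (conjSeries (pole β r Complex.I)) = 1 := by
  simpa using map_conjSeries_pole (β := β) hr 1

lemma map_conjSeries_pole_zero (hr : 0 < r) :
    PowerSeries.map C (conjSeries (momentum β r)) *
      PowerSeries.map (C (R := ℂ)) (conjSeries (pole β r 0)) = 1 := by
  simpa using map_conjSeries_pole (β := β) hr 0

lemma C_momentum_sub_mul_pole (hr : 0 < r) (y : ℝ) :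
    (C (momentum β r) - C (C (Complex.I * y))) * C (pole β r (Complex.I * y)) =
      (1 : ℂ⟦X⟧⟦X⟧) := by
  rw [← map_sub, ← map_mul, momentum_sub_mul_pole hr, map_one]

lemma C_momentum_mul_pole_zero (hr : 0 < r) :
    C (momentum β r) * C (pole β r 0) = (1 : ℂ⟦X⟧⟦X⟧) := by
  rw [← map_mul, momentum_mul_pole_zero hr, map_one]

lemma C_momentum_sub_I_mul_pole (hr : 0 < r) :
    (C (momentum β r) - C (C Complex.I)) * C (pole β r Complex.I) = (1 : ℂ⟦X⟧⟦X⟧) := by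
  rw [← map_sub, ← map_mul, momentum_sub_I_mul_pole hr, map_one]

namespace IsWeightedKernel

/-- Since -q/(p+q) = p/(p+q) - 1. The following rank one relations arise in the same way, from the
partial fraction of each weight with respect to p + q. -/
lemma gramMatConj_eq (h : IsWeightedKernel β r e W) :
    gramMatConj N β r W =
      gramMat N β r W - vecMulVec (oddVec N e) (oddVec N (conjSeries e)) := by
  rw [gramMat, gramMatConj, ← oddMat_mul_map, ← oddMat_sub]
  congr 1
  linear_combination -h.add_mul

lemma gramMat_eq (h : IsWeightedKernel β r e W) :
    gramMat N β r W =
      gramMatConj N β r W + vecMulVec (oddVec N e) (oddVec N (conjSeries e)) := by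
  rw [h.gramMatConj_eq, sub_add_cancel]

/-- The weight splits as p/(p+q) - iy/(q+iy). -/
lemma shiftMat_eq (h : IsWeightedKernel β r e W) (hr : 0 < r) (y : ℝ) :
    shiftMat N β r y W = gramMat N β r W - vecMulVec ((Complex.I * y) • oddVec N e)
      (oddVec N (conjSeries (pole β r (Complex.I * y)) * conjSeries e)) := by
  rw [shiftMat, gramMat, ← oddVec_C_mul, ← oddMat_mul_map, ← oddMat_sub]
  congr 1
  rw [map_sub, map_mul (PowerSeries.map C), map_mul (PowerSeries.map C), map_mul C _ e]
  linear_combination (C (momentum β r) * W) * map_conjSeries_pole hr y -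
    C (C (Complex.I * y)) * PowerSeries.map C (conjSeries (pole β r (Complex.I * y))) * h.add_mul

/-- The same weight measured from f* is -q/(p+q) + q/(q+iy). -/
lemma shiftMat_eq_conj (h : IsWeightedKernel β r e W) (hr : 0 < r) (y : ℝ) :
    shiftMat N β r y W = gramMatConj N β r W + vecMulVec (oddVec N e)
      (oddVec N (conjSeries (momentum β r) * conjSeries (pole β r (Complex.I * y)) *
        conjSeries e)) := by
  rw [shiftMat, gramMatConj, ← oddMat_mul_map, ← oddMat_add]
  congr 1
  rw [map_sub, map_mul (PowerSeries.map C), map_mul (PowerSeries.map C),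
    map_mul (PowerSeries.map C)]
  linear_combination -(PowerSeries.map C (conjSeries (momentum β r)) * W) *
    map_conjSeries_pole hr y + PowerSeries.map C (conjSeries (momentum β r)) *
    PowerSeries.map C (conjSeries (pole β r (Complex.I * y))) * h.add_mul

lemma shiftMatConj_eq (h : IsWeightedKernel β r e W) (hr : 0 < r) (y : ℝ) :
    shiftMatConj N β r y W = gramMat N β r W - vecMulVec
      (oddVec N (momentum β r * pole β r (Complex.I * y) * e)) (oddVec N (conjSeries e)) := by
  rw [shiftMatConj, gramMat, ← oddMat_mul_map, ← oddMat_sub]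
  congr 1
  rw [map_add, map_C_C, map_mul C _ e, map_mul C (momentum β r)]
  linear_combination C (momentum β r) * W * C_momentum_sub_mul_pole hr y -
    C (momentum β r) * C (pole β r (Complex.I * y)) * h.add_mul

lemma raisedMat_eq (h : IsWeightedKernel β r e W) (hr : 0 < r) :
    raisedMat N β r W = gramMat N β r W - vecMulVec (oddVec N (momentum β r * e))
      (oddVec N (conjSeries (pole β r Complex.I) * conjSeries e)) := by
  rw [raisedMat, gramMat, ← oddMat_mul_map, ← oddMat_sub]
  congr 1
  rw [map_mul C, map_sub, map_mul C, map_mul (PowerSeries.map C)]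
  linear_combination C (momentum β r) * W * map_conjSeries_pole_I hr -
    C (momentum β r) * PowerSeries.map C (conjSeries (pole β r Complex.I)) * h.add_mul

/-- The weight splits as -q/(p+q) + (b/p)·q/(q+b). -/
lemma loweredMat_eq (h : IsWeightedKernel β r e W) (hr : 0 < r) :
    loweredMat N β r W = gramMatConj N β r W + vecMulVec
      ((Complex.I * β) • oddVec N (pole β r 0 * e))
      (oddVec N (conjSeries (momentum β r) * conjSeries (pole β r (Complex.I * β)) *
        conjSeries e)) := by
  rw [loweredMat, gramMatConj, ← oddVec_C_mul, ← oddMat_mul_map, ← oddMat_add]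
  congr 1
  simp only [map_mul (PowerSeries.map C), map_mul C (pole β r 0), map_sub,
    map_mul C (C (Complex.I * β))]
  linear_combination
    -(PowerSeries.map C (conjSeries (momentum β r)) * W) * map_conjSeries_pole hr β
    + (C (C (Complex.I * β)) * C (pole β r 0) * PowerSeries.map C (conjSeries (momentum β r)) *
      PowerSeries.map C (conjSeries (pole β r (Complex.I * β)))) * h.add_mul
    - (PowerSeries.map C (conjSeries (momentum β r)) *
      PowerSeries.map C (conjSeries (pole β r (Complex.I * β))) * W *
      (PowerSeries.map C (conjSeries (momentum β r)) + C (C (Complex.I * β)))) *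
        C_momentum_mul_pole_zero hr

/-- The sum of the even series in p and in q is (p+q)(1 + r²/((p-b)(q+b))), which cancels the
denominator of p/(p+q). What remains is p + r²(1 + b/(p-b))/(q+b). -/
lemma lyapunov_evenFlow (h : IsWeightedKernel β r e W) (hr : 0 < r) :
    evenToeplitz N (evenFlow β r) * gramMat N β r W +
        gramMat N β r W * (evenToeplitz N (evenFlow β r))ᵀ =
      vecMulVec (oddVec N (momentum β r * e)) (oddVec N (conjSeries e)) +
      ((r : ℂ) ^ 2) • vecMulVec
        (oddVec N e + (Complex.I * β) • oddVec N (pole β r (Complex.I * β) * e))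
        (oddVec N (pole β r (Complex.I * β) * conjSeries e)) := by
  rw [gramMat, ← oddMat_even_mul (isEven_evenFlow hr), ← oddMat_map_even_mul (isEven_evenFlow hr),
    ← oddVec_C_mul, ← oddVec_add, ← oddMat_mul_map, ← oddMat_mul_map, ← oddMat_C_mul,
    ← oddMat_add, ← oddMat_add]
  congr 1
  have h1 := map_conjSeries_pole (β := β) hr β
  rw [conjSeries_pole_self hr] at h1
  have h2 := C_momentum_sub_mul_pole (β := β) hr β
  have h3 := h.add_mul
  have h4 : PowerSeries.map (C (R := ℂ)) (conjSeries (momentum β r)) =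
      PowerSeries.map C (momentum β r) - 2 * C (C (Complex.I * β)) := by
    rw [conjSeries_momentum, map_sub, map_mul, map_C_C, map_ofNat]
  simp only [evenFlow, map_add, map_sub, map_mul C _ e, map_mul C (C ((r : ℂ) ^ 2)),
    map_mul (PowerSeries.map C), map_C_C, map_mul C (C (Complex.I * β))]
  rw [h4] at h1 h3
  generalize C (momentum β r) = p at *
  generalize PowerSeries.map C (momentum β r) = q at *
  generalize C (C (Complex.I * β)) = b at *
  generalize C (pole β r (Complex.I * β)) = u at *
  generalize PowerSeries.map C (pole β r (Complex.I * β)) = w at *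
  generalize PowerSeries.map C (conjSeries e) = f at *
  generalize C e = g at *
  generalize C (C ((r : ℂ) ^ 2)) = ρ at *
  linear_combination (p + ρ * (1 + b * u) * w) * h3 - ρ * u * p * W * h1
    + (-ρ * w * p * W + ρ * w * (p + (q - 2 * b)) * W) * h2

/-- Each pair 1/p + 1/q and 1/(p-i) + 1/(q+i) contains the factor p + q. After its cancellation the
weight is β/q + (1-β)(1 + i/(p-i))/(q+i). -/
lemma lyapunov_evenPole (h : IsWeightedKernel β r e W) (hr : 0 < r)
    (hβ : r ^ 2 = β * (1 - β)) :
    evenToeplitz N (evenPole β r) * gramMat N β r W +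
        gramMat N β r W * (evenToeplitz N (conjSeries (evenPole β r)))ᵀ =
      (β : ℂ) • vecMulVec (oddVec N e) (oddVec N (conjSeries (pole β r 0) * conjSeries e)) +
      (1 - β : ℂ) • vecMulVec
        (oddVec N e + Complex.I • oddVec N (pole β r Complex.I * e))
        (oddVec N (conjSeries (pole β r Complex.I) * conjSeries e)) := by
  have hev := isEven_evenPole hr hβ
  rw [gramMat, ← oddMat_even_mul hev, ← oddMat_map_even_mul hev.conjSeries,
    ← oddVec_C_mul, ← oddVec_add, ← oddMat_mul_map, ← oddMat_mul_map, ← oddMat_C_mul,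
    ← oddMat_C_mul, ← oddMat_add, ← oddMat_add]
  congr 1
  have h1 := map_conjSeries_pole_I (β := β) hr
  have h2 := map_conjSeries_pole_zero (β := β) hr
  have h3 := C_momentum_mul_pole_zero (β := β) hr
  have h4 := C_momentum_sub_I_mul_pole (β := β) hr
  have h5 := h.add_mul
  have h6 : conjSeries (evenPole β r) = C (β : ℂ) * conjSeries (pole β r 0) +
      C (1 - β : ℂ) * conjSeries (pole β r Complex.I) := by
    rw [evenPole, map_add conjSeries, map_mul conjSeries, map_mul conjSeries, conjSeries_C,
      conjSeries_C]
    simp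
  rw [h6, evenPole]
  simp only [map_add, map_mul (PowerSeries.map C), map_mul C _ e, map_C_C,
    map_mul C (C (β : ℂ)), map_mul C (C (1 - β : ℂ)), map_mul C (C Complex.I)]
  generalize C (momentum β r) = p at *
  generalize PowerSeries.map C (conjSeries (momentum β r)) = q at *
  generalize C (C Complex.I) = a at *
  generalize C (pole β r 0) = u at *
  generalize C (pole β r Complex.I) = v at *
  generalize PowerSeries.map C (conjSeries (pole β r 0)) = u' at *
  generalize PowerSeries.map C (conjSeries (pole β r Complex.I)) = v' at *
  generalize PowerSeries.map C (conjSeries e) = f at *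
  generalize C e = g at *
  generalize C (C (β : ℂ)) = k at *
  generalize C (C (1 - β : ℂ)) = l at *
  linear_combination (k * u' + l * (1 + a * v) * v') * h5 + k * W * h3 - k * W * h2
    - l * p * v * W * h1 + l * W * v' * q * h4

end IsWeightedKernel

end Identities

end MTRogue

/-! ### Derivatives of inverse matrices and of coefficients -/

namespace MTRogue

open PowerSeries Matrix

section InverseDeriv

variable {n : Type*} [Fintype n] [DecidableEq n]

lemma differentiableAt_det {M : ℝ → Matrix n n ℂ} {s : ℝ}
    (hM : ∀ i j, DifferentiableAt ℝ (fun s => M s i j) s) :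
    DifferentiableAt ℝ (fun s => (M s).det) s := by
  simp only [det_apply']
  refine DifferentiableAt.fun_sum fun τ _ => DifferentiableAt.const_mul ?_ _
  exact DifferentiableAt.fun_finsetProd fun i _ => hM _ _

lemma differentiableAt_inv_apply {M : ℝ → Matrix n n ℂ} {s : ℝ}
    (hM : ∀ i j, DifferentiableAt ℝ (fun s => M s i j) s) (h0 : (M s).det ≠ 0) (i j : n) :
    DifferentiableAt ℝ (fun s => (M s)⁻¹ i j) s := by
  simp only [inv_def, Matrix.smul_apply, Ring.inverse_eq_inv', smul_eq_mul, adjugate_apply]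
  refine ((differentiableAt_det hM).fun_inv h0).fun_mul (differentiableAt_det fun k l => ?_)
  by_cases hk : k = j
  · simp only [hk, updateRow_self]
    exact differentiableAt_const _
  · simp only [updateRow_ne hk]
    exact hM k l

lemma hasDerivAt_inv_apply {M : ℝ → Matrix n n ℂ} {M' : Matrix n n ℂ} {s : ℝ}
    (hM : ∀ i j, HasDerivAt (fun s => M s i j) (M' i j) s) (h0 : (M s).det ≠ 0) (i j : n) :
    HasDerivAt (fun s => (M s)⁻¹ i j) ((-((M s)⁻¹ * M' * (M s)⁻¹)) i j) s := by
  have hd := differentiableAt_inv_apply (fun i j => (hM i j).differentiableAt) h0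
  choose K hK using fun i j => (⟨_, (hd i j).hasDerivAt⟩ : ∃ c, HasDerivAt _ c s)
  have hev : ∀ᶠ x in nhds s, (M x).det ≠ 0 :=
    (differentiableAt_det fun i j => (hM i j).differentiableAt).continuousAt.eventually_ne h0
  -- Differentiability of the inverse is known from Cramer's rule; its value follows from
  -- differentiating M M⁻¹ = 1, valid near `s`.
  have h1 : M' * (M s)⁻¹ + M s * Matrix.of K = 0 := by
    ext i j
    have h2 : HasDerivAt (fun x => ∑ k, M x i k * (M x)⁻¹ k j)
        (∑ k, (M' i k * (M s)⁻¹ k j + M s i k * K k j)) s :=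
      HasDerivAt.fun_sum fun k _ => (hM i k).mul (hK k j)
    have h3 : (fun x => ∑ k, M x i k * (M x)⁻¹ k j) =ᶠ[nhds s]
        fun _ => (1 : Matrix n n ℂ) i j := by
      filter_upwards [hev] with x hx
      rw [← mul_apply, mul_nonsing_inv _ hx.isUnit]
    have h4 := h2.unique ((hasDerivAt_const s _).congr_of_eventuallyEq h3)
    rw [Finset.sum_add_distrib] at h4
    simpa [mul_apply] using h4
  have h5 : Matrix.of K = -((M s)⁻¹ * M' * (M s)⁻¹) := by
    have := congrArg (fun A => (M s)⁻¹ * A) h1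
    simp only [mul_add, mul_zero, ← mul_assoc, nonsing_inv_mul _ h0.isUnit, one_mul] at this
    exact eq_neg_of_add_eq_zero_right this
  rw [← h5]; exact hK i j

lemma hasDerivAt_invForm {M : ℝ → Matrix n n ℂ} {M' : Matrix n n ℂ} {y z : ℝ → n → ℂ}
    {y' z' : n → ℂ} {s : ℝ} (hM : ∀ i j, HasDerivAt (fun s => M s i j) (M' i j) s)
    (hy : ∀ i, HasDerivAt (fun s => y s i) (y' i) s)
    (hz : ∀ i, HasDerivAt (fun s => z s i) (z' i) s) (h0 : (M s).det ≠ 0) :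
    HasDerivAt (fun s => invForm (M s) (y s) (z s))
      (invForm (M s) y' (z s) - y s ⬝ᵥ ((M s)⁻¹ *ᵥ (M' *ᵥ ((M s)⁻¹ *ᵥ z s))) +
        invForm (M s) (y s) z') s := by
  have h1 : HasDerivAt (fun s => ∑ i, y s i * ∑ j, (M s)⁻¹ i j * z s j)
      (∑ i, (y' i * ∑ j, (M s)⁻¹ i j * z s j + y s i *
        ∑ j, ((-((M s)⁻¹ * M' * (M s)⁻¹)) i j * z s j + (M s)⁻¹ i j * z' j))) s :=
    HasDerivAt.fun_sum fun i _ => (hy i).mul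
      (HasDerivAt.fun_sum fun j _ => (hasDerivAt_inv_apply hM h0 i j).mul (hz j))
  refine h1.congr_deriv ?_
  simp only [Finset.sum_add_distrib, mul_add]
  rw [mulVec_mulVec, mulVec_mulVec, ← add_assoc, sub_eq_add_neg, ← dotProduct_neg, ← neg_mulVec]
  rfl

end InverseDeriv

section CoeffDeriv

/-- Coefficientwise derivative of a family of series. -/
def HasCoeffDerivAt (U : ℝ → ℂ⟦X⟧) (U' : ℂ⟦X⟧) (s : ℝ) : Prop :=
  ∀ n, HasDerivAt (fun s => coeff n (U s)) (coeff n U') s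

/-- Coefficientwise derivative of a family of double series. -/
def HasCoeffDerivAt₂ (F : ℝ → ℂ⟦X⟧⟦X⟧) (F' : ℂ⟦X⟧⟦X⟧) (s : ℝ) : Prop :=
  ∀ j, HasCoeffDerivAt (fun s => coeff j (F s)) (coeff j F') s

lemma hasCoeffDerivAt_const (U : ℂ⟦X⟧) (s : ℝ) : HasCoeffDerivAt (fun _ => U) 0 s := fun n => by
  simpa using hasDerivAt_const s (coeff n U)

lemma HasCoeffDerivAt.mul {U V : ℝ → ℂ⟦X⟧} {U' V' : ℂ⟦X⟧} {s : ℝ}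
    (hU : HasCoeffDerivAt U U' s) (hV : HasCoeffDerivAt V V' s) :
    HasCoeffDerivAt (fun s => U s * V s) (U' * V s + U s * V') s := fun n => by
  simp only [coeff_mul, map_add]
  rw [← Finset.sum_add_distrib]
  exact HasDerivAt.fun_sum fun x _ => (hU x.1).mul (hV x.2)

lemma HasCoeffDerivAt.const_mul {U : ℝ → ℂ⟦X⟧} {U' : ℂ⟦X⟧} {s : ℝ} (V : ℂ⟦X⟧)
    (hU : HasCoeffDerivAt U U' s) : HasCoeffDerivAt (fun s => V * U s) (V * U') s := by
  simpa using (hasCoeffDerivAt_const V s).mul hU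

lemma HasCoeffDerivAt.conjSeries {U : ℝ → ℂ⟦X⟧} {U' : ℂ⟦X⟧} {s : ℝ}
    (hU : HasCoeffDerivAt U U' s) :
    HasCoeffDerivAt (fun s => MTRogue.conjSeries (U s)) (MTRogue.conjSeries U') s := fun n => by
  simp only [coeff_conjSeries]
  exact (hU n).star

lemma HasCoeffDerivAt.sum {ι : Type*} (t : Finset ι) {U : ι → ℝ → ℂ⟦X⟧} {U' : ι → ℂ⟦X⟧} {s : ℝ}
    (hU : ∀ i, HasCoeffDerivAt (U i) (U' i) s) :
    HasCoeffDerivAt (fun s => ∑ i ∈ t, U i s) (∑ i ∈ t, U' i) s := fun n => by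
  simp only [map_sum]
  exact HasDerivAt.fun_sum fun i _ => hU i n

lemma HasCoeffDerivAt₂.mul {F G : ℝ → ℂ⟦X⟧⟦X⟧} {F' G' : ℂ⟦X⟧⟦X⟧} {s : ℝ}
    (hF : HasCoeffDerivAt₂ F F' s) (hG : HasCoeffDerivAt₂ G G' s) :
    HasCoeffDerivAt₂ (fun s => F s * G s) (F' * G s + F s * G') s := fun n => by
  simp only [coeff_mul, map_add]
  rw [← Finset.sum_add_distrib]
  exact HasCoeffDerivAt.sum _ fun x => (hF x.1).mul (hG x.2)

lemma hasCoeffDerivAt₂_const (F : ℂ⟦X⟧⟦X⟧) (s : ℝ) : HasCoeffDerivAt₂ (fun _ => F) 0 s :=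
  fun j => by simpa using hasCoeffDerivAt_const (coeff j F) s

lemma HasCoeffDerivAt₂.const_mul {F : ℝ → ℂ⟦X⟧⟦X⟧} {F' : ℂ⟦X⟧⟦X⟧} {s : ℝ} (G : ℂ⟦X⟧⟦X⟧)
    (hF : HasCoeffDerivAt₂ F F' s) : HasCoeffDerivAt₂ (fun s => G * F s) (G * F') s := by
  simpa using (hasCoeffDerivAt₂_const G s).mul hF

lemma HasCoeffDerivAt.C {U : ℝ → ℂ⟦X⟧} {U' : ℂ⟦X⟧} {s : ℝ} (hU : HasCoeffDerivAt U U' s) :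
    HasCoeffDerivAt₂ (fun s => PowerSeries.C (U s)) (PowerSeries.C U') s := fun j => by
  simp only [coeff_C]
  split_ifs
  · exact hU
  · exact hasCoeffDerivAt_const 0 s

lemma HasCoeffDerivAt.map {U : ℝ → ℂ⟦X⟧} {U' : ℂ⟦X⟧} {s : ℝ} (hU : HasCoeffDerivAt U U' s) :
    HasCoeffDerivAt₂ (fun s => PowerSeries.map PowerSeries.C (U s))
      (PowerSeries.map PowerSeries.C U') s := fun j i => by
  simp only [coeff_map, coeff_C]
  split_ifs
  · exact hU j
  · exact hasDerivAt_const s 0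

lemma HasCoeffDerivAt₂.oddMat {N : ℕ} {F : ℝ → ℂ⟦X⟧⟦X⟧} {F' : ℂ⟦X⟧⟦X⟧} {s : ℝ}
    (hF : HasCoeffDerivAt₂ F F' s) (i j : Fin N) :
    HasDerivAt (fun s => oddMat N (F s) i j) (oddMat N F' i j) s := hF _ _

lemma HasCoeffDerivAt.oddVec {N : ℕ} {U : ℝ → ℂ⟦X⟧} {U' : ℂ⟦X⟧} {s : ℝ}
    (hU : HasCoeffDerivAt U U' s) (i : Fin N) :
    HasDerivAt (fun s => oddVec N (U s) i) (oddVec N U' i) s := hU _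

end CoeffDeriv

end MTRogue

/-! ### Nonvanishing of f -/

namespace MTRogue

open PowerSeries Matrix

section NonVanishing

variable {N : ℕ} {β r : ℝ} {e : ℂ⟦X⟧} {W : ℂ⟦X⟧⟦X⟧}

/-- The factor i from ip/(p+q) supplies the sign: (iM)ᴴ = i(-Mᴴ). -/
lemma conj_det_I_smul_oddMat (F : ℂ⟦X⟧⟦X⟧) :
    conj (Complex.I • oddMat N F).det = (Complex.I • oddMat N (-conjSwap F)).det := by
  rw [oddMat_neg, oddMat_conjSwap, starRingEnd_apply, ← det_conjTranspose, conjTranspose_smul]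
  simp

lemma IsWeightedKernel.neg_conjSwap_gram (h : IsWeightedKernel β r e W) :
    -conjSwap (C (momentum β r) * W) =
      -(PowerSeries.map C (conjSeries (momentum β r)) * W) := by
  rw [conjSwap_mul, conjSwap_C, h.conjSwap_eq]

lemma IsWeightedKernel.neg_conjSwap_shift (h : IsWeightedKernel β r e W) (y : ℝ) :
    -conjSwap (C (momentum β r - C (Complex.I * y)) *
      PowerSeries.map C (conjSeries (momentum β r) * conjSeries (pole β r (Complex.I * y))) * W) =
    -(C (momentum β r * pole β r (Complex.I * y)) *
      PowerSeries.map C (conjSeries (momentum β r) + C (Complex.I * y)) * W) := by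
  rw [conjSwap_mul, conjSwap_mul, conjSwap_C, conjSwap_map, h.conjSwap_eq, ← map_mul conjSeries,
    conjSeries_conjSeries, map_sub conjSeries, conjSeries_C]
  simp only [map_mul, Complex.conj_I, Complex.conj_ofReal, neg_mul, map_neg, sub_neg_eq_add]
  ring

lemma IsWeightedKernel.conjTranspose_gramMat (h : IsWeightedKernel β r e W) :
    (gramMat N β r W)ᴴ = -gramMatConj N β r W := by
  rw [gramMat, gramMatConj, ← h.neg_conjSwap_gram, oddMat_neg, neg_neg, oddMat_conjSwap]

/-- From Mᴴ = -(M - e eᴴ) a kernel vector satisfies vᴴM = (vᴴe)eᴴ. Pairing with v gives |eᴴv|² = 0,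
hence vᴴM = 0. The Lyapunov identity between vᴴ and v then leaves r²·iβ times the squared modulus of
the second product. -/
lemma IsWeightedKernel.dotProduct_eq_zero (h : IsWeightedKernel β r e W) (hr : 0 < r)
    (hβ : β ≠ 0) {v : Fin N → ℂ} (hv : gramMat N β r W *ᵥ v = 0) :
    oddVec N (conjSeries e) ⬝ᵥ v = 0 ∧
      oddVec N (pole β r (Complex.I * β) * conjSeries e) ⬝ᵥ v = 0 := by
  set M := gramMat N β r W with hM
  have h1 : star v ᵥ* Mᴴ = 0 := by rw [← star_mulVec, hv, star_zero]
  rw [h.conjTranspose_gramMat, h.gramMatConj_eq, neg_sub, ← hM, vecMul_sub, sub_eq_zero,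
    vecMul_vecMulVec] at h1
  have hs : ∀ U : ℂ⟦X⟧, star v ⬝ᵥ oddVec N U = star (oddVec N (conjSeries U) ⬝ᵥ v) := fun U => by
    rw [oddVec_conjSeries, star_dotProduct]
  have h2 : oddVec N (conjSeries e) ⬝ᵥ v = 0 := by
    have h3 := congrArg (fun w => w ⬝ᵥ v) h1
    simp only [← dotProduct_mulVec, hv, dotProduct_zero, smul_dotProduct, hs] at h3
    simpa using h3
  refine ⟨h2, ?_⟩
  have h4 : star v ᵥ* M = 0 := by
    rw [← h1, hs, h2]; simp
  have h5 := congrArg (fun A => star v ⬝ᵥ (A *ᵥ v)) (h.lyapunov_evenFlow (N := N) hr)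
  simp only [add_mulVec, dotProduct_add, ← mulVec_mulVec, ← hM, hv, mulVec_zero, dotProduct_zero]
    at h5
  rw [dotProduct_mulVec _ M, h4, zero_dotProduct, vecMulVec_mulVec, h2, smul_mulVec,
    vecMulVec_mulVec] at h5
  simp only [dotProduct_smul, dotProduct_add, hs, h2, map_mul, conjSeries_pole_self hr] at h5
  have hβ' : (β : ℂ) ≠ 0 := by exact_mod_cast hβ
  have hr' : (r : ℂ) ≠ 0 := by exact_mod_cast hr.ne'
  simpa [hβ', hr'] using h5

/-- Both rank one terms of the Lyapunov identity annihilate a kernel vector, so the kernel is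
invariant under the transposed Toeplitz matrix. -/
lemma IsWeightedKernel.det_gramMat_ne_zero (h : IsWeightedKernel β r e W) (hr : 0 < r)
    (hβ : β ≠ 0) : (gramMat N β r W).det ≠ 0 := by
  refine det_ne_zero_of_kernel_invariant (coeff_two_evenFlow_ne_zero (β := β) hr)
    (fun v hv => ?_) (fun v hv hz => ?_)
  · obtain ⟨h1, h2⟩ := h.dotProduct_eq_zero hr hβ hv
    have h3 := congrArg (fun A => A *ᵥ v) (h.lyapunov_evenFlow (N := N) hr)
    simp only [add_mulVec, ← mulVec_mulVec, hv, mulVec_zero, zero_add, smul_mulVec,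
      vecMulVec_mulVec, h1, h2] at h3
    simpa using h3
  · obtain ⟨h1, h2⟩ := h.dotProduct_eq_zero hr hβ hv
    ext i
    by_cases hi : 1 ≤ (i : ℕ)
    · exact hz i hi
    have hi0 : (i : ℕ) = 0 := by omega
    have hsum : ∀ y : Fin N → ℂ, y ⬝ᵥ v = y i * v i := fun y => by
      rw [dotProduct, Finset.sum_eq_single i]
      · intro j _ hj
        have : (j : ℕ) ≠ i := fun h' => hj (Fin.ext h')
        rw [hz j (by omega), mul_zero]
      · simp
    rw [hsum] at h1 h2
    rcases mul_eq_zero.1 h1 with h1 | h1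
    · rcases mul_eq_zero.1 h2 with h2 | h2
      · exfalso
        have h4 : momentum β r - C (Complex.I * β) = C (r : ℂ) * PowerSeries.exp ℂ := by
          rw [momentum]; ring
        -- A nonzero first entry forces the X coefficients of e* and of e*/(p-b) to vanish.
        -- Comparing X coefficients in r e^X · (e*/(p-b)) = e* then gives r times a product of
        -- nonzero constant terms equal to zero.
        have h3 := congrArg (coeff 1) (congrArg (· * conjSeries e)
          (momentum_sub_mul_pole (β := β) hr β))
        simp only [mul_assoc, h4, one_mul] at h3
        simp only [oddVec, hi0, mul_zero, zero_add] at h1 h2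
        rw [coeff_C_mul, coeff_mul, Finset.Nat.sum_antidiagonal_eq_sum_range_succ_mk] at h3
        have h5 : constantCoeff (pole β r (Complex.I * β)) ≠ 0 := fun h' => by
          have := congrArg constantCoeff (momentum_sub_mul_pole (β := β) hr β)
          rw [map_mul, h'] at this
          simp at this
        have h6 : constantCoeff (conjSeries e) ≠ 0 := by
          rw [← coeff_zero_eq_constantCoeff_apply, coeff_conjSeries]
          simpa using h.ne_zero
        simp [Finset.sum_range_succ, h1, h2, hr.ne', h5, h6, coeff_exp] at h3
      · exact h2
    · exact h1

end NonVanishing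

end MTRogue

/-! ### Reduction of indices, and the x-derivative of f*/f -/

namespace MTRogue

open PowerSeries Matrix

section Reduction

variable {N : ℕ} {β r : ℝ} {e : ℂ⟦X⟧} {W : ℂ⟦X⟧⟦X⟧}

/-- The factor of a determinant under the shift of indices which is trivial up to constants. -/
noncomputable def shiftFactor (β r : ℝ) : ℂ :=
  -(constantCoeff (evenRatio β r) * constantCoeff (conjSeries (evenPole β r)))

lemma det_oddMat_neg_even_mul (hr : 0 < r) (hβ : r ^ 2 = β * (1 - β)) (F : ℂ⟦X⟧⟦X⟧) :
    (oddMat N (-(C (evenRatio β r) * (PowerSeries.map C (conjSeries (evenPole β r)) * F)))).det =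
      shiftFactor β r ^ N * (oddMat N F).det := by
  rw [oddMat_neg, oddMat_even_mul (isEven_evenRatio hr hβ),
    oddMat_map_even_mul (isEven_evenPole hr hβ).conjSeries, det_neg, det_mul, det_mul,
    det_transpose, det_evenToeplitz, det_evenToeplitz, Fintype.card_fin, shiftFactor, neg_pow
      (constantCoeff (evenRatio β r) * _), mul_pow]
  ring

lemma map_conjSeries_evenPole (hr : 0 < r) :
    PowerSeries.map C (conjSeries (evenPole β r)) =
      (PowerSeries.map C (conjSeries (momentum β r)) + C (C (Complex.I * β))) *
        PowerSeries.map C (conjSeries (pole β r 0)) *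
        PowerSeries.map (C (R := ℂ)) (conjSeries (pole β r Complex.I)) := by
  rw [evenPole_eq hr, map_mul conjSeries, map_mul conjSeries, map_sub conjSeries, conjSeries_C,
    map_mul (PowerSeries.map C), map_mul (PowerSeries.map C), map_sub (PowerSeries.map C), map_C_C]
  simp

/-- The quotient of the two weights is -[p(p-i)/(p-b)]·[(q+b)/(q(q+i))], a product of even series.
In terms of tau functions, τ_{0,1,0} = Ω₀^N τ_{-1,0,1}. -/
lemma det_raisedMat (hr : 0 < r) (hβ : r ^ 2 = β * (1 - β)) (W : ℂ⟦X⟧⟦X⟧) :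
    (raisedMat N β r W).det = shiftFactor β r ^ N * (shiftMat N β r β W).det := by
  rw [shiftMat, ← det_oddMat_neg_even_mul hr hβ, raisedMat]
  congr 3
  have h1 := map_conjSeries_pole (β := β) hr β
  have h2 := map_conjSeries_pole_zero (β := β) hr
  have h3 := C_momentum_sub_mul_pole (β := β) hr β
  rw [map_conjSeries_evenPole hr, evenRatio]
  simp only [map_mul (PowerSeries.map C), map_sub, map_mul C (momentum β r),
    map_mul C (momentum β r * (momentum β r - C Complex.I))]
  generalize C (momentum β r) = p at *
  generalize PowerSeries.map C (conjSeries (momentum β r)) = q at *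
  generalize C (C Complex.I) = a at *
  generalize C (C (Complex.I * β)) = b at *
  generalize C (pole β r (Complex.I * β)) = u at *
  generalize PowerSeries.map C (conjSeries (pole β r (Complex.I * β))) = u' at *
  generalize PowerSeries.map C (conjSeries (pole β r 0)) = z' at *
  generalize PowerSeries.map C (conjSeries (pole β r Complex.I)) = v' at *
  calc _ = p * (p - a) * v' * W * 1 * 1 * 1 := by ring
    _ = p * (p - a) * v' * W * ((p - b) * u) * ((q + b) * u') * (q * z') := by rw [h1, h2, h3]
    _ = _ := by ring

/-- The same quotient of weights; it expresses τ_{-1,1,0} = Ω₀^N τ_{-2,0,1}. -/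
lemma det_shiftMat_one (hr : 0 < r) (hβ : r ^ 2 = β * (1 - β)) (W : ℂ⟦X⟧⟦X⟧) :
    (shiftMat N β r 1 W).det = shiftFactor β r ^ N * (loweredMat N β r W).det := by
  rw [loweredMat, ← det_oddMat_neg_even_mul hr hβ, shiftMat]
  congr 2
  have h1 := map_conjSeries_pole (β := β) hr β
  have h2 := map_conjSeries_pole_zero (β := β) hr
  have h3 := C_momentum_sub_mul_pole (β := β) hr β
  have h4 := C_momentum_mul_pole_zero (β := β) hr
  rw [map_conjSeries_evenPole hr, evenRatio]
  simp only [Complex.ofReal_one, mul_one, map_mul (PowerSeries.map C), map_sub,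
    map_mul C (momentum β r), map_mul C (pole β r 0),
    map_mul C (momentum β r * (momentum β r - C Complex.I))]
  generalize C (momentum β r) = p at *
  generalize PowerSeries.map C (conjSeries (momentum β r)) = q at *
  generalize C (C Complex.I) = a at *
  generalize C (C (Complex.I * β)) = b at *
  generalize C (pole β r (Complex.I * β)) = u at *
  generalize C (pole β r 0) = z at *
  generalize PowerSeries.map C (conjSeries (pole β r (Complex.I * β))) = u' at *
  generalize PowerSeries.map C (conjSeries (pole β r 0)) = z' at *
  generalize PowerSeries.map C (conjSeries (pole β r Complex.I)) = v' at *
  calc _ = (p - a) * q * v' * W * 1 * 1 * 1 * 1 := by ring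
    _ = (p - a) * q * v' * W * ((p - b) * u) * ((q + b) * u') * (q * z') * (p * z) := by
      rw [h1, h2, h3, h4]
    _ = _ := by ring

end Reduction

section Flow

variable {N : ℕ} {β r : ℝ} {e : ℝ → ℂ⟦X⟧} {W : ℝ → ℂ⟦X⟧⟦X⟧}

/-- Since `k` is real and the Cauchy kernel is constant, the flow E' = kPE multiplies E(p)E*(q) by
k(P(p) + P*(q)). -/
lemma hasCoeffDerivAt₂_kernel {K : ℂ⟦X⟧⟦X⟧}
    (hW : ∀ s, W s = K * (C (e s) * PowerSeries.map C (conjSeries (e s)))) {P : ℂ⟦X⟧} {k s : ℝ}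
    (he : HasCoeffDerivAt e (C (k : ℂ) * (P * e s)) s) :
    HasCoeffDerivAt₂ W (C (C (k : ℂ)) * ((C P + PowerSeries.map C (conjSeries P)) * W s)) s := by
  have h1 := (he.C.mul he.conjSeries.map).const_mul K
  have h2 : (fun s => K * (C (e s) * PowerSeries.map C (conjSeries (e s)))) = W :=
    funext fun s => (hW s).symm
  rw [h2] at h1
  convert h1 using 1
  rw [hW s, map_mul conjSeries, map_mul conjSeries, conjSeries_C, Complex.conj_ofReal,
    map_mul (PowerSeries.map C), map_mul (PowerSeries.map C), map_C_C, map_mul C (C (k : ℂ)),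
    map_mul C P]
  ring

lemma hasCoeffDerivAt_conj_mul {P : ℂ⟦X⟧} {k s : ℝ}
    (he : HasCoeffDerivAt e (C (k : ℂ) * (P * e s)) s) (V : ℂ⟦X⟧) :
    HasCoeffDerivAt (fun s => V * conjSeries (e s))
      (C (k : ℂ) * (V * conjSeries P * conjSeries (e s))) s := by
  convert he.conjSeries.const_mul V using 1
  rw [map_mul conjSeries, map_mul conjSeries, conjSeries_C, Complex.conj_ofReal]
  ring

variable {K : ℂ⟦X⟧⟦X⟧} {k s : ℝ}

/-- The flow multiplies the weight by p + q, which cancels the denominator and leaves rank one. -/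
lemma hasDerivAt_gramMat_x (h : ∀ s, IsWeightedKernel β r (e s) (W s))
    (hW : ∀ s, W s = K * (C (e s) * PowerSeries.map C (conjSeries (e s))))
    (he : HasCoeffDerivAt e (C (k : ℂ) * (momentum β r * e s)) s) (i j : Fin N) :
    HasDerivAt (fun s => gramMat N β r (W s) i j)
      (((k : ℂ) • vecMulVec (oddVec N (momentum β r * e s)) (oddVec N (conjSeries (e s)))) i j)
      s := by
  refine (((hasCoeffDerivAt₂_kernel hW he).const_mul
    (C (momentum β r))).oddMat i j).congr_deriv ?_
  rw [← oddMat_mul_map, ← oddMat_C_mul]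
  refine congrFun (congrFun (congrArg (oddMat N) ?_) i) j
  rw [map_mul C (momentum β r)]
  linear_combination C (C (k : ℂ)) * C (momentum β r) * (h s).add_mul

/-- Here (1/p + 1/q)·p/(p+q) = 1/q, again of rank one. -/
lemma hasDerivAt_gramMat_t (hr : 0 < r) (h : ∀ s, IsWeightedKernel β r (e s) (W s))
    (hW : ∀ s, W s = K * (C (e s) * PowerSeries.map C (conjSeries (e s))))
    (he : HasCoeffDerivAt e (C (k : ℂ) * (pole β r 0 * e s)) s) (i j : Fin N) :
    HasDerivAt (fun s => gramMat N β r (W s) i j)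
      (((k : ℂ) • vecMulVec (oddVec N (e s))
        (oddVec N (conjSeries (pole β r 0) * conjSeries (e s)))) i j) s := by
  refine (((hasCoeffDerivAt₂_kernel hW he).const_mul
    (C (momentum β r))).oddMat i j).congr_deriv ?_
  rw [← oddMat_mul_map, ← oddMat_C_mul]
  refine congrFun (congrFun (congrArg (oddMat N) ?_) i) j
  rw [map_mul (PowerSeries.map C)]
  have h1 := C_momentum_mul_pole_zero (β := β) hr
  have h2 := map_conjSeries_pole_zero (β := β) hr
  linear_combination C (C (k : ℂ)) * PowerSeries.map C (conjSeries (pole β r 0)) * (h s).add_mul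
    + C (C (k : ℂ)) * W s * h1 - C (C (k : ℂ)) * W s * h2

lemma hasDerivAt_gramMatConj_t (hr : 0 < r) (h : ∀ s, IsWeightedKernel β r (e s) (W s))
    (hW : ∀ s, W s = K * (C (e s) * PowerSeries.map C (conjSeries (e s))))
    (he : HasCoeffDerivAt e (C (k : ℂ) * (pole β r 0 * e s)) s) (i j : Fin N) :
    HasDerivAt (fun s => gramMatConj N β r (W s) i j)
      ((-((k : ℂ) • vecMulVec (oddVec N (pole β r 0 * e s)) (oddVec N (conjSeries (e s))))) i j)
      s := by
  have h0 := ((hasCoeffDerivAt₂_kernel hW he).const_mul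
    (-PowerSeries.map C (conjSeries (momentum β r)))).oddMat i j
  simp only [neg_mul] at h0
  refine h0.congr_deriv ?_
  rw [← oddMat_mul_map, ← oddMat_C_mul, ← oddMat_neg]
  refine congrFun (congrFun (congrArg (oddMat N) ?_) i) j
  rw [map_mul C (pole β r 0)]
  have h1 := C_momentum_mul_pole_zero (β := β) hr
  have h2 := map_conjSeries_pole_zero (β := β) hr
  linear_combination -C (C (k : ℂ)) * C (pole β r 0) * (h s).add_mul
    + C (C (k : ℂ)) * W s * h1 - C (C (k : ℂ)) * W s * h2

lemma HasCoeffDerivAt.oddVec_smul {U : ℝ → ℂ⟦X⟧} {V : ℂ⟦X⟧} {c : ℂ}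
    (hU : HasCoeffDerivAt U (PowerSeries.C c * V) s) (i : Fin N) :
    HasDerivAt (fun s => MTRogue.oddVec N (U s) i) ((c • MTRogue.oddVec N V) i) s := by
  rw [← oddVec_C_mul]; exact hU.oddVec i

lemma dotProduct_smul_vecMulVec (M : Matrix (Fin N) (Fin N) ℂ) (c : ℂ) (y z u v : Fin N → ℂ) :
    y ⬝ᵥ (M⁻¹ *ᵥ ((c • vecMulVec u v) *ᵥ (M⁻¹ *ᵥ z))) = c * (invForm M y u * invForm M v z) := by
  rw [smul_mulVec, mulVec_smul, dotProduct_smul, dotProduct_inv_mulVec_vecMulVec, smul_eq_mul]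

/-- The `x`-derivative of `f* / f`. -/
lemma hasDerivAt_ratio_x (hr : 0 < r) (hβ : r ^ 2 = β * (1 - β)) (hβ0 : β ≠ 0)
    (h : ∀ s, IsWeightedKernel β r (e s) (W s))
    (hW : ∀ s, W s = K * (C (e s) * PowerSeries.map C (conjSeries (e s))))
    (he : HasCoeffDerivAt e (C (k : ℂ) * (momentum β r * e s)) s) :
    HasDerivAt (fun s => (gramMatConj N β r (W s)).det / (gramMat N β r (W s)).det)
      (-(Complex.I * k * (1 - β) * ((gramMatConj N β r (W s)).det / (gramMat N β r (W s)).det -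
        (shiftMat N β r β (W s)).det * (shiftMatConj N β r β (W s)).det /
          (gramMat N β r (W s)).det ^ 2))) s := by
  have hM := fun s => (h s).det_gramMat_ne_zero (N := N) hr hβ0
  have e1 : ∀ s, (gramMatConj N β r (W s)).det / (gramMat N β r (W s)).det =
      1 - invForm (gramMat N β r (W s)) (oddVec N (conjSeries (e s))) (oddVec N (e s)) := fun s => by
    rw [(h s).gramMatConj_eq, det_sub_vecMulVec (hM s), mul_div_cancel_left₀ _ (hM s)]
  have e2 : (shiftMat N β r β (W s)).det * (shiftMatConj N β r β (W s)).det /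
      (gramMat N β r (W s)).det ^ 2 =
      (1 - (Complex.I * β) * invForm (gramMat N β r (W s))
        (oddVec N (pole β r (Complex.I * β) * conjSeries (e s))) (oddVec N (e s))) *
      (1 - invForm (gramMat N β r (W s)) (oddVec N (conjSeries (e s))) (oddVec N (e s) +
        (Complex.I * β) • oddVec N (pole β r (Complex.I * β) * e s))) := by
    have e3 : momentum β r * pole β r (Complex.I * β) * e s =
        e s + C (Complex.I * β) * (pole β r (Complex.I * β) * e s) := by
      linear_combination e s * momentum_sub_mul_pole (β := β) hr β
    rw [(h s).shiftMat_eq hr, (h s).shiftMatConj_eq hr, det_sub_vecMulVec (hM s),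
      det_sub_vecMulVec (hM s), e3, oddVec_add, oddVec_C_mul, invForm_smul_right,
      conjSeries_pole_self hr]
    have := hM s
    field_simp
  have hd := (hasDerivAt_invForm (hasDerivAt_gramMat_x h hW he)
    (fun i => (hasCoeffDerivAt_conj_mul he 1).oddVec_smul i) (fun i => he.oddVec_smul i)
    (hM s)).const_sub 1
  simp only [one_mul] at hd
  simp only [e1, e2]
  refine hd.congr_deriv ?_
  have hb : Complex.I * (β : ℂ) ≠ 0 :=
    mul_ne_zero Complex.I_ne_zero (by exact_mod_cast hβ0)
  -- With F the even series in the respective variable, p = F - r²/(p-b) + b and q = F - r²/(q+b) -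
  -- b. This explains δ = b and T = T'.
  have hflow := invForm_flow (hM s) ((h s).lyapunov_evenFlow hr)
    (ϕd := oddVec N (momentum β r * e s))
    (ψ := oddVec N (conjSeries (e s)))
    (ψd := oddVec N (conjSeries (momentum β r) * conjSeries (e s))) (δ := Complex.I * β)
    (by rw [← oddVec_even_mul (isEven_evenFlow hr), ← oddVec_C_mul, ← oddVec_C_mul, ← oddVec_sub,
          ← oddVec_add, evenFlow]
        congr 1; ring)
    (by rw [← oddVec_even_mul (isEven_evenFlow hr), ← oddVec_C_mul, ← oddVec_C_mul, ← oddVec_sub,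
          ← oddVec_sub, evenFlow, conjSeries_momentum]
        congr 1; ring)
  rw [dotProduct_inv_mulVec_vecMulVec] at hflow
  rw [dotProduct_smul_vecMulVec, invForm_smul_left, invForm_smul_right]
  have hr2 : (r : ℂ) ^ 2 = β * (1 - β) := by exact_mod_cast hβ
  rw [hr2] at hflow
  -- The flow identity carries the factor c = b, which is nonzero.
  apply mul_left_cancel₀ hb
  linear_combination (-(k : ℂ)) * hflow + (β * k * (1 - β) * ((1 - invForm (gramMat N β r (W s))
      (oddVec N (conjSeries (e s))) (oddVec N (e s))) - (1 - (Complex.I * β) *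
      invForm (gramMat N β r (W s)) (oddVec N (pole β r (Complex.I * β) * conjSeries (e s)))
      (oddVec N (e s))) * (1 - invForm (gramMat N β r (W s)) (oddVec N (conjSeries (e s)))
      (oddVec N (e s) + (Complex.I * β) • oddVec N (pole β r (Complex.I * β) * e s))))) *
      Complex.I_sq

end Flow

end MTRogue

/-! ### The t-derivative of f*/f, and the derivatives of g/f* and h/f -/

namespace MTRogue

open PowerSeries Matrix

section Flow

variable {N : ℕ} {β r : ℝ} {e : ℝ → ℂ⟦X⟧} {W : ℝ → ℂ⟦X⟧⟦X⟧}
variable {K : ℂ⟦X⟧⟦X⟧} {k s : ℝ}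

lemma conjSeries_pole_zero (hr : 0 < r) :
    conjSeries (momentum β r) * conjSeries (pole β r 0) = 1 := by
  simpa using conjSeries_pole (β := β) hr 0

lemma conjSeries_pole_I (hr : 0 < r) :
    (conjSeries (momentum β r) + C Complex.I) * conjSeries (pole β r Complex.I) = 1 := by
  simpa using conjSeries_pole (β := β) hr 1

/-- The `t`-derivative of `f* / f`. -/
lemma hasDerivAt_ratio_t (hr : 0 < r) (hβ : r ^ 2 = β * (1 - β)) (hβ0 : β ≠ 0)
    (h : ∀ s, IsWeightedKernel β r (e s) (W s))
    (hW : ∀ s, W s = K * (C (e s) * PowerSeries.map C (conjSeries (e s))))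
    (he : HasCoeffDerivAt e (C ((k * β : ℝ) : ℂ) * (pole β r 0 * e s)) s) :
    HasDerivAt (fun s => (gramMatConj N β r (W s)).det / (gramMat N β r (W s)).det)
      (-(Complex.I * k * (1 - β) * ((gramMatConj N β r (W s)).det / (gramMat N β r (W s)).det -
        (shiftMat N β r 1 (W s)).det * (shiftMatConj N β r 1 (W s)).det /
          (gramMat N β r (W s)).det ^ 2))) s := by
  have hM := fun s => (h s).det_gramMat_ne_zero (N := N) hr hβ0
  have e1 : ∀ s, (gramMatConj N β r (W s)).det / (gramMat N β r (W s)).det =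
      1 - invForm (gramMat N β r (W s)) (oddVec N (conjSeries (e s))) (oddVec N (e s)) := fun s => by
    rw [(h s).gramMatConj_eq, det_sub_vecMulVec (hM s), mul_div_cancel_left₀ _ (hM s)]
  have e2 : (shiftMat N β r 1 (W s)).det * (shiftMatConj N β r 1 (W s)).det /
      (gramMat N β r (W s)).det ^ 2 =
      (1 - Complex.I * invForm (gramMat N β r (W s))
        (oddVec N (conjSeries (pole β r Complex.I) * conjSeries (e s))) (oddVec N (e s))) *
      (1 - invForm (gramMat N β r (W s)) (oddVec N (conjSeries (e s))) (oddVec N (e s) +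
        Complex.I • oddVec N (pole β r Complex.I * e s))) := by
    have e3 : momentum β r * pole β r Complex.I * e s =
        e s + C Complex.I * (pole β r Complex.I * e s) := by
      linear_combination e s * momentum_sub_I_mul_pole (β := β) hr
    rw [(h s).shiftMat_eq hr, (h s).shiftMatConj_eq hr, det_sub_vecMulVec (hM s),
      det_sub_vecMulVec (hM s)]
    simp only [Complex.ofReal_one, mul_one]
    rw [e3, oddVec_add, oddVec_C_mul, invForm_smul_right]
    have := hM s
    field_simp
  have hd := (hasDerivAt_invForm (hasDerivAt_gramMat_t hr h hW he)
    (fun i => (hasCoeffDerivAt_conj_mul he 1).oddVec_smul i) (fun i => he.oddVec_smul i)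
    (hM s)).const_sub 1
  simp only [one_mul] at hd
  simp only [e1, e2]
  refine hd.congr_deriv ?_
  have hev := isEven_evenPole hr hβ
  have h6 : conjSeries (evenPole β r) = C (β : ℂ) * conjSeries (pole β r 0) +
      C (1 - β : ℂ) * conjSeries (pole β r Complex.I) := by
    rw [evenPole, map_add conjSeries, map_mul conjSeries, map_mul conjSeries, conjSeries_C,
      conjSeries_C]
    simp
  -- Now β/p = `evenPole` - (1-β)/(p-i), so c = i, ρ = 1-β and no scalar part δ is left.
  have hflow := invForm_flow (hM s) ((h s).lyapunov_evenPole hr hβ)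
    (ϕd := (β : ℂ) • oddVec N (pole β r 0 * e s))
    (ψ := oddVec N (conjSeries (e s)))
    (ψd := (β : ℂ) • oddVec N (conjSeries (pole β r 0) * conjSeries (e s))) (δ := 0)
    (by rw [← oddVec_even_mul hev, ← oddVec_C_mul, ← oddVec_C_mul, ← oddVec_sub, evenPole,
          zero_smul, add_zero]
        congr 1; ring)
    (by rw [← oddVec_even_mul hev.conjSeries, ← oddVec_C_mul, ← oddVec_C_mul, ← oddVec_sub, h6,
          zero_smul, sub_zero]
        congr 1; ring)
  rw [dotProduct_smul_vecMulVec, invForm_smul_left, invForm_smul_right] at hflow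
  rw [dotProduct_smul_vecMulVec, invForm_smul_left, invForm_smul_right]
  apply mul_left_cancel₀ Complex.I_ne_zero
  push_cast
  linear_combination (-(k : ℂ)) * hflow + (k * (1 - β) * ((1 - invForm (gramMat N β r (W s))
      (oddVec N (conjSeries (e s))) (oddVec N (e s))) - (1 - Complex.I *
      invForm (gramMat N β r (W s)) (oddVec N (conjSeries (pole β r Complex.I) *
        conjSeries (e s))) (oddVec N (e s))) *
      (1 - invForm (gramMat N β r (W s)) (oddVec N (conjSeries (e s)))
      (oddVec N (e s) + Complex.I • oddVec N (pole β r Complex.I * e s))))) *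
      Complex.I_sq

/-- The `x`-derivative of `g / f`. -/
lemma hasDerivAt_shift_div_x (hr : 0 < r) (hβ0 : β ≠ 0)
    (h : ∀ s, IsWeightedKernel β r (e s) (W s))
    (hW : ∀ s, W s = K * (C (e s) * PowerSeries.map C (conjSeries (e s))))
    (he : HasCoeffDerivAt e (C (k : ℂ) * (momentum β r * e s)) s) :
    HasDerivAt (fun s => (shiftMat N β r 1 (W s)).det / (gramMat N β r (W s)).det)
      (-(Complex.I * k * ((shiftMat N β r 1 (W s)).det / (gramMat N β r (W s)).det -
        (raisedMat N β r (W s)).det * (gramMatConj N β r (W s)).det /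
          (gramMat N β r (W s)).det ^ 2))) s := by
  have hM := fun s => (h s).det_gramMat_ne_zero (N := N) hr hβ0
  have e1 : ∀ s, (shiftMat N β r 1 (W s)).det / (gramMat N β r (W s)).det =
      1 - Complex.I * invForm (gramMat N β r (W s))
        (oddVec N (conjSeries (pole β r Complex.I) * conjSeries (e s))) (oddVec N (e s)) :=
    fun s => by
      rw [(h s).shiftMat_eq hr, det_sub_vecMulVec (hM s), mul_div_cancel_left₀ _ (hM s),
        invForm_smul_right]
      simp
  have e2 : (raisedMat N β r (W s)).det * (gramMatConj N β r (W s)).det /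
      (gramMat N β r (W s)).det ^ 2 =
      (1 - invForm (gramMat N β r (W s))
        (oddVec N (conjSeries (pole β r Complex.I) * conjSeries (e s)))
        (oddVec N (momentum β r * e s))) *
      (1 - invForm (gramMat N β r (W s)) (oddVec N (conjSeries (e s))) (oddVec N (e s))) := by
    rw [(h s).raisedMat_eq hr, (h s).gramMatConj_eq, det_sub_vecMulVec (hM s),
      det_sub_vecMulVec (hM s)]
    have := hM s
    field_simp
  have e3 : oddVec N (conjSeries (pole β r Complex.I) * conjSeries (momentum β r) *
      conjSeries (e s)) = oddVec N (conjSeries (e s)) -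
        Complex.I • oddVec N (conjSeries (pole β r Complex.I) * conjSeries (e s)) := by
    rw [← oddVec_C_mul, ← oddVec_sub]
    congr 1
    linear_combination conjSeries (e s) * conjSeries_pole_I (β := β) hr
  have hd := ((hasDerivAt_invForm (hasDerivAt_gramMat_x h hW he)
    (fun i => (hasCoeffDerivAt_conj_mul he (conjSeries (pole β r Complex.I))).oddVec_smul i)
    (fun i => he.oddVec_smul i) (hM s)).const_mul Complex.I).const_sub 1
  simp only [e1, e2]
  refine hd.congr_deriv ?_
  rw [dotProduct_smul_vecMulVec, invForm_smul_left, invForm_smul_right, e3, invForm_sub_left,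
    invForm_smul_left]
  ring

/-- The `t`-derivative of `h / f*`. -/
lemma hasDerivAt_shift_div_t (hr : 0 < r)
    (h : ∀ s, IsWeightedKernel β r (e s) (W s))
    (hW : ∀ s, W s = K * (C (e s) * PowerSeries.map C (conjSeries (e s))))
    (hN : ∀ s, (gramMatConj N β r (W s)).det ≠ 0)
    (he : HasCoeffDerivAt e (C ((k * β : ℝ) : ℂ) * (pole β r 0 * e s)) s) :
    HasDerivAt (fun s => (shiftMat N β r β (W s)).det / (gramMatConj N β r (W s)).det)
      (-(Complex.I * k * ((loweredMat N β r (W s)).det * (gramMat N β r (W s)).det /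
          (gramMatConj N β r (W s)).det ^ 2 -
        (shiftMat N β r β (W s)).det / (gramMatConj N β r (W s)).det))) s := by
  set Q := conjSeries (momentum β r) * conjSeries (pole β r (Complex.I * β)) with hQ
  have e1 : ∀ s, (shiftMat N β r β (W s)).det / (gramMatConj N β r (W s)).det =
      1 + invForm (gramMatConj N β r (W s)) (oddVec N (Q * conjSeries (e s))) (oddVec N (e s)) :=
    fun s => by
      rw [(h s).shiftMat_eq_conj hr, det_add_vecMulVec (hN s), mul_div_cancel_left₀ _ (hN s)]
  have e2 : (loweredMat N β r (W s)).det * (gramMat N β r (W s)).det /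
      (gramMatConj N β r (W s)).det ^ 2 =
      (1 + Complex.I * β * invForm (gramMatConj N β r (W s)) (oddVec N (Q * conjSeries (e s)))
        (oddVec N (pole β r 0 * e s))) *
      (1 + invForm (gramMatConj N β r (W s)) (oddVec N (conjSeries (e s))) (oddVec N (e s))) := by
    rw [(h s).loweredMat_eq hr, (h s).gramMat_eq, det_add_vecMulVec (hN s),
      det_add_vecMulVec (hN s), invForm_smul_right, ← hQ]
    have := hN s
    field_simp
  -- The weights satisfy b·(q/(q+b))·(1/q) = 1 - q/(q+b).
  have e3 : (Complex.I * β) • oddVec N (Q * conjSeries (pole β r 0) * conjSeries (e s)) =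
      oddVec N (conjSeries (e s)) - oddVec N (Q * conjSeries (e s)) := by
    rw [← oddVec_C_mul, ← oddVec_sub]
    congr 1
    linear_combination (C (Complex.I * β) * conjSeries (pole β r (Complex.I * β)) *
      conjSeries (e s)) * conjSeries_pole_zero (β := β) hr +
      conjSeries (e s) * conjSeries_pole (β := β) hr β
  have hd := (hasDerivAt_invForm (hasDerivAt_gramMatConj_t hr h hW he)
    (fun i => (hasCoeffDerivAt_conj_mul he Q).oddVec_smul i)
    (fun i => he.oddVec_smul i) (hN s)).const_add 1
  simp only [e1, e2]
  refine hd.congr_deriv ?_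
  have e4 := congrArg (fun y => invForm (gramMatConj N β r (W s)) y (oddVec N (e s))) e3
  simp only [invForm_smul_left, invForm_sub_left] at e4
  rw [← neg_smul, dotProduct_smul_vecMulVec, invForm_smul_left, invForm_smul_right]
  apply mul_left_cancel₀ Complex.I_ne_zero
  push_cast
  linear_combination (k : ℂ) * e4 - ((-k * ((1 + Complex.I * β * invForm
        (gramMatConj N β r (W s)) (oddVec N (Q * conjSeries (e s)))
        (oddVec N (pole β r 0 * e s))) *
      (1 + invForm (gramMatConj N β r (W s)) (oddVec N (conjSeries (e s))) (oddVec N (e s))) -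
      (1 + invForm (gramMatConj N β r (W s)) (oddVec N (Q * conjSeries (e s))) (oddVec N (e s))))))
      * Complex.I_sq

/-- The `x`-derivative of `g / f*`. -/
lemma hasDerivAt_waveU_x (hr : 0 < r) (hβ : r ^ 2 = β * (1 - β)) (hβ0 : β ≠ 0)
    (h : ∀ s, IsWeightedKernel β r (e s) (W s))
    (hW : ∀ s, W s = K * (C (e s) * PowerSeries.map C (conjSeries (e s))))
    (hN : ∀ s, (gramMatConj N β r (W s)).det ≠ 0)
    (he : HasCoeffDerivAt e (C (k : ℂ) * (momentum β r * e s)) s) :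
    HasDerivAt (fun s => (shiftMat N β r 1 (W s)).det / (gramMatConj N β r (W s)).det)
      (-(Complex.I * k * (β * ((shiftMat N β r 1 (W s)).det / (gramMatConj N β r (W s)).det) -
        (raisedMat N β r (W s)).det / (gramMat N β r (W s)).det +
        (1 - β) * ((shiftMat N β r 1 (W s)).det / (gramMatConj N β r (W s)).det) *
          ((shiftMat N β r β (W s)).det * (shiftMatConj N β r β (W s)).det /
          ((gramMat N β r (W s)).det * (gramMatConj N β r (W s)).det))))) s := by
  have hM := fun s => (h s).det_gramMat_ne_zero (N := N) hr hβ0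
  have h1 := hasDerivAt_shift_div_x (N := N) hr hβ0 h hW he
  have h2 := hasDerivAt_ratio_x (N := N) hr hβ hβ0 h hW he
  -- The quotient g/f* is (g/f)/(f*/f).
  have h3 := h1.fun_div h2 (div_ne_zero (hN s) (hM s))
  refine (h3.congr_deriv ?_).congr_of_eventuallyEq (Filter.Eventually.of_forall fun s => ?_)
  · have := hM s
    have := hN s
    field_simp
    ring
  · have := hM s
    have := hN s
    simp only
    field_simp

/-- The `t`-derivative of `h / f`. -/
lemma hasDerivAt_waveV_t (hr : 0 < r) (hβ : r ^ 2 = β * (1 - β)) (hβ0 : β ≠ 0)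
    (h : ∀ s, IsWeightedKernel β r (e s) (W s))
    (hW : ∀ s, W s = K * (C (e s) * PowerSeries.map C (conjSeries (e s))))
    (hN : ∀ s, (gramMatConj N β r (W s)).det ≠ 0)
    (he : HasCoeffDerivAt e (C ((k * β : ℝ) : ℂ) * (pole β r 0 * e s)) s) :
    HasDerivAt (fun s => (shiftMat N β r β (W s)).det / (gramMat N β r (W s)).det)
      (-(Complex.I * k * ((loweredMat N β r (W s)).det / (gramMatConj N β r (W s)).det -
        β * ((shiftMat N β r β (W s)).det / (gramMat N β r (W s)).det) -
        (1 - β) * ((shiftMat N β r β (W s)).det / (gramMat N β r (W s)).det) *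
          ((shiftMat N β r 1 (W s)).det * (shiftMatConj N β r 1 (W s)).det /
          ((gramMat N β r (W s)).det * (gramMatConj N β r (W s)).det))))) s := by
  have hM := fun s => (h s).det_gramMat_ne_zero (N := N) hr hβ0
  have h1 := hasDerivAt_shift_div_t (N := N) hr h hW hN he
  have h2 := hasDerivAt_ratio_t (N := N) hr hβ hβ0 h hW he
  -- The quotient h/f is (h/f*)·(f*/f).
  have h3 := h1.fun_mul h2
  refine (h3.congr_deriv ?_).congr_of_eventuallyEq (Filter.Eventually.of_forall fun s => ?_)
  · have := hM s
    have := hN s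
    field_simp
    ring
  · have := hM s
    have := hN s
    simp only
    field_simp

end Flow

end MTRogue

/-! ### Exponentials of power series -/

namespace MTRogue

open PowerSeries Matrix

/-- `e` is the series of the exponential of `S`. -/
structure IsExpSeries (S e : ℂ⟦X⟧) : Prop where
  derivative_eq : d⁄dX ℂ e = d⁄dX ℂ S * e
  constantCoeff_eq : constantCoeff e = Complex.exp (constantCoeff S)

namespace IsExpSeries

lemma coeff_succ {S e : ℂ⟦X⟧} (h : IsExpSeries S e) (n : ℕ) :
    coeff (n + 1) e = (∑ x ∈ Finset.HasAntidiagonal.antidiagonal n,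
      coeff x.1 (d⁄dX ℂ S) * coeff x.2 e) / (n + 1) := by
  rw [← coeff_mul, ← h.derivative_eq, coeff_derivative, mul_div_cancel_right₀]
  exact_mod_cast n.succ_ne_zero

/-- The equation e' = S'e is a recursion in which the coefficient of order n involves S only up to
order n. Uniqueness and the independence of R both come from this. -/
lemma coeff_congr {S e S' e' : ℂ⟦X⟧} (h : IsExpSeries S e) (h' : IsExpSeries S' e') {n : ℕ}
    (hS : ∀ m ≤ n, coeff m S = coeff m S') : coeff n e = coeff n e' := by
  induction n using Nat.strong_induction_on with
  | _ n ih =>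
    rcases n with _ | n
    · have := hS 0 le_rfl
      simp only [coeff_zero_eq_constantCoeff] at this ⊢
      rw [h.constantCoeff_eq, h'.constantCoeff_eq, this]
    · rw [h.coeff_succ, h'.coeff_succ]
      congr 1
      refine Finset.sum_congr rfl fun x hx => ?_
      have hx' := Finset.HasAntidiagonal.mem_antidiagonal.1 hx
      rw [coeff_derivative, coeff_derivative, hS (x.1 + 1) (by omega),
        ih x.2 (by omega) fun m hm => hS m (by omega)]

lemma unique {S e e' : ℂ⟦X⟧} (h : IsExpSeries S e) (h' : IsExpSeries S e') : e = e' := by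
  ext n; exact h.coeff_congr h' fun _ _ => rfl

lemma conjSeries {S e : ℂ⟦X⟧} (h : IsExpSeries S e) :
    IsExpSeries (MTRogue.conjSeries S) (MTRogue.conjSeries e) := by
  have hd : ∀ U : ℂ⟦X⟧, d⁄dX ℂ (MTRogue.conjSeries U) = MTRogue.conjSeries (d⁄dX ℂ U) := by
    intro U
    ext n
    simp [coeff_derivative, coeff_conjSeries]
  have hc : ∀ U : ℂ⟦X⟧, constantCoeff (MTRogue.conjSeries U) = conj (constantCoeff U) := by
    intro U
    rw [← coeff_zero_eq_constantCoeff_apply, coeff_conjSeries, coeff_zero_eq_constantCoeff_apply]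
  refine ⟨?_, ?_⟩
  · rw [hd, hd, h.derivative_eq, map_mul]
  · rw [hc, hc, h.constantCoeff_eq, Complex.exp_conj]

lemma constantCoeff_ne_zero {S e : ℂ⟦X⟧} (h : IsExpSeries S e) : constantCoeff e ≠ 0 := by
  rw [h.constantCoeff_eq]; exact Complex.exp_ne_zero _

/-- The parameter derivative is carried through the recursion for the coefficients; the Leibniz rule
for S'e closes the induction. -/
lemma hasCoeffDerivAt {S e : ℝ → ℂ⟦X⟧} (h : ∀ s, IsExpSeries (S s) (e s)) {S' : ℂ⟦X⟧} {s : ℝ}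
    (hS : HasCoeffDerivAt S S' s) : HasCoeffDerivAt e (S' * e s) s := by
  intro n
  induction n using Nat.strong_induction_on with
  | _ n ih =>
    rcases n with _ | n
    · have h1 := (hS 0).cexp
      simp only [coeff_zero_eq_constantCoeff, map_mul] at h1 ⊢
      simp only [(h _).constantCoeff_eq]
      rwa [mul_comm]
    · have hd : ∀ m, HasDerivAt (fun s => coeff m (d⁄dX ℂ (S s))) (coeff m (d⁄dX ℂ S')) s :=
        fun m => by
          simp only [coeff_derivative]
          exact (hS (m + 1)).mul_const _
      have h1 : HasDerivAt (fun s => (∑ x ∈ Finset.HasAntidiagonal.antidiagonal n,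
          coeff x.1 (d⁄dX ℂ (S s)) * coeff x.2 (e s)) / ((n : ℂ) + 1))
          ((∑ x ∈ Finset.HasAntidiagonal.antidiagonal n,
          (coeff x.1 (d⁄dX ℂ S') * coeff x.2 (e s) +
            coeff x.1 (d⁄dX ℂ (S s)) * coeff x.2 (S' * e s))) / ((n : ℂ) + 1)) s := by
        refine (HasDerivAt.fun_sum fun x hx => ?_).div_const _
        have hx' := Finset.HasAntidiagonal.mem_antidiagonal.1 hx
        exact (hd x.1).mul (ih x.2 (by omega))
      simp only [(h _).coeff_succ]
      refine h1.congr_deriv ?_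
      rw [Finset.sum_add_distrib, ← coeff_mul, ← coeff_mul, ← map_add]
      have h2 : d⁄dX ℂ S' * e s + d⁄dX ℂ (S s) * (S' * e s) = d⁄dX ℂ (S' * e s) := by
        rw [Derivation.leibniz, (h s).derivative_eq]
        simp only [smul_eq_mul]; ring
      rw [h2, coeff_derivative, mul_div_cancel_right₀]
      exact_mod_cast n.succ_ne_zero

lemma contDiff_coeff {E : Type*} [NormedAddCommGroup E] [NormedSpace ℝ E] {S e : E → ℂ⟦X⟧}
    (h : ∀ z, IsExpSeries (S z) (e z)) {m : WithTop ℕ∞}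
    (hS : ∀ n, ContDiff ℝ m fun z => coeff n (S z)) (n : ℕ) :
    ContDiff ℝ m fun z => coeff n (e z) := by
  induction n using Nat.strong_induction_on with
  | _ n ih =>
    rcases n with _ | n
    · have h1 := (hS 0).cexp
      simpa only [coeff_zero_eq_constantCoeff, (h _).constantCoeff_eq] using h1
    · simp only [(h _).coeff_succ, coeff_derivative]
      refine (ContDiff.sum fun x hx => ?_).div_const _
      have hx' := Finset.HasAntidiagonal.mem_antidiagonal.1 hx
      exact ((hS (x.1 + 1)).mul contDiff_const).mul (ih x.2 (by omega))

end IsExpSeries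

lemma isExpSeries_logTaylor {b z₀ : ℂ} {S : ℂ → ℂ} (hS : AnalyticAt ℂ S z₀) :
    IsExpSeries (logTaylor b z₀ S) (logTaylor b z₀ fun z => Complex.exp (S z)) :=
  ⟨derivative_logTaylor_exp hS, by simp [constantCoeff_logTaylor]⟩

section ContDiffMat

variable {E : Type*} [NormedAddCommGroup E] [NormedSpace ℝ E] {m : WithTop ℕ∞}

lemma contDiff_det {n : Type*} [Fintype n] [DecidableEq n] {M : E → Matrix n n ℂ}
    (hM : ∀ i j, ContDiff ℝ m fun z => M z i j) : ContDiff ℝ m fun z => (M z).det := by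
  simp only [det_apply']
  refine ContDiff.sum fun τ _ => contDiff_const.mul ?_
  exact contDiff_prod fun i _ => hM _ _

lemma coeff_coeff_C_mul_map_mul (U V : ℂ⟦X⟧) (K : ℂ⟦X⟧⟦X⟧) (i j : ℕ) :
    coeff i (coeff j (C U * (PowerSeries.map C V * K))) =
      ∑ y ∈ Finset.HasAntidiagonal.antidiagonal i, coeff y.1 U *
        ∑ x ∈ Finset.HasAntidiagonal.antidiagonal j, coeff x.1 V * coeff y.2 (coeff x.2 K) := by
  rw [coeff_C_mul, coeff_mul]
  refine Finset.sum_congr rfl fun y _ => ?_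
  rw [coeff_mul, map_sum]
  simp only [coeff_map, coeff_C_mul]

lemma contDiff_oddMat {N : ℕ} {U V : E → ℂ⟦X⟧} (K : ℂ⟦X⟧⟦X⟧)
    (hU : ∀ n, ContDiff ℝ m fun z => coeff n (U z))
    (hV : ∀ n, ContDiff ℝ m fun z => coeff n (V z)) (i j : Fin N) :
    ContDiff ℝ m fun z => oddMat N (C (U z) * (PowerSeries.map C (V z) * K)) i j := by
  simp only [oddMat, of_apply, coeff_coeff_C_mul_map_mul]
  exact ContDiff.sum fun y _ => (hU _).mul (ContDiff.sum fun x _ => (hV _).mul contDiff_const)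

lemma oddMat_congr {N : ℕ} {U U' V V' : ℂ⟦X⟧} (K : ℂ⟦X⟧⟦X⟧)
    (hU : ∀ n < 2 * N, coeff n U = coeff n U') (hV : ∀ n < 2 * N, coeff n V = coeff n V') :
    oddMat N (C U * (PowerSeries.map C V * K)) = oddMat N (C U' * (PowerSeries.map C V' * K)) := by
  ext i j
  simp only [oddMat, of_apply, coeff_coeff_C_mul_map_mul]
  refine Finset.sum_congr rfl fun y hy => ?_
  have hy' := Finset.HasAntidiagonal.mem_antidiagonal.1 hy
  rw [hU y.1 (by omega)]
  congr 1
  refine Finset.sum_congr rfl fun x hx => ?_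
  have hx' := Finset.HasAntidiagonal.mem_antidiagonal.1 hx
  rw [hV x.1 (by omega)]

lemma contDiff_coeff_mul {U : E → ℂ⟦X⟧} (V : ℂ⟦X⟧)
    (hU : ∀ n, ContDiff ℝ m fun z => coeff n (U z)) (n : ℕ) :
    ContDiff ℝ m fun z => coeff n (V * U z) := by
  simp only [coeff_mul]
  exact ContDiff.sum fun x _ => contDiff_const.mul (hU _)

lemma coeff_mul_congr {U U' : ℂ⟦X⟧} (V : ℂ⟦X⟧) {n : ℕ} (hU : ∀ k ≤ n, coeff k U = coeff k U') :
    coeff n (V * U) = coeff n (V * U') := by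
  rw [coeff_mul, coeff_mul]
  refine Finset.sum_congr rfl fun x hx => ?_
  have hx' := Finset.HasAntidiagonal.mem_antidiagonal.1 hx
  rw [hU x.2 (by omega)]

end ContDiffMat

end MTRogue

/-! ### The tau functions as determinants of series coefficients -/

namespace MTRogue

open PowerSeries Matrix Filter Topology

/-- The part of the exponent which depends on `p` (or on `q`, for `-b` in place of `b`). -/
noncomputable def phaseFun (b r : ℂ) (κ μ : ℝ) (R : ℕ∞) (c : ℕ → ℂ) (x t : ℝ) (p : ℂ) : ℂ :=
  ((κ * x : ℝ) : ℂ) * p + ((μ * t : ℝ) : ℂ) * p⁻¹ + powerSum R c (Complex.log ((p - b) / r))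

/-- The series `∑ c_r X^r`, `1 ≤ r ≤ R`. -/
noncomputable def rootSeries (R : ℕ∞) (c : ℕ → ℂ) : ℂ⟦X⟧ :=
  PowerSeries.mk fun n => if n = 0 then 0 else cutCoeff R c n

/-- The series of `phaseFun`. -/
noncomputable def phaseSeries (β r κ μ : ℝ) (R : ℕ∞) (c : ℕ → ℂ) (x t : ℝ) : ℂ⟦X⟧ :=
  C ((κ * x : ℝ) : ℂ) * momentum β r + C ((μ * t : ℝ) : ℂ) * pole β r 0 + rootSeries R c

lemma conjSeries_rootSeries (R : ℕ∞) (c : ℕ → ℂ) :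
    conjSeries (rootSeries R c) = rootSeries R fun n => conj (c n) := by
  ext n
  rw [coeff_conjSeries, rootSeries, rootSeries, coeff_mk, coeff_mk, cutCoeff, cutCoeff]
  split_ifs <;> simp

section

variable {b z₀ r : ℂ} {R : ℕ∞} {c : ℕ → ℂ}

lemma analyticAt_phaseFun (hc : R = ⊤ → HasPosRadius c) (hr : r ≠ 0) (hz : z₀ - b = r)
    (h0 : z₀ ≠ 0) (κ μ x t : ℝ) : AnalyticAt ℂ (phaseFun b r κ μ R c x t) z₀ :=
  ((analyticAt_const.mul analyticAt_id).add (analyticAt_const.mul (analyticAt_id.inv h0))).add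
    (analyticAt_powerSum_log hc hr hz)

lemma logTaylor_phaseFun (hc : R = ⊤ → HasPosRadius c) (hr : r ≠ 0) (hz : z₀ - b = r)
    (h0 : z₀ ≠ 0) (κ μ x t : ℝ) :
    logTaylor b z₀ (phaseFun b r κ μ R c x t) =
      C ((κ * x : ℝ) : ℂ) * (C b + C r * PowerSeries.exp ℂ) +
        C ((μ * t : ℝ) : ℂ) * (C b + C r * PowerSeries.exp ℂ)⁻¹ + rootSeries R c := by
  have hinv : AnalyticAt ℂ (fun z : ℂ => z⁻¹) z₀ := analyticAt_id.inv h0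
  have h1 : logTaylor b z₀ (fun z => powerSum R c (Complex.log ((z - b) / r))) =
      rootSeries R c := by
    ext n
    rw [coeff_logTaylor_powerSum hc hr hz, rootSeries, coeff_mk]
  unfold phaseFun
  rw [logTaylor_add ((analyticAt_const.fun_mul (analyticAt_self _)).fun_add
      (analyticAt_const.fun_mul hinv)) (analyticAt_powerSum_log hc hr hz),
    logTaylor_add (analyticAt_const.fun_mul (analyticAt_self _)) (analyticAt_const.fun_mul hinv),
    logTaylor_mul analyticAt_const (analyticAt_self _), logTaylor_mul analyticAt_const hinv,
    logTaylor_inv (analyticAt_self _) h0, logTaylor_id, logTaylor_const, logTaylor_const, hz, h1]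

end

section

variable {β r : ℝ}

lemma base_add_I_mul_ne_zero (hr : 0 < r) (y : ℝ) : (r : ℂ) + Complex.I * y ≠ 0 := by
  intro h
  have := congrArg Complex.re h
  simp at this
  exact hr.ne' this

/-- The base point of the expansion in `p`. -/
noncomputable def basePoint (β r : ℝ) : ℂ := r + Complex.I * β

lemma conj_basePoint : conj (basePoint β r) = r - Complex.I * β := by
  simp [basePoint, sub_eq_add_neg]

lemma basePoint_sub : basePoint β r - Complex.I * β = r := by simp [basePoint]

lemma conj_basePoint_sub : conj (basePoint β r) - -(Complex.I * β) = r := by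
  simp [conj_basePoint]

lemma basePoint_sub_I_mul_ne_zero (hr : 0 < r) (y : ℝ) : basePoint β r - Complex.I * y ≠ 0 := by
  have := base_add_I_mul_ne_zero hr (β - y)
  convert this using 1
  rw [basePoint]; push_cast; ring

lemma conj_basePoint_add_I_mul_ne_zero (hr : 0 < r) (y : ℝ) :
    conj (basePoint β r) + Complex.I * y ≠ 0 := by
  have := base_add_I_mul_ne_zero hr (y - β)
  convert this using 1
  rw [conj_basePoint]; push_cast; ring

lemma basePoint_ne_zero (hr : 0 < r) : basePoint β r ≠ 0 := by
  simpa using basePoint_sub_I_mul_ne_zero (β := β) hr 0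

lemma conj_basePoint_ne_zero (hr : 0 < r) : conj (basePoint β r) ≠ 0 := by
  simpa using conj_basePoint_add_I_mul_ne_zero (β := β) hr 0

lemma basePoint_add_conj_ne_zero (hr : 0 < r) : basePoint β r + conj (basePoint β r) ≠ 0 := by
  rw [conj_basePoint, basePoint]
  have : (r : ℂ) ≠ 0 := by exact_mod_cast hr.ne'
  ring_nf
  simpa using this

lemma logTaylor_basePoint : logTaylor (Complex.I * β) (basePoint β r) (fun p => p) =
    momentum β r := by
  rw [logTaylor_id, basePoint_sub, momentum]

lemma conjSeries_momentum_eq :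
    conjSeries (momentum β r) = C (-(Complex.I * β)) + C (r : ℂ) * PowerSeries.exp ℂ := by
  rw [conjSeries_momentum, momentum, map_neg]; ring

lemma logTaylor_conj_basePoint :
    logTaylor (-(Complex.I * β)) (conj (basePoint β r)) (fun q => q) =
      conjSeries (momentum β r) := by
  rw [logTaylor_id, conj_basePoint_sub, conjSeries_momentum_eq]

variable {R : ℕ∞} {c : ℕ → ℂ}

/-- The series of the exponential of `phaseFun`. -/
noncomputable def waveSeries (β r κ μ : ℝ) (R : ℕ∞) (c : ℕ → ℂ) (x t : ℝ) : ℂ⟦X⟧ :=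
  logTaylor (Complex.I * β) (basePoint β r) fun p =>
    Complex.exp (phaseFun (Complex.I * β) r κ μ R c x t p)

lemma isExpSeries_waveSeries (hr : 0 < r) (hc : R = ⊤ → HasPosRadius c) (κ μ x t : ℝ) :
    IsExpSeries (phaseSeries β r κ μ R c x t) (waveSeries β r κ μ R c x t) := by
  have hr' : (r : ℂ) ≠ 0 := by exact_mod_cast hr.ne'
  have h1 := isExpSeries_logTaylor (b := Complex.I * β)
    (analyticAt_phaseFun hc hr' basePoint_sub (basePoint_ne_zero (β := β) hr) κ μ x t)
  rw [logTaylor_phaseFun hc hr' basePoint_sub (basePoint_ne_zero hr)] at h1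
  have h2 : pole β r 0 = (C (Complex.I * β) + C (r : ℂ) * PowerSeries.exp ℂ)⁻¹ := by
    rw [pole, momentum]; simp
  rw [phaseSeries, h2, momentum]
  exact h1

/-- The phases in p and in q have conjugate series, and a phase series determines its exponential.
-/
lemma conjSeries_waveSeries (hr : 0 < r) (hc : R = ⊤ → HasPosRadius c) (κ μ x t : ℝ) :
    logTaylor (-(Complex.I * β)) (conj (basePoint β r)) (fun q =>
      Complex.exp (phaseFun (-(Complex.I * β)) r κ μ R (fun n => conj (c n)) x t q)) =
        conjSeries (waveSeries β r κ μ R c x t) := by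
  have hr' : (r : ℂ) ≠ 0 := by exact_mod_cast hr.ne'
  have hc' : R = ⊤ → HasPosRadius fun n => conj (c n) := fun h => (hc h).conj
  have h1 := isExpSeries_logTaylor (b := -(Complex.I * β))
    (analyticAt_phaseFun hc' hr' conj_basePoint_sub (conj_basePoint_ne_zero (β := β) hr) κ μ x t)
  rw [logTaylor_phaseFun hc' hr' conj_basePoint_sub (conj_basePoint_ne_zero hr)] at h1
  refine IsExpSeries.unique h1 ?_
  have h2 := (isExpSeries_waveSeries (β := β) hr hc κ μ x t).conjSeries
  have h3 : conjSeries (pole β r 0) =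
      (C (-(Complex.I * β)) + C (r : ℂ) * PowerSeries.exp ℂ)⁻¹ := by
    have h0 := constantCoeff_momentum_sub_I_mul_ne_zero (β := β) hr 0
    simp only [Complex.ofReal_zero, mul_zero] at h0
    rw [pole, conjSeries_inv h0, map_sub conjSeries, conjSeries_momentum_eq, conjSeries_C]
    simp
  rw [phaseSeries, map_add conjSeries, map_add conjSeries, map_mul conjSeries, map_mul conjSeries,
    conjSeries_rootSeries, h3, conjSeries_momentum_eq, conjSeries_C, conjSeries_C,
    Complex.conj_ofReal, Complex.conj_ofReal] at h2
  exact h2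

/-- The rational factor in `p`. -/
noncomputable def ratP (b : ℂ) (n k l : ℤ) (p : ℂ) : ℂ :=
  Complex.I * (p * p ^ n * (p - Complex.I) ^ k * (p - b) ^ l)

/-- The rational factor in `q`. -/
noncomputable def ratQ (b : ℂ) (n k l : ℤ) (q : ℂ) : ℂ :=
  (-1) ^ n * (-1) ^ k * (-1) ^ l * ((q ^ n)⁻¹ * ((q + Complex.I) ^ k)⁻¹ * ((q + b) ^ l)⁻¹)

lemma analyticAt_ratP (hr : 0 < r) (n k l : ℤ) :
    AnalyticAt ℂ (ratP (Complex.I * β) n k l) (basePoint β r) := by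
  have h1 := basePoint_ne_zero (β := β) hr
  have h2 : basePoint β r - Complex.I ≠ 0 := by
    simpa using basePoint_sub_I_mul_ne_zero (β := β) hr 1
  have h3 := basePoint_sub_I_mul_ne_zero (β := β) hr β
  exact analyticAt_const.mul (((analyticAt_id.mul (analyticAt_id.zpow h1)).mul
    ((analyticAt_id.sub analyticAt_const).zpow h2)).mul
    ((analyticAt_id.sub analyticAt_const).zpow h3))

lemma analyticAt_ratQ (hr : 0 < r) (n k l : ℤ) :
    AnalyticAt ℂ (ratQ (Complex.I * β) n k l) (conj (basePoint β r)) := by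
  have h1 := conj_basePoint_ne_zero (β := β) hr
  have h2 : conj (basePoint β r) + Complex.I ≠ 0 := by
    simpa using conj_basePoint_add_I_mul_ne_zero (β := β) hr 1
  have h3 := conj_basePoint_add_I_mul_ne_zero (β := β) hr β
  exact analyticAt_const.mul ((((analyticAt_id.zpow h1).inv (zpow_ne_zero _ h1)).mul
    (((analyticAt_id.add analyticAt_const).zpow h2).inv (zpow_ne_zero _ h2))).mul
    (((analyticAt_id.add analyticAt_const).zpow h3).inv (zpow_ne_zero _ h3)))

/-- The double series of `1 / (p + q)` at the base point. -/
noncomputable def baseKernel (β r : ℝ) : ℂ⟦X⟧⟦X⟧ :=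
  cauchyKernel (Complex.I * β) (basePoint β r) (conj (basePoint β r))

lemma add_mul_baseKernel (hr : 0 < r) :
    (C (momentum β r) + PowerSeries.map C (conjSeries (momentum β r))) * baseKernel β r = 1 := by
  rw [← logTaylor_conj_basePoint, ← logTaylor_basePoint]
  exact add_mul_cauchyKernel (basePoint_add_conj_ne_zero hr)

/-- The sum p + q is invariant under conjugation with exchange of variables, hence so is its unique
inverse. -/
lemma conjSwap_baseKernel (hr : 0 < r) : conjSwap (baseKernel β r) = baseKernel β r := by
  have h1 := add_mul_baseKernel (β := β) hr
  have h2 := congrArg conjSwap h1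
  have h3 : conjSwap (1 : ℂ⟦X⟧⟦X⟧) = 1 := by
    rw [← map_one (C (R := ℂ⟦X⟧)), conjSwap_C, map_one, map_one, map_one]
  rw [conjSwap_mul, conjSwap_add, conjSwap_C, conjSwap_map, conjSeries_conjSeries, h3] at h2
  linear_combination baseKernel β r * h2 - conjSwap (baseKernel β r) * h1

/-- The double series of `E(p) E*(q) / (p + q)`. -/
noncomputable def weightedKernel (β r κ μ : ℝ) (R : ℕ∞) (c : ℕ → ℂ) (x t : ℝ) : ℂ⟦X⟧⟦X⟧ :=
  baseKernel β r * (C (waveSeries β r κ μ R c x t) *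
    PowerSeries.map C (conjSeries (waveSeries β r κ μ R c x t)))

lemma isWeightedKernel (hr : 0 < r) (hc : R = ⊤ → HasPosRadius c) (κ μ x t : ℝ) :
    IsWeightedKernel β r (waveSeries β r κ μ R c x t) (weightedKernel β r κ μ R c x t) := by
  refine ⟨?_, ?_, (isExpSeries_waveSeries hr hc κ μ x t).constantCoeff_ne_zero⟩
  · rw [weightedKernel, ← mul_assoc, add_mul_baseKernel hr, one_mul]
  · rw [weightedKernel, conjSwap_mul, conjSwap_mul, conjSwap_baseKernel hr, conjSwap_C,
      conjSwap_map, conjSeries_conjSeries, mul_comm (C _)]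

/-- The determinants `τ_{n,k,l}` through the double series. -/
lemma oddDet_eq (hr : 0 < r) (hc : R = ⊤ → HasPosRadius c) (κ μ x t : ℝ) (N : ℕ) (n k l : ℤ) :
    oddDet N (Complex.I * β) (basePoint β r) (fun p q =>
      (ratP (Complex.I * β) n k l p * Complex.exp (phaseFun (Complex.I * β) r κ μ R c x t p)) *
      (ratQ (Complex.I * β) n k l q * Complex.exp (phaseFun (-(Complex.I * β)) r κ μ R
        (fun m => conj (c m)) x t q)) / (p + q)) =
    (oddMat N (C (logTaylor (Complex.I * β) (basePoint β r) (ratP (Complex.I * β) n k l) *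
        waveSeries β r κ μ R c x t) *
      (PowerSeries.map C (logTaylor (-(Complex.I * β)) (conj (basePoint β r))
        (ratQ (Complex.I * β) n k l) * conjSeries (waveSeries β r κ μ R c x t)) *
        baseKernel β r))).det := by
  have hr' : (r : ℂ) ≠ 0 := by exact_mod_cast hr.ne'
  have hc' : R = ⊤ → HasPosRadius fun n => conj (c n) := fun h => (hc h).conj
  have hP := analyticAt_phaseFun hc hr' basePoint_sub (basePoint_ne_zero (β := β) hr) κ μ x t
  have hQ := analyticAt_phaseFun hc' hr' conj_basePoint_sub (conj_basePoint_ne_zero (β := β) hr)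
    κ μ x t
  rw [oddDet]
  congr 1
  ext i j
  rw [of_apply, matElem_eq_coeff, logTaylor₂_cauchy (basePoint_add_conj_ne_zero hr)
    ((analyticAt_ratP hr n k l).fun_mul hP.cexp') ((analyticAt_ratQ hr n k l).fun_mul hQ.cexp'),
    logTaylor_mul (analyticAt_ratP hr n k l) hP.cexp',
    logTaylor_mul (analyticAt_ratQ hr n k l) hQ.cexp', conjSeries_waveSeries hr hc]
  rfl

end

end MTRogue

/-! ### The tau functions f, f*, g, h and their dependence on R, x, t -/

namespace MTRogue

open PowerSeries Matrix Filter Topology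

section Values

variable {β r : ℝ} {R : ℕ∞} {c : ℕ → ℂ}

lemma logTaylor_momentum_sub (y : ℂ) :
    logTaylor (Complex.I * β) (basePoint β r) (fun p => Complex.I * (p - y)) =
      C Complex.I * (momentum β r - C y) := by
  have h1 : ∀ z : ℂ, AnalyticAt ℂ (fun p : ℂ => p + -y) z := fun z =>
    (analyticAt_self z).fun_add analyticAt_const
  simp only [sub_eq_add_neg]
  rw [logTaylor_mul analyticAt_const (h1 _), logTaylor_const, logTaylor_add (analyticAt_self _)
    analyticAt_const, logTaylor_const, logTaylor_basePoint, map_neg]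

lemma logTaylor_conj_pole (hr : 0 < r) (y : ℝ) :
    logTaylor (-(Complex.I * β)) (conj (basePoint β r)) (fun q => q * (q + Complex.I * y)⁻¹) =
      conjSeries (momentum β r) * conjSeries (pole β r (Complex.I * y)) := by
  have h0 := conj_basePoint_add_I_mul_ne_zero (β := β) hr y
  have h1 : AnalyticAt ℂ (fun q : ℂ => q + Complex.I * y) (conj (basePoint β r)) :=
    (analyticAt_self _).fun_add analyticAt_const
  have h2 : AnalyticAt ℂ (fun q : ℂ => (q + Complex.I * y)⁻¹) (conj (basePoint β r)) :=
    h1.fun_inv h0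
  rw [logTaylor_mul (analyticAt_self _) h2, logTaylor_inv h1 h0,
    logTaylor_add (analyticAt_self _) analyticAt_const, logTaylor_const, logTaylor_conj_basePoint]
  congr 1
  have h3 := congrArg constantCoeff (conjSeries_pole (β := β) hr y)
  rw [map_mul] at h3
  symm
  rw [PowerSeries.eq_inv_iff_mul_eq_one (fun h => by rw [h, zero_mul] at h3; simp at h3), mul_comm,
    conjSeries_pole hr]

lemma eventually_basePoint_ne_zero (hr : 0 < r) : ∀ᶠ p in 𝓝 (basePoint β r), p ≠ 0 :=
  continuousAt_id.eventually_ne (basePoint_ne_zero hr)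

lemma oddMat_I_mul {N : ℕ} (U V e f : ℂ⟦X⟧) (K : ℂ⟦X⟧⟦X⟧) :
    oddMat N (C (C Complex.I * U * e) * (PowerSeries.map C (V * f) * K)) =
      Complex.I • oddMat N (C U * PowerSeries.map C V * (K * (C e * PowerSeries.map C f))) := by
  rw [← oddMat_C_mul]
  congr 1
  rw [map_mul C _ e, map_mul C _ U, map_mul (PowerSeries.map C)]
  ring

variable {N : ℕ}

/-- The matrix of `oddDet_eq`. -/
noncomputable def tauMat (N : ℕ) (β r κ μ : ℝ) (R : ℕ∞) (c : ℕ → ℂ) (n k l : ℤ) (x t : ℝ) :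
    Matrix (Fin N) (Fin N) ℂ :=
  oddMat N (C (logTaylor (Complex.I * β) (basePoint β r) (ratP (Complex.I * β) n k l) *
        waveSeries β r κ μ R c x t) *
      (PowerSeries.map C (logTaylor (-(Complex.I * β)) (conj (basePoint β r))
        (ratQ (Complex.I * β) n k l) * conjSeries (waveSeries β r κ μ R c x t)) *
        baseKernel β r))

lemma tauMat_zero (κ μ x t : ℝ) :
    tauMat N β r κ μ R c 0 0 0 x t = Complex.I • gramMat N β r (weightedKernel β r κ μ R c x t) := by
  have h1 : ratP (Complex.I * β) 0 0 0 = fun p => Complex.I * (p - 0) := by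
    funext p; simp [ratP]
  have h2 : ratQ (Complex.I * β) 0 0 0 = fun _ => 1 := by
    funext p; simp [ratQ]
  rw [tauMat, h1, h2, logTaylor_momentum_sub, logTaylor_const, oddMat_I_mul, weightedKernel,
    gramMat]
  simp

lemma tauMat_neg_one (hr : 0 < r) (κ μ x t : ℝ) :
    tauMat N β r κ μ R c (-1) 0 0 x t =
      Complex.I • gramMatConj N β r (weightedKernel β r κ μ R c x t) := by
  have h1 : logTaylor (Complex.I * β) (basePoint β r) (ratP (Complex.I * β) (-1) 0 0) =
      C Complex.I * 1 := by
    rw [mul_one, ← logTaylor_const (Complex.I * β) (basePoint β r)]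
    -- Cancelling p against p⁻¹ is valid only for p ≠ 0, that is, near the base point.
    apply logTaylor_congr
    filter_upwards [eventually_basePoint_ne_zero (β := β) hr] with p hp
    simp [ratP, hp]
  have h2 : ratQ (Complex.I * β) (-1) 0 0 = fun q => -1 * q := by
    funext p; simp [ratQ]
  rw [tauMat, h1, h2, logTaylor_mul analyticAt_const (analyticAt_self _), logTaylor_const,
    logTaylor_conj_basePoint, oddMat_I_mul, weightedKernel, gramMatConj]
  simp

lemma tauMat_shift_k (hr : 0 < r) (κ μ x t : ℝ) :
    tauMat N β r κ μ R c (-1) 1 0 x t =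
      Complex.I • shiftMat N β r 1 (weightedKernel β r κ μ R c x t) := by
  have h1 : logTaylor (Complex.I * β) (basePoint β r) (ratP (Complex.I * β) (-1) 1 0) =
      C Complex.I * (momentum β r - C (Complex.I * (1 : ℝ))) := by
    rw [← logTaylor_momentum_sub]
    apply logTaylor_congr
    filter_upwards [eventually_basePoint_ne_zero (β := β) hr] with p hp
    simp [ratP, hp]
  have h2 : ratQ (Complex.I * β) (-1) 1 0 = fun q => q * (q + Complex.I * (1 : ℝ))⁻¹ := by
    funext p; simp [ratQ]
  rw [tauMat, h1, h2, logTaylor_conj_pole hr, oddMat_I_mul, weightedKernel, shiftMat]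

lemma tauMat_shift_l (hr : 0 < r) (κ μ x t : ℝ) :
    tauMat N β r κ μ R c (-1) 0 1 x t =
      Complex.I • shiftMat N β r β (weightedKernel β r κ μ R c x t) := by
  have h1 : logTaylor (Complex.I * β) (basePoint β r) (ratP (Complex.I * β) (-1) 0 1) =
      C Complex.I * (momentum β r - C (Complex.I * β)) := by
    rw [← logTaylor_momentum_sub]
    apply logTaylor_congr
    filter_upwards [eventually_basePoint_ne_zero (β := β) hr] with p hp
    simp [ratP, hp]
  have h2 : ratQ (Complex.I * β) (-1) 0 1 = fun q => q * (q + Complex.I * β)⁻¹ := by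
    funext p; simp [ratQ]
  rw [tauMat, h1, h2, logTaylor_conj_pole hr, oddMat_I_mul, weightedKernel, shiftMat]

/-- The largest row or column index used is 2(N-1)+1 = 2N-1, so only orders below 2N matter. -/
lemma tauMat_congr (hr : 0 < r) (hc : R = ⊤ → HasPosRadius c) {R' : ℕ∞}
    (hc' : R' = ⊤ → HasPosRadius c) (h : ∀ n < 2 * N, cutCoeff R c n = cutCoeff R' c n)
    (κ μ : ℝ) (n k l : ℤ) (x t : ℝ) :
    tauMat N β r κ μ R c n k l x t = tauMat N β r κ μ R' c n k l x t := by
  have h1 : ∀ m < 2 * N, coeff m (waveSeries β r κ μ R c x t) =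
      coeff m (waveSeries β r κ μ R' c x t) := fun m hm => by
    refine (isExpSeries_waveSeries hr hc κ μ x t).coeff_congr
      (isExpSeries_waveSeries hr hc' κ μ x t) fun j hj => ?_
    simp only [phaseSeries, map_add, rootSeries, coeff_mk, h j (by omega)]
  refine oddMat_congr _ (fun m hm => coeff_mul_congr _ fun j hj => h1 j (by omega))
    fun m hm => coeff_mul_congr _ fun j hj => ?_
  rw [coeff_conjSeries, coeff_conjSeries, h1 j (by omega)]

lemma contDiff_tauMat (hr : 0 < r) (hc : R = ⊤ → HasPosRadius c) (κ μ : ℝ) (n k l : ℤ)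
    (m : WithTop ℕ∞) :
    ContDiff ℝ m fun z : ℝ × ℝ => (tauMat N β r κ μ R c n k l z.1 z.2).det := by
  have h1 : ∀ j, ContDiff ℝ m fun z : ℝ × ℝ => coeff j (waveSeries β r κ μ R c z.1 z.2) := by
    refine IsExpSeries.contDiff_coeff (S := fun z : ℝ × ℝ => phaseSeries β r κ μ R c z.1 z.2)
      (fun z => isExpSeries_waveSeries hr hc κ μ z.1 z.2) fun j => ?_
    simp only [phaseSeries, map_add, coeff_C_mul]
    have h2 : ContDiff ℝ m fun z : ℝ × ℝ => ((κ * z.1 : ℝ) : ℂ) :=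
      Complex.ofRealCLM.contDiff.comp (contDiff_const.mul contDiff_fst)
    have h3 : ContDiff ℝ m fun z : ℝ × ℝ => ((μ * z.2 : ℝ) : ℂ) :=
      Complex.ofRealCLM.contDiff.comp (contDiff_const.mul contDiff_snd)
    exact ((h2.mul contDiff_const).add (h3.mul contDiff_const)).add contDiff_const
  refine contDiff_det fun i j => contDiff_oddMat _ (contDiff_coeff_mul _ h1)
    (contDiff_coeff_mul _ fun j => ?_) i j
  simp only [coeff_conjSeries]
  exact Complex.conjCLE.contDiff.comp (h1 j)

lemma hasCoeffDerivAt_waveSeries_x (hr : 0 < r) (hc : R = ⊤ → HasPosRadius c) (κ μ x t : ℝ) :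
    HasCoeffDerivAt (fun x => waveSeries β r κ μ R c x t)
      (C (κ : ℂ) * (momentum β r * waveSeries β r κ μ R c x t)) x := by
  rw [← mul_assoc]
  refine IsExpSeries.hasCoeffDerivAt (fun x => isExpSeries_waveSeries hr hc κ μ x t) fun n => ?_
  simp only [phaseSeries, map_add, coeff_C_mul]
  have h1 : HasDerivAt (fun x : ℝ => ((κ * x : ℝ) : ℂ)) κ x := by
    simpa using ((hasDerivAt_id x).const_mul κ).ofReal_comp
  exact ((h1.mul_const _).add_const _).add_const _

lemma hasCoeffDerivAt_waveSeries_t (hr : 0 < r) (hc : R = ⊤ → HasPosRadius c) (κ μ x t : ℝ) :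
    HasCoeffDerivAt (fun t => waveSeries β r κ μ R c x t)
      (C (μ : ℂ) * (pole β r 0 * waveSeries β r κ μ R c x t)) t := by
  rw [← mul_assoc]
  refine IsExpSeries.hasCoeffDerivAt (fun t => isExpSeries_waveSeries hr hc κ μ x t) fun n => ?_
  simp only [phaseSeries, map_add, coeff_C_mul]
  have h1 : HasDerivAt (fun t : ℝ => ((μ * t : ℝ) : ℂ)) μ t := by
    simpa using ((hasDerivAt_id t).const_mul μ).ofReal_comp
  exact ((h1.mul_const _).const_add _).add_const _

end Values

/-! ### Removal of the parameter α by scaling -/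

section Scaling

/-- The operator (p-b)∂_p is homogeneous of degree zero when p and b are scaled together. -/
lemma opP_scale (α b : ℂ) (F : ℂ → ℂ → ℂ) :
    (fun p q => opP (α * b) F (α * p) (α * q)) = opP b fun p q => F (α * p) (α * q) := by
  funext p q
  simp only [opP]
  rw [deriv_comp_mul_left α (fun p' => F p' (α * q)) p, smul_eq_mul]
  ring

lemma opQ_scale (α b : ℂ) (F : ℂ → ℂ → ℂ) :
    (fun p q => opQ (α * b) F (α * p) (α * q)) = opQ b fun p q => F (α * p) (α * q) := by
  funext p q
  simp only [opQ]
  rw [deriv_comp_mul_left α (fun q' => F (α * p) q') q, smul_eq_mul]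
  ring

lemma matElem_scale (α : ℝ) (b p₀ : ℂ) (F : ℂ → ℂ → ℂ) (i j : ℕ) :
    matElem (α * b) (α * p₀) F i j = matElem b p₀ (fun p q => F (α * p) (α * q)) i j := by
  have hQ : ∀ (j : ℕ) (F : ℂ → ℂ → ℂ), (fun p q => (opQ (α * b))^[j] F (α * p) (α * q)) =
      (opQ b)^[j] fun p q => F (α * p) (α * q) := by
    intro j
    induction j with
    | zero => intro F; rfl
    | succ j ih =>
      intro F
      simp only [Function.iterate_succ_apply, ih, opQ_scale]
  have hP : ∀ (i : ℕ) (F : ℂ → ℂ → ℂ), (fun p q => (opP (α * b))^[i] F (α * p) (α * q)) =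
      (opP b)^[i] fun p q => F (α * p) (α * q) := by
    intro i
    induction i with
    | zero => intro F; rfl
    | succ i ih =>
      intro F
      simp only [Function.iterate_succ_apply, ih, opP_scale]
  rw [matElem, matElem, ← hQ, ← hP]
  simp

lemma sqrt_ofReal {x : ℝ} (hx : 0 ≤ x) : Complex.sqrt (x : ℂ) = (√x : ℝ) := by
  rw [Complex.sqrt, Real.sqrt_eq_rpow, Complex.ofReal_cpow hx]
  simp

variable {σ ρ₁ ρ₂ : ℝ}

lemma bHat_eq : bHat σ ρ₁ ρ₂ = Complex.I * ((1 + σ * ρ₁ * ρ₂ : ℝ) : ℂ) := by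
  rw [bHat]; push_cast; ring

lemma bPar_eq (α : ℝ) : bPar α σ ρ₁ ρ₂ = α * bHat σ ρ₁ ρ₂ := by
  rw [bPar, aPar, bHat]; ring

lemma bHat_mul_sub : bHat σ ρ₁ ρ₂ * (bHat σ ρ₁ ρ₂ - Complex.I) =
    (((1 + σ * ρ₁ * ρ₂) * (1 - (1 + σ * ρ₁ * ρ₂)) : ℝ) : ℂ) := by
  rw [bHat_eq]; push_cast
  linear_combination ((1 + σ * ρ₁ * ρ₂ : ℂ) * (σ * ρ₁ * ρ₂)) * Complex.I_sq

lemma rootHat_eq (h : 0 ≤ (1 + σ * ρ₁ * ρ₂) * (1 - (1 + σ * ρ₁ * ρ₂))) :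
    rootHat σ ρ₁ ρ₂ = (√((1 + σ * ρ₁ * ρ₂) * (1 - (1 + σ * ρ₁ * ρ₂))) : ℝ) := by
  rw [rootHat, bHat_mul_sub, sqrt_ofReal h]

lemma rootPar_eq (h : 0 ≤ (1 + σ * ρ₁ * ρ₂) * (1 - (1 + σ * ρ₁ * ρ₂))) {α : ℝ} (hα : 0 < α) :
    rootPar α σ ρ₁ ρ₂ = α * rootHat σ ρ₁ ρ₂ := by
  have h1 : bPar α σ ρ₁ ρ₂ * (bPar α σ ρ₁ ρ₂ - aPar α) =
      ((α ^ 2 * ((1 + σ * ρ₁ * ρ₂) * (1 - (1 + σ * ρ₁ * ρ₂))) : ℝ) : ℂ) := by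
    rw [Complex.ofReal_mul, ← bHat_mul_sub, bPar_eq, aPar]; push_cast; ring
  rw [rootPar, h1, sqrt_ofReal (by positivity), rootHat_eq h, Real.sqrt_mul (by positivity),
    Real.sqrt_sq hα.le, Complex.ofReal_mul]

lemma pPar_eq (h : 0 ≤ (1 + σ * ρ₁ * ρ₂) * (1 - (1 + σ * ρ₁ * ρ₂))) {α : ℝ} (hα : 0 < α) :
    pPar α σ ρ₁ ρ₂ = α * pHat σ ρ₁ ρ₂ := by
  rw [pPar, rootPar_eq h hα, bPar_eq, pHat, mul_add]

lemma OmegaPar_eq (h : 0 ≤ (1 + σ * ρ₁ * ρ₂) * (1 - (1 + σ * ρ₁ * ρ₂))) {α : ℝ} (hα : 0 < α) :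
    OmegaPar α σ ρ₁ ρ₂ = OmegaHat σ ρ₁ ρ₂ := by
  have hα' : (α : ℂ) ^ 2 ≠ 0 := by
    have : (α : ℂ) ≠ 0 := by exact_mod_cast hα.ne'
    positivity
  rw [OmegaPar, OmegaHat, pPar_eq h hα, map_mul, Complex.conj_ofReal,
    ← mul_div_mul_left (-(pHat σ ρ₁ ρ₂ * (pHat σ ρ₁ ρ₂ - Complex.I))) _ hα']
  congr 1 <;> ring

/-- Every factor is homogeneous of degree zero in (p, q, a, b): the x-term through (p+q)/a, the
t-term through b/p + b/q, the logarithms through quotients. For α > 0 the chosen square root scales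
by α. -/
lemma mPar_scale (h : 0 ≤ (1 + σ * ρ₁ * ρ₂) * (1 - (1 + σ * ρ₁ * ρ₂))) {α : ℝ} (hα : 0 < α)
    (R : ℕ∞) (c : ℕ → ℂ) (n k l : ℤ) (x t : ℝ) (p q : ℂ) :
    mPar α σ ρ₁ ρ₂ R c n k l x t (α * p) (α * q) = mHat σ ρ₁ ρ₂ R c n k l x t p q := by
  have hα' : (α : ℂ) ≠ 0 := by exact_mod_cast hα.ne'
  have h1 : ∀ u v : ℂ, (α : ℂ) * u / (α * v) = u / v := fun u v => mul_div_mul_left _ _ hα'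
  have hT : ThetaPar α σ ρ₁ ρ₂ R c x t (α * p) (α * q) = ThetaHat σ ρ₁ ρ₂ R c x t p q := by
    have e1 : Complex.I * ρ₂ / (aPar α * ρ₁) * (α * p + α * q) * x =
        (ρ₂ : ℂ) / ρ₁ * (p + q) * x := by
      have : Complex.I * ρ₂ / (aPar α * ρ₁) * α = (ρ₂ : ℂ) / ρ₁ := by
        rw [aPar, div_mul_eq_mul_div, mul_right_comm,
          mul_div_mul_left _ _ (mul_ne_zero Complex.I_ne_zero hα')]
      rw [← this]; ring
    have e2 : Complex.I * ρ₁ * (α * bHat σ ρ₁ ρ₂) / ρ₂ * (1 / (α * p) + 1 / (α * q)) * t =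
        Complex.I * ρ₁ * bHat σ ρ₁ ρ₂ / ρ₂ * (1 / p + 1 / q) * t := by
      have e3 : ∀ u : ℂ, (α : ℂ) * (1 / (α * u)) = 1 / u := fun u => by
        rw [mul_one_div, div_mul_cancel_left₀ hα', one_div]
      rw [← e3 p, ← e3 q]; ring
    rw [ThetaPar, ThetaHat, rootPar_eq h hα, bPar_eq, e1, e2, ← mul_sub, ← mul_add, h1, h1]
  have e4 : Complex.I * (α * p) / (α * p + α * q) = Complex.I * p / (p + q) := by
    rw [← mul_add, mul_left_comm, h1]
  have e5 : (α * p - aPar α) / (α * q + aPar α) = (p - Complex.I) / (q + Complex.I) := by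
    rw [aPar, mul_comm Complex.I, ← mul_sub, ← mul_add, h1]
  have e6 : (α * p - bPar α σ ρ₁ ρ₂) / (α * q + bPar α σ ρ₁ ρ₂) =
      (p - bHat σ ρ₁ ρ₂) / (q + bHat σ ρ₁ ρ₂) := by
    rw [bPar_eq, ← mul_sub, ← mul_add, h1]
  rw [mPar, mHat, hT, e4, e5, e6, h1]

lemma tauPar_eq (h : 0 ≤ (1 + σ * ρ₁ * ρ₂) * (1 - (1 + σ * ρ₁ * ρ₂))) {α : ℝ} (hα : 0 < α)
    (N : ℕ) (R : ℕ∞) (c : ℕ → ℂ) :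
    tauPar α σ ρ₁ ρ₂ N R c = tauHat σ ρ₁ ρ₂ N R c := by
  funext n k l x t
  rw [tauPar, tauHat, oddDet, oddDet]
  congr 1
  ext i j
  rw [of_apply, of_apply, pPar_eq h hα, bPar_eq, matElem_scale]
  simp only [mPar_scale h hα]

end Scaling

end MTRogue

/-! ### Conjugation of the quotients and the modulus of Ω₀ -/

namespace MTRogue

open PowerSeries Matrix

section Ratios

variable {N : ℕ} {β r : ℝ} {e : ℂ⟦X⟧} {W : ℂ⟦X⟧⟦X⟧}

lemma det_I_smul (M : Matrix (Fin N) (Fin N) ℂ) : (Complex.I • M).det = Complex.I ^ N * M.det := by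
  rw [det_smul, Fintype.card_fin]

lemma conj_I_pow_mul_gram (h : IsWeightedKernel β r e W) :
    conj (Complex.I ^ N * (gramMat N β r W).det) = Complex.I ^ N * (gramMatConj N β r W).det := by
  rw [← det_I_smul, ← det_I_smul, gramMat, conj_det_I_smul_oddMat, h.neg_conjSwap_gram, gramMatConj]

lemma conj_I_pow_mul_shift (h : IsWeightedKernel β r e W) (y : ℝ) :
    conj (Complex.I ^ N * (shiftMat N β r y W).det) =
      Complex.I ^ N * (shiftMatConj N β r y W).det := by
  rw [← det_I_smul, ← det_I_smul, shiftMat, conj_det_I_smul_oddMat, h.neg_conjSwap_shift,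
    shiftMatConj]

lemma det_gramMatConj_ne_zero (h : IsWeightedKernel β r e W) (hr : 0 < r) (hβ0 : β ≠ 0) :
    (gramMatConj N β r W).det ≠ 0 := by
  intro h0
  have h1 := conj_I_pow_mul_gram (N := N) h
  rw [h0, mul_zero, _root_.map_eq_zero] at h1
  exact mul_ne_zero (pow_ne_zero _ Complex.I_ne_zero) (h.det_gramMat_ne_zero hr hβ0) h1

lemma I_pow_mul_div (x y : ℂ) : Complex.I ^ N * x / (Complex.I ^ N * y) = x / y :=
  mul_div_mul_left _ _ (pow_ne_zero _ Complex.I_ne_zero)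

/-- The factors i^N cancel in quotients. This and the next lemma turn |v|² and |u|² into the
products that occur in the derivative formulas. -/
lemma conj_shift_div_gram (h : IsWeightedKernel β r e W) (y : ℝ) :
    conj ((shiftMat N β r y W).det / (gramMat N β r W).det) =
      (shiftMatConj N β r y W).det / (gramMatConj N β r W).det := by
  rw [← I_pow_mul_div (N := N), map_div₀, conj_I_pow_mul_gram h, conj_I_pow_mul_shift h,
    I_pow_mul_div]

lemma conj_shift_div_gramMatConj (h : IsWeightedKernel β r e W) (y : ℝ) :
    conj ((shiftMat N β r y W).det / (gramMatConj N β r W).det) =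
      (shiftMatConj N β r y W).det / (gramMat N β r W).det := by
  rw [← I_pow_mul_div (N := N), map_div₀, conj_I_pow_mul_shift h, ← conj_I_pow_mul_gram h,
    Complex.conj_conj, I_pow_mul_div]

lemma constantCoeff_evenRatio_ne_zero (hr : 0 < r) : constantCoeff (evenRatio β r) ≠ 0 := fun h => by
  have := congrArg constantCoeff (evenRatio_mul_evenPole (β := β) hr)
  rw [map_mul, h] at this
  simp at this

/-- The two Toeplitz factors have reciprocal series up to conjugation, so the factor is -z/z̄ and
has modulus one; hence Ω₀^(-N) does not affect |u|. -/
lemma shiftFactor_eq (hr : 0 < r) : shiftFactor β r =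
    -(constantCoeff (evenRatio β r) / conj (constantCoeff (evenRatio β r))) := by
  have h1 := congrArg constantCoeff (evenRatio_mul_evenPole (β := β) hr)
  rw [map_mul, map_one] at h1
  rw [shiftFactor, ← coeff_zero_eq_constantCoeff_apply (conjSeries _), coeff_conjSeries,
    coeff_zero_eq_constantCoeff_apply, eq_inv_of_mul_eq_one_right h1, map_inv₀,
    div_eq_mul_inv]

lemma shiftFactor_ne_zero (hr : 0 < r) : shiftFactor β r ≠ 0 := by
  have h := constantCoeff_evenRatio_ne_zero (β := β) hr
  rw [shiftFactor_eq hr]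
  exact neg_ne_zero.mpr (div_ne_zero h ((map_ne_zero _).mpr h))

lemma norm_shiftFactor (hr : 0 < r) : ‖shiftFactor β r‖ = 1 := by
  have h := constantCoeff_evenRatio_ne_zero (β := β) hr
  rw [shiftFactor_eq hr, norm_neg, norm_div, Complex.norm_conj, div_self (norm_ne_zero_iff.mpr h)]

lemma constantCoeff_evenRatio (hr : 0 < r) : constantCoeff (evenRatio β r) =
    basePoint β r * (basePoint β r - Complex.I) / r := by
  have hr' : (r : ℂ) ≠ 0 := by exact_mod_cast hr.ne'
  have h0 : constantCoeff (momentum β r) = basePoint β r := by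
    simp [momentum, basePoint, add_comm]
  rw [evenRatio, map_mul, map_mul, map_sub, h0, constantCoeff_C, pole, constantCoeff_inv, map_sub,
    h0, constantCoeff_C, basePoint_sub, div_eq_mul_inv]

end Ratios

/-! ### Identification with the functions of the statement -/

section Identification

variable {σ ρ₁ ρ₂ β r : ℝ}

lemma rootHat_eq_ofReal (hβ : β = 1 + σ * ρ₁ * ρ₂) (hr : 0 < r) (hr2 : r ^ 2 = β * (1 - β)) :
    rootHat σ ρ₁ ρ₂ = r := by
  have h : (1 + σ * ρ₁ * ρ₂) * (1 - (1 + σ * ρ₁ * ρ₂)) = r ^ 2 := by rw [hr2, hβ]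
  rw [rootHat_eq (by rw [h]; positivity), h, Real.sqrt_sq hr.le]

lemma bHat_eq_I_mul (hβ : β = 1 + σ * ρ₁ * ρ₂) : bHat σ ρ₁ ρ₂ = Complex.I * β := by
  rw [bHat_eq, hβ]

lemma pHat_eq (hβ : β = 1 + σ * ρ₁ * ρ₂) (hr : 0 < r) (hr2 : r ^ 2 = β * (1 - β)) :
    pHat σ ρ₁ ρ₂ = basePoint β r := by
  rw [pHat, rootHat_eq_ofReal hβ hr hr2, bHat_eq_I_mul hβ, basePoint]

lemma OmegaHat_eq (hβ : β = 1 + σ * ρ₁ * ρ₂) (hr : 0 < r) (hr2 : r ^ 2 = β * (1 - β)) :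
    OmegaHat σ ρ₁ ρ₂ = shiftFactor β r := by
  have hr' : (r : ℂ) ≠ 0 := by exact_mod_cast hr.ne'
  rw [OmegaHat, pHat_eq hβ hr hr2, shiftFactor_eq hr, constantCoeff_evenRatio hr, map_div₀,
    map_mul, map_sub, Complex.conj_I, Complex.conj_ofReal, div_div_div_cancel_right₀ hr', neg_div,
    sub_neg_eq_add]

lemma ThetaHat_eq (hβ : β = 1 + σ * ρ₁ * ρ₂) (hr : 0 < r) (hr2 : r ^ 2 = β * (1 - β))
    (R : ℕ∞) (c : ℕ → ℂ) (x t : ℝ) (p q : ℂ) :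
    ThetaHat σ ρ₁ ρ₂ R c x t p q =
      phaseFun (Complex.I * β) r (ρ₂ / ρ₁) (-(ρ₁ / ρ₂) * β) R c x t p +
      phaseFun (-(Complex.I * β)) r (ρ₂ / ρ₁) (-(ρ₁ / ρ₂) * β) R (fun m => conj (c m)) x t q := by
  rw [ThetaHat, rootHat_eq_ofReal hβ hr hr2, bHat_eq_I_mul hβ, phaseFun, phaseFun, sub_neg_eq_add]
  push_cast
  -- Here ib = -β, so the coefficient of 1/p in the t-flow is the real number -(ρ₁/ρ₂)β.
  linear_combination (ρ₁ * β / ρ₂ * (1 / p + 1 / q) * t : ℂ) * Complex.I_sq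

lemma mHat_eq (hβ : β = 1 + σ * ρ₁ * ρ₂) (hr : 0 < r) (hr2 : r ^ 2 = β * (1 - β))
    (R : ℕ∞) (c : ℕ → ℂ) (n k l : ℤ) (x t : ℝ) (p q : ℂ) :
    mHat σ ρ₁ ρ₂ R c n k l x t p q =
      (ratP (Complex.I * β) n k l p *
        Complex.exp (phaseFun (Complex.I * β) r (ρ₂ / ρ₁) (-(ρ₁ / ρ₂) * β) R c x t p)) *
      (ratQ (Complex.I * β) n k l q * Complex.exp (phaseFun (-(Complex.I * β)) r (ρ₂ / ρ₁)
        (-(ρ₁ / ρ₂) * β) R (fun m => conj (c m)) x t q)) / (p + q) := by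
  have h1 : ∀ (u v : ℂ) (n : ℤ), (-(u / v)) ^ n = (-1) ^ n * (u ^ n * (v ^ n)⁻¹) := fun u v n => by
    rw [neg_eq_neg_one_mul, mul_zpow, div_zpow, div_eq_mul_inv]
  rw [mHat, ThetaHat_eq hβ hr hr2, Complex.exp_add, h1, h1, h1, bHat_eq_I_mul hβ, ratP, ratQ]
  ring

lemma tauHat_eq (hβ : β = 1 + σ * ρ₁ * ρ₂) (hr : 0 < r) (hr2 : r ^ 2 = β * (1 - β)) (N : ℕ)
    {R : ℕ∞} {c : ℕ → ℂ} (hc : R = ⊤ → HasPosRadius c) (n k l : ℤ) (x t : ℝ) :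
    tauHat σ ρ₁ ρ₂ N R c n k l x t =
      (tauMat N β r (ρ₂ / ρ₁) (-(ρ₁ / ρ₂) * β) R c n k l x t).det := by
  rw [tauMat, ← oddDet_eq hr hc, tauHat, pHat_eq hβ hr hr2, bHat_eq_I_mul hβ]
  congr 1
  funext p q
  exact mHat_eq hβ hr hr2 R c n k l x t p q

end Identification

/-! ### The plane wave and the Thirring equations -/

section PlaneWave

variable {σ ρ₁ ρ₂ β : ℝ}

lemma planeWave_eq (hβ : β = 1 + σ * ρ₁ * ρ₂) (x t : ℝ) : planeWave σ ρ₁ ρ₂ x t =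
    Complex.exp (((β * (ρ₂ / ρ₁ * x + ρ₁ / ρ₂ * t) : ℝ) : ℂ) * Complex.I) := by
  rw [planeWave, hβ]
  push_cast
  congr 1
  ring

lemma norm_planeWave (x t : ℝ) : ‖planeWave σ ρ₁ ρ₂ x t‖ = 1 := by
  rw [planeWave_eq rfl, Complex.norm_exp_ofReal_mul_I]

lemma contDiff_planeWave (m : WithTop ℕ∞) :
    ContDiff ℝ m fun z : ℝ × ℝ => planeWave σ ρ₁ ρ₂ z.1 z.2 := by
  simp only [planeWave_eq rfl]
  refine ContDiff.cexp (ContDiff.mul (Complex.ofRealCLM.contDiff.comp ?_) contDiff_const)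
  exact contDiff_const.mul ((contDiff_const.mul contDiff_fst).add
    (contDiff_const.mul contDiff_snd))

lemma hasDerivAt_planeWave_x (hβ : β = 1 + σ * ρ₁ * ρ₂) (x t : ℝ) :
    HasDerivAt (fun x => planeWave σ ρ₁ ρ₂ x t)
      (planeWave σ ρ₁ ρ₂ x t * (((β * (ρ₂ / ρ₁) : ℝ) : ℂ) * Complex.I)) x := by
  simp only [planeWave_eq hβ]
  refine HasDerivAt.cexp (HasDerivAt.mul_const (HasDerivAt.ofReal_comp ?_) _)
  simpa using (((hasDerivAt_id x).const_mul (ρ₂ / ρ₁)).add_const (ρ₁ / ρ₂ * t)).const_mul β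

lemma hasDerivAt_planeWave_t (hβ : β = 1 + σ * ρ₁ * ρ₂) (x t : ℝ) :
    HasDerivAt (fun t => planeWave σ ρ₁ ρ₂ x t)
      (planeWave σ ρ₁ ρ₂ x t * (((β * (ρ₁ / ρ₂) : ℝ) : ℂ) * Complex.I)) t := by
  simp only [planeWave_eq hβ]
  refine HasDerivAt.cexp (HasDerivAt.mul_const (HasDerivAt.ofReal_comp ?_) _)
  simpa using (((hasDerivAt_id t).const_mul (ρ₁ / ρ₂)).const_add (ρ₂ / ρ₁ * x)).const_mul β

end PlaneWave

section Solution

variable {σ ρ₁ ρ₂ β r : ℝ} {N : ℕ} {R : ℕ∞} {c : ℕ → ℂ}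

lemma waveU_eq (hβ : β = 1 + σ * ρ₁ * ρ₂) (hr : 0 < r) (hr2 : r ^ 2 = β * (1 - β))
    (hc : R = ⊤ → HasPosRadius c) (x t : ℝ) :
    waveU σ ρ₁ ρ₂ N (OmegaHat σ ρ₁ ρ₂) (tauHat σ ρ₁ ρ₂ N R c) x t =
      ρ₁ * (shiftFactor β r ^ N)⁻¹ * ((shiftMat N β r 1 (weightedKernel β r (ρ₂ / ρ₁)
        (-(ρ₁ / ρ₂) * β) R c x t)).det / (gramMatConj N β r (weightedKernel β r (ρ₂ / ρ₁)
        (-(ρ₁ / ρ₂) * β) R c x t)).det) * planeWave σ ρ₁ ρ₂ x t := by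
  rw [waveU, OmegaHat_eq hβ hr hr2, tauHat_eq hβ hr hr2 N hc, tauHat_eq hβ hr hr2 N hc,
    tauMat_zero, tauMat_shift_k hr, det_I_smul, det_I_smul,
    conj_I_pow_mul_gram (isWeightedKernel hr hc _ _ x t), mul_div_assoc, I_pow_mul_div,
    _root_.zpow_neg, zpow_natCast]
  ring

lemma waveV_eq (hβ : β = 1 + σ * ρ₁ * ρ₂) (hr : 0 < r) (hr2 : r ^ 2 = β * (1 - β))
    (hc : R = ⊤ → HasPosRadius c) (x t : ℝ) :
    waveV σ ρ₁ ρ₂ (tauHat σ ρ₁ ρ₂ N R c) x t =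
      ρ₂ * ((shiftMat N β r β (weightedKernel β r (ρ₂ / ρ₁)
        (-(ρ₁ / ρ₂) * β) R c x t)).det / (gramMat N β r (weightedKernel β r (ρ₂ / ρ₁)
        (-(ρ₁ / ρ₂) * β) R c x t)).det) * planeWave σ ρ₁ ρ₂ x t := by
  rw [waveV, tauHat_eq hβ hr hr2 N hc, tauHat_eq hβ hr hr2 N hc,
    tauMat_zero, tauMat_shift_l hr, det_I_smul, det_I_smul, I_pow_mul_div]

lemma tauHat_ne_zero (hβ : β = 1 + σ * ρ₁ * ρ₂) (hr : 0 < r) (hr2 : r ^ 2 = β * (1 - β))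
    (hβ0 : β ≠ 0) (hc : R = ⊤ → HasPosRadius c) (x t : ℝ) :
    tauHat σ ρ₁ ρ₂ N R c 0 0 0 x t ≠ 0 := by
  rw [tauHat_eq hβ hr hr2 N hc, tauMat_zero, det_I_smul]
  exact mul_ne_zero (pow_ne_zero _ Complex.I_ne_zero)
    ((isWeightedKernel hr hc _ _ x t).det_gramMat_ne_zero hr hβ0)

lemma conj_tauHat (hβ : β = 1 + σ * ρ₁ * ρ₂) (hr : 0 < r) (hr2 : r ^ 2 = β * (1 - β))
    (hc : R = ⊤ → HasPosRadius c) (x t : ℝ) :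
    conj (tauHat σ ρ₁ ρ₂ N R c 0 0 0 x t) = tauHat σ ρ₁ ρ₂ N R c (-1) 0 0 x t := by
  rw [tauHat_eq hβ hr hr2 N hc, tauHat_eq hβ hr hr2 N hc, tauMat_zero, tauMat_neg_one hr,
    det_I_smul, det_I_smul, conj_I_pow_mul_gram (isWeightedKernel hr hc _ _ x t)]

lemma contDiff_tauHat (hβ : β = 1 + σ * ρ₁ * ρ₂) (hr : 0 < r) (hr2 : r ^ 2 = β * (1 - β))
    (hc : R = ⊤ → HasPosRadius c) (n k l : ℤ) (m : WithTop ℕ∞) :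
    ContDiff ℝ m fun z : ℝ × ℝ => tauHat σ ρ₁ ρ₂ N R c n k l z.1 z.2 := by
  simp only [tauHat_eq hβ hr hr2 N hc]
  exact contDiff_tauMat hr hc _ _ n k l m

lemma tauHat_congr (hβ : β = 1 + σ * ρ₁ * ρ₂) (hr : 0 < r) (hr2 : r ^ 2 = β * (1 - β))
    (hc : R = ⊤ → HasPosRadius c) (hR : ((2 * N - 1 : ℕ) : ℕ∞) ≤ R) :
    tauHat σ ρ₁ ρ₂ N R c = tauHat σ ρ₁ ρ₂ N ((2 * N - 1 : ℕ) : ℕ∞) c := by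
  have hc' : ((2 * N - 1 : ℕ) : ℕ∞) = ⊤ → HasPosRadius c := fun h =>
    absurd h (ENat.natCast_ne_top _)
  funext n k l x t
  rw [tauHat_eq hβ hr hr2 N hc, tauHat_eq hβ hr hr2 N hc', tauMat_congr hr hc hc' fun m hm => ?_]
  have h1 : (m : ℕ∞) ≤ ((2 * N - 1 : ℕ) : ℕ∞) := by exact_mod_cast (by omega : m ≤ 2 * N - 1)
  rw [cutCoeff, cutCoeff, if_pos h1, if_pos (h1.trans hR)]

lemma isMTSolution (hβ : β = 1 + σ * ρ₁ * ρ₂) (hr : 0 < r) (hr2 : r ^ 2 = β * (1 - β))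
    (hβ0 : β ≠ 0) (hρ₁ : ρ₁ ≠ 0) (hρ₂ : ρ₂ ≠ 0) (hc : R = ⊤ → HasPosRadius c) :
    IsMTSolution σ (waveU σ ρ₁ ρ₂ N (OmegaHat σ ρ₁ ρ₂) (tauHat σ ρ₁ ρ₂ N R c))
      (waveV σ ρ₁ ρ₂ (tauHat σ ρ₁ ρ₂ N R c)) := by
  have hne : ∀ x t : ℝ, tauHat σ ρ₁ ρ₂ N R c 0 0 0 x t ≠ 0 := tauHat_ne_zero hβ hr hr2 hβ0 hc
  have hρ₁' : (ρ₁ : ℂ) ≠ 0 := by exact_mod_cast hρ₁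
  have hρ₂' : (ρ₂ : ℂ) ≠ 0 := by exact_mod_cast hρ₂
  have hβ' : (β : ℂ) = 1 + σ * ρ₁ * ρ₂ := by rw [hβ]; push_cast; ring
  have hS : shiftFactor β r ^ N ≠ 0 := pow_ne_zero _ (shiftFactor_ne_zero hr)
  have hk := fun x t => isWeightedKernel (β := β) hr hc (ρ₂ / ρ₁) (-(ρ₁ / ρ₂) * β) x t
  have hV : ∀ x t : ℝ, ((‖waveV σ ρ₁ ρ₂ (tauHat σ ρ₁ ρ₂ N R c) x t‖ ^ 2 : ℝ) : ℂ) = ρ₂ ^ 2 *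
      ((shiftMat N β r β (weightedKernel β r (ρ₂ / ρ₁) (-(ρ₁ / ρ₂) * β) R c x t)).det *
      (shiftMatConj N β r β (weightedKernel β r (ρ₂ / ρ₁) (-(ρ₁ / ρ₂) * β) R c x t)).det /
      ((gramMat N β r (weightedKernel β r (ρ₂ / ρ₁) (-(ρ₁ / ρ₂) * β) R c x t)).det *
      (gramMatConj N β r (weightedKernel β r (ρ₂ / ρ₁) (-(ρ₁ / ρ₂) * β) R c x t)).det)) := by
    intro x t
    rw [waveV_eq hβ hr hr2 hc, norm_mul, norm_mul, norm_planeWave, mul_one, mul_pow,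
      Complex.norm_real, Real.norm_eq_abs, sq_abs, Complex.ofReal_mul, Complex.ofReal_pow,
      Complex.ofReal_pow, ← Complex.mul_conj', conj_shift_div_gram (hk x t), div_mul_div_comm]
  have hU : ∀ x t : ℝ, ((‖waveU σ ρ₁ ρ₂ N (OmegaHat σ ρ₁ ρ₂) (tauHat σ ρ₁ ρ₂ N R c) x t‖ ^ 2 : ℝ) :
      ℂ) = ρ₁ ^ 2 *
      ((shiftMat N β r 1 (weightedKernel β r (ρ₂ / ρ₁) (-(ρ₁ / ρ₂) * β) R c x t)).det *
      (shiftMatConj N β r 1 (weightedKernel β r (ρ₂ / ρ₁) (-(ρ₁ / ρ₂) * β) R c x t)).det /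
      ((gramMat N β r (weightedKernel β r (ρ₂ / ρ₁) (-(ρ₁ / ρ₂) * β) R c x t)).det *
      (gramMatConj N β r (weightedKernel β r (ρ₂ / ρ₁) (-(ρ₁ / ρ₂) * β) R c x t)).det)) := by
    intro x t
    rw [waveU_eq hβ hr hr2 hc, norm_mul, norm_mul, norm_mul, norm_planeWave, mul_one, norm_inv,
      norm_pow, norm_shiftFactor hr, one_pow, inv_one, mul_one, mul_pow,
      Complex.norm_real, Real.norm_eq_abs, sq_abs, Complex.ofReal_mul, Complex.ofReal_pow,
      Complex.ofReal_pow, ← Complex.mul_conj', conj_shift_div_gramMatConj (hk x t),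
      div_mul_div_comm]
    congr 2
    ring
  refine ⟨?_, ?_, fun x t => ?_, fun x t => ?_⟩
  · simp only [waveU, conj_tauHat hβ hr hr2 hc, div_eq_mul_inv]
    refine ContDiff.mul (contDiff_const.mul (ContDiff.mul (contDiff_const.mul
      (contDiff_tauHat hβ hr hr2 hc _ _ _ _)) (ContDiff.inv (contDiff_tauHat hβ hr hr2 hc _ _ _ _)
      fun z => ?_))) (contDiff_planeWave _)
    rw [← conj_tauHat hβ hr hr2 hc]
    exact (map_ne_zero _).mpr (hne _ _)
  · simp only [waveV, div_eq_mul_inv]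
    exact ContDiff.mul (contDiff_const.mul (ContDiff.mul
      (contDiff_tauHat hβ hr hr2 hc _ _ _ _) (ContDiff.inv (contDiff_tauHat hβ hr hr2 hc _ _ _ _)
      fun z => hne _ _))) (contDiff_planeWave _)
  · have h1 := (hasDerivAt_waveU_x (N := N) hr hr2 hβ0 (fun x => hk x t) (fun _ => rfl)
      (fun x => det_gramMatConj_ne_zero (hk x t) hr hβ0)
      (hasCoeffDerivAt_waveSeries_x hr hc (ρ₂ / ρ₁) (-(ρ₁ / ρ₂) * β) x t)).const_mul
      ((ρ₁ : ℂ) * (shiftFactor β r ^ N)⁻¹)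
    have h2 := h1.fun_mul (hasDerivAt_planeWave_x hβ x t)
    simp only [← waveU_eq hβ hr hr2 hc] at h2
    -- By the reduction the raised determinant is Ω₀^N times that of h, cancelling Ω₀^(-N) in u and
    -- producing the linear term v. The plane wave cancels the β term, and 1 - β = -σρ₁ρ₂ matches
    -- the cubic term.
    rw [h2.deriv, hV, waveU_eq hβ hr hr2 hc, waveV_eq hβ hr hr2 hc, det_raisedMat hr hr2]
    generalize (gramMat N β r _).det = f
    generalize (gramMatConj N β r _).det = fc
    generalize (shiftMat N β r 1 _).det = g
    generalize (shiftMat N β r β _).det = h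
    generalize (shiftMatConj N β r β _).det = hc
    generalize shiftFactor β r ^ N = S at *
    generalize planeWave σ ρ₁ ρ₂ x t = w
    push_cast
    have e1 : S * h / f = S * (h / f) := mul_div_assoc _ _ _
    rw [e1]
    generalize h / f = X
    generalize g / fc = Y
    generalize h * hc / (f * fc) = Z
    rw [hβ']
    field_simp
    rw [Complex.I_sq]
    ring
  · have h1 := (hasDerivAt_waveV_t (N := N) hr hr2 hβ0 (fun t => hk x t) (fun _ => rfl)
      (fun t => det_gramMatConj_ne_zero (hk x t) hr hβ0)
      (hasCoeffDerivAt_waveSeries_t hr hc (ρ₂ / ρ₁) (-(ρ₁ / ρ₂) * β) x t)).const_mul (ρ₂ : ℂ)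
    have h2 := h1.fun_mul (hasDerivAt_planeWave_t hβ x t)
    simp only [← waveV_eq hβ hr hr2 hc] at h2
    -- The determinant in u is Ω₀^N times the lowered one, so the Ω₀ powers cancel and u matches the
    -- lowered term in the t-derivative.
    rw [h2.deriv, hU, waveU_eq hβ hr hr2 hc, waveV_eq hβ hr hr2 hc, det_shiftMat_one hr hr2]
    generalize (gramMat N β r _).det = f
    generalize (gramMatConj N β r _).det = fc
    generalize (loweredMat N β r _).det = g
    generalize (shiftMat N β r β _).det = h
    generalize (shiftMatConj N β r 1 _).det = gc
    generalize shiftFactor β r ^ N = S at *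
    generalize planeWave σ ρ₁ ρ₂ x t = w
    push_cast
    have e1 : S * g / fc = S * (g / fc) := mul_div_assoc _ _ _
    rw [e1]
    generalize h / f = X
    generalize g / fc = Y
    generalize S * g * gc / (f * fc) = Z
    rw [hβ']
    field_simp
    rw [Complex.I_sq]
    ring

end Solution

end MTRogue

/-! ### The theorem -/

theorem theorem3 (σ ρ₁ ρ₂ : ℝ)
    (hρ : (σ = 1 ∧ -1 < ρ₁ * ρ₂ ∧ ρ₁ * ρ₂ < 0) ∨ (σ = -1 ∧ 0 < ρ₁ * ρ₂ ∧ ρ₁ * ρ₂ < 1))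
    (N : ℕ) (hN : 1 ≤ N) (a : ℕ → ℂ)
    (R : ℕ∞) (hR : ((2 * N - 1 : ℕ) : ℕ∞) ≤ R) (ha : R = ⊤ → MTRogue.HasPosRadius a) :
    -- the quotients `g / f*` and `h / f` are defined everywhere
    (∀ x t : ℝ, MTRogue.tauHat σ ρ₁ ρ₂ N R a 0 0 0 x t ≠ 0) ∧
    -- `f* = τ_{-1,0,0}`
    (∀ x t : ℝ, (starRingEnd ℂ) (MTRogue.tauHat σ ρ₁ ρ₂ N R a 0 0 0 x t) =
      MTRogue.tauHat σ ρ₁ ρ₂ N R a (-1) 0 0 x t) ∧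
    -- `u` and `v` solve the massive Thirring model
    MTRogue.IsMTSolution σ
      (MTRogue.waveU σ ρ₁ ρ₂ N (MTRogue.OmegaHat σ ρ₁ ρ₂) (MTRogue.tauHat σ ρ₁ ρ₂ N R a))
      (MTRogue.waveV σ ρ₁ ρ₂ (MTRogue.tauHat σ ρ₁ ρ₂ N R a)) ∧
    -- only the parameters `a_1, …, a_{2N-1}` enter
    MTRogue.tauHat σ ρ₁ ρ₂ N R a = MTRogue.tauHat σ ρ₁ ρ₂ N ((2 * N - 1 : ℕ) : ℕ∞) a ∧
    -- the form with the parameter `α > 0` gives the same functions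
    (∀ α : ℝ, 0 < α →
      MTRogue.OmegaPar α σ ρ₁ ρ₂ = MTRogue.OmegaHat σ ρ₁ ρ₂ ∧
      MTRogue.tauPar α σ ρ₁ ρ₂ N R a = MTRogue.tauHat σ ρ₁ ρ₂ N R a ∧
      MTRogue.waveU σ ρ₁ ρ₂ N (MTRogue.OmegaPar α σ ρ₁ ρ₂)
          (MTRogue.tauPar α σ ρ₁ ρ₂ N R a) =
        MTRogue.waveU σ ρ₁ ρ₂ N (MTRogue.OmegaHat σ ρ₁ ρ₂)
          (MTRogue.tauHat σ ρ₁ ρ₂ N R a) ∧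
      MTRogue.waveV σ ρ₁ ρ₂ (MTRogue.tauPar α σ ρ₁ ρ₂ N R a) =
        MTRogue.waveV σ ρ₁ ρ₂ (MTRogue.tauHat σ ρ₁ ρ₂ N R a)) := by
  -- Both sign cases amount to β ∈ (0,1), which makes β(1-β) positive and r a positive real number.
  have hs : -1 < σ * ρ₁ * ρ₂ ∧ σ * ρ₁ * ρ₂ < 0 := by
    rcases hρ with ⟨rfl, h1, h2⟩ | ⟨rfl, h1, h2⟩
    · constructor <;> linarith
    · constructor <;> linarith
  obtain ⟨β, hβ⟩ : ∃ β, β = 1 + σ * ρ₁ * ρ₂ := ⟨_, rfl⟩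
  have hpos : 0 < β * (1 - β) := mul_pos (by linarith) (by linarith)
  have hr : 0 < √(β * (1 - β)) := Real.sqrt_pos.mpr hpos
  have hr2 : √(β * (1 - β)) ^ 2 = β * (1 - β) := Real.sq_sqrt hpos.le
  have hβ0 : β ≠ 0 := by linarith
  have hρ₁ : ρ₁ ≠ 0 := by rintro rfl; simp at hs
  have hρ₂ : ρ₂ ≠ 0 := by rintro rfl; simp at hs
  refine ⟨MTRogue.tauHat_ne_zero hβ hr hr2 hβ0 ha, MTRogue.conj_tauHat hβ hr hr2 ha,
    MTRogue.isMTSolution hβ hr hr2 hβ0 hρ₁ hρ₂ ha, MTRogue.tauHat_congr hβ hr hr2 ha hR,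
    fun α hα => ?_⟩
  rw [hβ] at hpos
  have h1 := MTRogue.OmegaPar_eq hpos.le hα
  have h2 := MTRogue.tauPar_eq hpos.le hα N R a
  exact ⟨h1, h2, by rw [h1, h2], by rw [h2]⟩
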